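/- Let ${\cal B}_1,\dots,{\cal B}_4$ be the four non-orientable closed flat $3$-manifolds, ${\cal B}_i=\mathbb{R}^3/\Gamma_i$, where $\Gamma_i$ is the group of Euclidean isometries generated by - $\Gamma_1$: the translations by $(1,0,0)$, $(0,1,0)$, $(0,0,1)$ and the map $(x,y,z)\mapsto(x+\tfrac12,y,-z)$; - $\Gamma_2$: the translations by $(1,0,0)$, $(0,1,0)$, $(\tfrac12,\tfrac12,\tfrac12)$ and the map $(x,y,z)\mapsto(x+\tfrac12,y,-z)$; - $\Gamma_3$: the translations by $(1,0,0)$, $(0,1,0)$, $(0,0,1)$ and the maps $(x,y,z)\mapsto(x+\tfrac12,-y,-z)$ and $(x,y,z)\mapsto(x,y+\tfrac12,-z)$; - $\Gamma_4$: the translations by $(1,0,0)$, $(0,1,0)$, $(0,0,1)$ and the maps $(x,y,z)\mapsto(x+\tfrac12,-y,-z)$ and $(x,y,z)\mapsto(x,y+\tfrac12,-z+\tfrac12)$. (Their first homology groups are $\mathbb{Z}^2\oplus\mathbb{Z}_2$, $\mathbb{Z}^2$, $\mathbb{Z}\oplus\mathbb{Z}_2^2$ and $\mathbb{Z}\oplus\mathbb{Z}_4$.)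 Let $K_8$ be the $8$-vertex triangulation of the Klein bottle with triangles $$123,\ 124,\ 135,\ 146,\ 157,\ 168,\ 178,\ 236,\ 245,\ 258,\ 267,\ 278,\ 345,\ 346,\ 567,\ 568.$$ For an automorphism $\sigma$ of $K_8$, the twisted product triangulation $T_\sigma$ over $S^1$ is obtained from the staircase triangulation of $K_8\times I$, where $I$ is the interval with the four vertices $0<1<2<3$ and the vertices of $K_8$ are ordered $1<\dots<8$, by identifying each vertex $(v,3)$ with $(\sigma(v),0)$; it has $24$ vertices. (The faces of the staircase triangulation are the nonempty sets of vertices of $K_8\times I$ that are totally ordered in the product order and project onto a face of each factor.) A $3$-dimensional bistellar flip of a simplicial complex replaces a subcomplex $A*\partial B$ by $\partial A*B$, where $A$ is a face, $B$ is a nonempty vertex set disjoint from $A$ that is not a face, $|A|+|B|=5$, and the link of $A$ is $\partial B$. **Theorem.** The non-orientable flat $3$-manifolds ${\cal B}_1$, ${\cal B}_2$, ${\cal B}_3$, ${\cal B}_4$ can be triangulated with $17$, $16$, $17$ and $17$ vertices, respectively. Moreover, for each $i$ such a triangulation can be obtained by a finite sequence of bistellar flips from a twisted product triangulation $T_\sigma$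 of ${\cal B}_i$, where $\sigma$ is one of the following gluing automorphisms of $K_8$: - ${\cal B}_1$: $()$ or $(1,2)(5,6)$; - ${\cal B}_2$: $(1,5,2,6)(3,8)(4,7)$ or $(1,6,2,5)(3,8)(4,7)$; - ${\cal B}_3$: $(1,2)(3,4)(7,8)$ or $(3,4)(5,6)(7,8)$; - ${\cal B}_4$: $(1,5)(2,6)(3,7)(4,8)$ or $(1,6)(2,5)(3,7)(4,8)$. -/

import Mathlib

namespace FlatTriangulation

/-! ## Finite simplicial complexes and triangulations -/

/-- The simplicial complex whose faces are the nonempty subsets of the members of `F`. -/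
def complexOf {ι : Type*} (F : Set (Finset ι)) : PreAbstractSimplicialComplex ι where
  faces := {s | s.Nonempty ∧ ∃ f ∈ F, s ⊆ f}
  isRelLowerSet_faces := fun _ hs =>
    ⟨hs.1, fun _ hts ht => ⟨ht, hs.2.imp fun _ hf => ⟨hf.1, hts.trans hf.2⟩⟩⟩

/-- The vertices of a simplicial complex. -/
def vertices {ι : Type*} (K : PreAbstractSimplicialComplex ι) : Set ι :=
  {v | {v} ∈ K.faces}

/-- The geometric realization in barycentric coordinates: points with nonnegative coordinates
that vanish outside some face and sum to one over that face. For a finite complex the subspace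
topology from `ι → ℝ` is the usual topology of the polyhedron. -/
def realization {ι : Type*} (K : PreAbstractSimplicialComplex ι) : Set (ι → ℝ) :=
  {x | (∀ v, 0 ≤ x v) ∧ ∃ s ∈ K.faces, (∀ v, v ∉ s → x v = 0) ∧ ∑ v ∈ s, x v = 1}

/-- `K` is a (finite) triangulation of the space `X`. -/
def IsTriangulation {ι : Type*} (K : PreAbstractSimplicialComplex ι)
    (X : Type*) [TopologicalSpace X] : Prop :=
  K.faces.Finite ∧ Nonempty (realization K ≃ₜ X)

/-! ## Bistellar flips -/

/-- `K'` arises from `K` by a single bistellar flip of dimension `d`: there are a face `A` of `K`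
and a nonempty set `B`, not a face of `K`, with `|A| + |B| = d + 2`, such that the link of `A`
in `K` is the boundary complex of the simplex `B`; the subcomplex `A * ∂B` is replaced by
`∂A * B`. If `B` is a single vertex (not in `K`), this is the stellar subdivision of the
facet `A`. -/
def BistellarFlip {ι : Type*} [DecidableEq ι] (d : ℕ)
    (K K' : PreAbstractSimplicialComplex ι) : Prop :=
  ∃ A B : Finset ι, A ∈ K.faces ∧ B.Nonempty ∧ B ∉ K.faces ∧ Disjoint A B ∧
    A.card + B.card = d + 2 ∧
    (∀ t : Finset ι, Disjoint A t → (A ∪ t ∈ K.faces ↔ t ⊂ B)) ∧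
    ∀ t : Finset ι, t ∈ K'.faces ↔ (t ∈ K.faces ∧ ¬ A ⊆ t) ∨ (B ⊆ t ∧ t ⊂ A ∪ B)

/-- `K'` is obtained from `K` by a finite sequence of bistellar flips of dimension `d`. -/
def ObtainedByBistellarFlips {ι : Type*} [DecidableEq ι] (d : ℕ)
    (K K' : PreAbstractSimplicialComplex ι) : Prop :=
  Relation.ReflTransGen (BistellarFlip d) K K'

/-! ## Product and twisted product triangulations -/

/-- The staircase product triangulation of two complexes with ordered vertices: the faces are
the sets of pairs that form a chain for the product order (that is, lie on a monotone lattice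
path) and project onto a face of each factor. -/
def staircaseProduct {α β : Type*} [LinearOrder α] [LinearOrder β]
    (K : PreAbstractSimplicialComplex α) (L : PreAbstractSimplicialComplex β) :
    PreAbstractSimplicialComplex (α × β) where
  faces := {s | s.image Prod.fst ∈ K.faces ∧ s.image Prod.snd ∈ L.faces ∧
    IsChain (· ≤ ·) (s : Set (α × β))}
  isRelLowerSet_faces := fun _ hs =>
    ⟨Finset.image_nonempty.mp (K.isRelLowerSet_faces hs.1).1, fun _ hts ht =>
      ⟨(K.isRelLowerSet_faces hs.1).2 (Finset.image_subset_image hts) (ht.image _),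
        (L.isRelLowerSet_faces hs.2.1).2 (Finset.image_subset_image hts) (ht.image _),
        hs.2.2.mono (Finset.coe_subset.mpr hts)⟩⟩

/-- The interval triangulated with the four vertices `0 < 1 < 2 < 3`. -/
def interval : PreAbstractSimplicialComplex ℕ := complexOf {{0, 1}, {1, 2}, {2, 3}}

/-- The identification that glues the top layer to the bottom layer after applying `σ`:
the vertex `(v, 3)` becomes `(σ v, 0)`. -/
def glue (σ : Equiv.Perm ℕ) (p : ℕ × ℕ) : ℕ × ℕ :=
  if p.2 < 3 then p else (σ p.1, 0)

/-- The twisted product triangulation over the circle of a complex `M` with vertices in `ℕ`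
along a permutation `σ` of the vertices (an automorphism of `M`): take the product
triangulation of `M × I`, with `I` triangulated by four vertices, and glue its ends by `σ`. -/
def twistedProduct (M : PreAbstractSimplicialComplex ℕ) (σ : Equiv.Perm ℕ) :
    PreAbstractSimplicialComplex (ℕ × ℕ) :=
  (staircaseProduct M interval).map (glue σ)

/-- The 8-vertex triangulation of the Klein bottle with automorphism group the dihedral group
of order 8; cut along the closed paths 2-7-5-6-8-2 and 2-4-3-2 it becomes a disk whose boundary
runs twice along each of the two paths. -/
def kleinBottle8 : PreAbstractSimplicialComplex ℕ :=
  complexOf {{1, 2, 3}, {1, 2, 4}, {1, 3, 5}, {1, 4, 6}, {1, 5, 7}, {1, 6, 8}, {1, 7, 8},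
    {2, 3, 6}, {2, 4, 5}, {2, 5, 8}, {2, 6, 7}, {2, 7, 8}, {3, 4, 5}, {3, 4, 6},
    {5, 6, 7}, {5, 6, 8}}

/-- The gluing automorphisms of `kleinBottle8` whose twisted products are
`B₁`, `B₂`, `B₃`, `B₄` (indexed by `0, 1, 2, 3`). -/
def gluings : Fin 4 → Set (Equiv.Perm ℕ) :=
  ![{1, c[1, 2] * c[5, 6]},
    {c[1, 5, 2, 6] * c[3, 8] * c[4, 7], c[1, 6, 2, 5] * c[3, 8] * c[4, 7]},
    {c[1, 2] * c[3, 4] * c[7, 8], c[3, 4] * c[5, 6] * c[7, 8]},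
    {c[1, 5] * c[2, 6] * c[3, 7] * c[4, 8], c[1, 6] * c[2, 5] * c[3, 7] * c[4, 8]}]

/-! ## The non-orientable closed flat 3-manifolds -/

/-- Euclidean 3-space. -/
abbrev E3 : Type := EuclideanSpace ℝ (Fin 3)

/-- The Euclidean isometry `x ↦ (ε₀ x₀ + b₀, ε₁ x₁ + b₁, ε₂ x₂ + b₂)`. -/
noncomputable def signedTranslation (ε : Fin 3 → ℤˣ) (b : Fin 3 → ℝ) : E3 ≃ᵢ E3 :=
  IsometryEquiv.mk'
    (fun x => WithLp.toLp 2 fun i => ((ε i : ℤ) : ℝ) * x i + b i)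
    (fun x => WithLp.toLp 2 fun i => ((ε i : ℤ) : ℝ) * (x i - b i))
    (fun x => by
      ext i
      rcases Int.units_eq_one_or (ε i) with h | h <;> simp [h])
    (by
      refine Isometry.of_dist_eq fun x y => ?_
      rw [EuclideanSpace.dist_eq, EuclideanSpace.dist_eq]
      congr 1
      refine Finset.sum_congr rfl fun i _ => ?_
      rcases Int.units_eq_one_or (ε i) with h | h <;> simp [h, Real.dist_eq])

/-- The translation of Euclidean 3-space by `b`. -/
noncomputable def translation (b : Fin 3 → ℝ) : E3 ≃ᵢ E3 := signedTranslation 1 b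

/-- Generators of the fundamental groups of the four non-orientable closed flat 3-manifolds
`B₁`, `B₂`, `B₃`, `B₄` (indexed by `0, 1, 2, 3`) as groups of isometries of Euclidean 3-space:
three linearly independent translations together with

* `B₁`: the glide reflection `(x + 1/2, y, -z)`, the lattice being `ℤ³` (so `B₁ = K × S¹`);
* `B₂`: the same glide reflection, the lattice being spanned by
  `(1, 0, 0)`, `(0, 1, 0)`, `(1/2, 1/2, 1/2)`;
* `B₃`: the screw motion `(x + 1/2, -y, -z)` and the glide reflection `(x, y + 1/2, -z)`,
  the lattice being `ℤ³`;
* `B₄`: the screw motion `(x + 1/2, -y, -z)` and the glide reflection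
  `(x, y + 1/2, -z + 1/2)`, the lattice being `ℤ³`.

The abelianizations are `ℤ² ⊕ ℤ/2`, `ℤ²`, `ℤ ⊕ (ℤ/2)²`, `ℤ ⊕ ℤ/4`. -/
noncomputable def flatGenerators : Fin 4 → Set (E3 ≃ᵢ E3) :=
  ![{translation ![1, 0, 0], translation ![0, 1, 0], translation ![0, 0, 1],
      signedTranslation ![1, 1, -1] ![1 / 2, 0, 0]},
    {translation ![1, 0, 0], translation ![0, 1, 0], translation ![1 / 2, 1 / 2, 1 / 2],
      signedTranslation ![1, 1, -1] ![1 / 2, 0, 0]},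
    {translation ![1, 0, 0], translation ![0, 1, 0], translation ![0, 0, 1],
      signedTranslation ![1, -1, -1] ![1 / 2, 0, 0],
      signedTranslation ![1, 1, -1] ![0, 1 / 2, 0]},
    {translation ![1, 0, 0], translation ![0, 1, 0], translation ![0, 0, 1],
      signedTranslation ![1, -1, -1] ![1 / 2, 0, 0],
      signedTranslation ![1, 1, -1] ![0, 1 / 2, 1 / 2]}]

/-- The group of isometries generated by `flatGenerators i`. -/
noncomputable def flatGroup (i : Fin 4) : Subgroup (E3 ≃ᵢ E3) :=
  Subgroup.closure (flatGenerators i)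

/-- Two points are equivalent if they lie in the same orbit of the group `Γ` of isometries. -/
def orbitSetoid (Γ : Subgroup (E3 ≃ᵢ E3)) : Setoid E3 where
  r x y := ∃ g ∈ Γ, g x = y
  iseqv :=
    ⟨fun _ => ⟨1, Γ.one_mem, rfl⟩,
      fun {x _} ⟨g, hg, h⟩ => ⟨g⁻¹, Γ.inv_mem hg, by
        rw [← h]; exact IsometryEquiv.inv_apply_self g x⟩,
      fun ⟨g, hg, h⟩ ⟨k, hk, h2⟩ => ⟨k * g, Γ.mul_mem hk hg, by
        rw [IsometryEquiv.mul_apply, h, h2]⟩⟩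

/-- The non-orientable closed flat 3-manifolds `B₁`, `B₂`, `B₃`, `B₄` (indexed by `0, 1, 2, 3`)
as orbit spaces of Euclidean 3-space, with the quotient topology. -/
abbrev FlatB (i : Fin 4) : Type := Quotient (orbitSetoid (flatGroup i))

end FlatTriangulation

/-! The theorem splits into a geometric statement and a finite certificate.

Geometry: each manifold fibres over a circle with fibre a flat Klein bottle and isometric monodromy.
The complex `kleinBottle8` has a realisation in the plane, periodic under the glide `(x + 4, -y)`
and the translation `(x, y + 4)`, and the plane symmetries `x ↦ -x`, `y ↦ -y` and the half turn
about `(1, 1)` permute its triangles. So the monodromies that occur (identity, translation by `(2,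
2)`, half turns about `(0, 0)` and `(1, 1)`) induce automorphisms `σ` of the complex, and the
mapping torus of `σ` is the manifold. This is made explicit by a map from space to the polyhedron of
the twisted product: barycentric coordinates of the Klein bottle (`kleinCoord`) are coupled with
those of the interval (`coupling`), the ends are glued (`pushGlue`), and the result is continued to
all heights (`torusCoord`). Its fibres are exactly the orbits of the group and it is onto, so it
induces a continuous bijection from a compact quotient to a Hausdorff space, hence a homeomorphism
(`isTriangulation_twistedProduct`).

The staircase triangulation enters through the monotone coupling: two mass distributions on ordered
sets have exactly one coupling supported on a chain, which identifies the product of the polyhedra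
with the polyhedron of the staircase product (`coupling_mem_realization`, `exists_coupling_eq`,
`sum_coupling`).

Certificate: a bistellar flip does not change the polyhedron up to homeomorphism, by an explicit
piecewise linear map (`BistellarFlip.nonempty_homeomorph`). For each manifold an explicit list of
flips leads from the twisted product with 24 vertices to a complex with 17 or 16. Facets are stored
as bit masks, every flip is checked against the definition (`runFlips_eq_true`), and the vertices of
the result are counted by evaluation. -/

namespace FlatTriangulation

/-! ## Bistellar flips preserve the polyhedron -/

section FlipMap

variable {ι : Type*} [DecidableEq ι]

/-- Move mass from `A` to `B` along the line joining the barycentres, until the smallest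
coordinate on `A` vanishes. -/
noncomputable def flipMap (A B : Finset ι) (hA : A.Nonempty) (x : ι → ℝ) : ι → ℝ := fun v =>
  x v + A.inf' hA x * ((if v ∈ B then (A.card : ℝ) / B.card else 0) - if v ∈ A then 1 else 0)

theorem continuous_flipMap (A B : Finset ι) (hA : A.Nonempty) : Continuous (flipMap A B hA) := by
  refine continuous_pi fun v => ?_
  unfold flipMap
  refine (continuous_apply v).add (Continuous.mul ?_ continuous_const)
  exact Continuous.finset_inf'_apply hA fun i _ => continuous_apply i

theorem flipMap_eq_self {A B : Finset ι} {hA : A.Nonempty} {x : ι → ℝ} (h : A.inf' hA x = 0) :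
    flipMap A B hA x = x := by
  ext v; simp [flipMap, h]

/-- The definition is symmetric under exchanging `A` with `B`: no old face contains `B`, so the new
faces containing `B` are exactly the proper subsets of `A ∪ B` that do, and the link of `B` becomes
the boundary of `A`. Maps constructed for a flip can therefore be constructed for its inverse. -/
theorem BistellarFlip.symm {d : ℕ} {K K' : PreAbstractSimplicialComplex ι} {A B : Finset ι}
    (hA : A ∈ K.faces) (hB : B.Nonempty) (hBK : B ∉ K.faces) (hd : Disjoint A B)
    (hc : A.card + B.card = d + 2)
    (hl : ∀ t : Finset ι, Disjoint A t → (A ∪ t ∈ K.faces ↔ t ⊂ B))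
    (hK : ∀ t : Finset ι, t ∈ K'.faces ↔ (t ∈ K.faces ∧ ¬ A ⊆ t) ∨ (B ⊆ t ∧ t ⊂ A ∪ B)) :
    B ∈ K'.faces ∧ A.Nonempty ∧ A ∉ K'.faces ∧ Disjoint B A ∧ B.card + A.card = d + 2 ∧
    (∀ t : Finset ι, Disjoint B t → (B ∪ t ∈ K'.faces ↔ t ⊂ A)) ∧
    ∀ t : Finset ι, t ∈ K.faces ↔ (t ∈ K'.faces ∧ ¬ B ⊆ t) ∨ (A ⊆ t ∧ t ⊂ B ∪ A) := by
  have hAne : A.Nonempty := (K.isRelLowerSet_faces hA).1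
  have hup : ∀ t : Finset ι, B ⊆ t → t ∉ K.faces := fun t h ht =>
    hBK ((K.isRelLowerSet_faces ht).2 h hB)
  have hss : ∀ t : Finset ι, A ⊆ t → (t ∈ K.faces ↔ t ⊂ A ∪ B) := by
    intro t ht
    have := hl (t \ A) Finset.disjoint_sdiff
    rw [Finset.union_sdiff_of_subset ht] at this
    rw [this, Finset.ssubset_iff_subset_ne, Finset.ssubset_iff_subset_ne]
    constructor
    · rintro ⟨h1, h2⟩
      refine ⟨sdiff_le_iff.mp h1, ?_⟩
      rintro rfl
      exact h2 (by rw [Finset.union_sdiff_left, Finset.sdiff_eq_self_of_disjoint hd.symm])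
    · rintro ⟨h1, h2⟩
      refine ⟨sdiff_le_iff.mpr h1, ?_⟩
      intro h
      exact h2 (by rw [← h, Finset.union_sdiff_of_subset ht])
  have hAB : ¬ A ⊆ B := fun h => hAne.ne_empty (Finset.disjoint_self_iff_empty A |>.mp
    (hd.mono_right h))
  have hBA : ¬ B ⊆ A := fun h => hB.ne_empty (Finset.disjoint_self_iff_empty B |>.mp
    (hd.symm.mono_right h))
  refine ⟨(hK B).2 (Or.inr ⟨subset_rfl, ?_⟩), hAne, ?_, hd.symm, by omega, ?_, ?_⟩
  · exact ⟨Finset.subset_union_right, fun h => hAB (Finset.subset_union_left.trans h)⟩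
  · intro h
    rcases (hK A).1 h with h | h
    · exact h.2 subset_rfl
    · exact hBA h.1
  · intro t ht
    rw [hK]
    constructor
    · rintro (h | h)
      · exact absurd h.1 (hup _ Finset.subset_union_left)
      · have h1 := h.2.1
        refine ⟨fun x hx => ?_, fun h3 => h.2.2 ?_⟩
        · rcases Finset.mem_union.mp (h1 (Finset.mem_union_right _ hx)) with h2 | h2
          · exact h2
          · exact absurd hx (Finset.disjoint_left.mp ht h2)
        · exact Finset.union_subset (h3.trans Finset.subset_union_right) Finset.subset_union_left
    · intro h
      refine Or.inr ⟨Finset.subset_union_left, ?_, fun h3 => h.2 fun x hx => ?_⟩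
      · exact Finset.union_subset Finset.subset_union_right (h.1.trans Finset.subset_union_left)
      · rcases Finset.mem_union.mp (h3 (Finset.mem_union_left _ hx)) with h2 | h2
        · exact absurd h2 (Finset.disjoint_left.mp hd hx)
        · exact h2
  · intro t
    rw [hK, Finset.union_comm B A]
    by_cases hAt : A ⊆ t
    · have := hss t hAt
      have := hup t
      tauto
    · have := hup t
      tauto

/-- If the minimum over `A` is zero, the point lies in a face not containing `A` and stays fixed.
Otherwise its face contains `A`, so by the link condition it lies in `A ∪ B`; making the minimal
coordinate `a` vanish puts it in the face `(A ∪ B).erase a`, which the flip creates. The weight `|A|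
/ |B|` keeps the total mass equal to one. -/
theorem mapsTo_flipMap {K K' : PreAbstractSimplicialComplex ι} {A B : Finset ι}
    (hA : A.Nonempty) (hB : B.Nonempty) (hd : Disjoint A B)
    (hl : ∀ t : Finset ι, Disjoint A t → (A ∪ t ∈ K.faces ↔ t ⊂ B))
    (hK : ∀ t : Finset ι, t ∈ K'.faces ↔ (t ∈ K.faces ∧ ¬ A ⊆ t) ∨ (B ⊆ t ∧ t ⊂ A ∪ B)) :
    Set.MapsTo (flipMap A B hA) (realization K) (realization K') := by
  rintro x ⟨hx0, s, hs, hxs, hsum⟩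
  obtain ⟨a, ha, hm⟩ := Finset.exists_mem_eq_inf' hA x
  have hle : ∀ v ∈ A, x a ≤ x v := fun v hv => hm ▸ Finset.inf'_le x hv
  rcases (hx0 a).eq_or_lt with h0 | h0
  · rw [flipMap_eq_self (hm.trans h0.symm)]
    refine ⟨hx0, s.erase a, ?_, ?_, ?_⟩
    · refine (hK _).2 (Or.inl ⟨(K.isRelLowerSet_faces hs).2 (Finset.erase_subset _ _) ?_,
        fun h => Finset.notMem_erase a s (h ha)⟩)
      by_contra hne
      rw [Finset.not_nonempty_iff_eq_empty] at hne
      have := Finset.sum_erase s h0.symm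
      rw [hne, hsum] at this
      simp at this
    · intro v hv
      by_cases hva : v = a
      · rw [hva, ← h0]
      · exact hxs v fun h => hv (Finset.mem_erase.mpr ⟨hva, h⟩)
    · rw [Finset.sum_erase s h0.symm, hsum]
  · have hAs : A ⊆ s := fun v hv => by
      by_contra h
      have := hle v hv
      rw [hxs v h] at this
      linarith
    have ht : s \ A ⊂ B := by
      rw [← hl _ Finset.disjoint_sdiff, Finset.union_sdiff_of_subset hAs]; exact hs
    have hsAB : s ⊆ A ∪ B := sdiff_le_iff.mp ht.1
    have hBc : (0 : ℝ) < B.card := by exact_mod_cast hB.card_pos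
    have haB : a ∉ B := Finset.disjoint_left.mp hd ha
    have hya : flipMap A B hA x a = 0 := by
      simp [flipMap, hm, ha, haB]
    refine ⟨fun v => ?_, (A ∪ B).erase a, ?_, ?_, ?_⟩
    · unfold flipMap
      rw [hm]
      by_cases hvA : v ∈ A
      · have := hle v hvA
        simp [hvA, Finset.disjoint_left.mp hd hvA]
        linarith
      · have := hx0 v
        simp only [hvA, if_false, sub_zero]
        have : 0 ≤ x a * (if v ∈ B then (A.card : ℝ) / B.card else 0) := by
          split_ifs <;> positivity
        linarith
    · refine (hK _).2 (Or.inr ⟨fun v hv => ?_, Finset.erase_ssubset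
        (Finset.mem_union_left _ ha)⟩)
      exact Finset.mem_erase.mpr ⟨fun h => haB (h ▸ hv), Finset.mem_union_right _ hv⟩
    · intro v hv
      by_cases hva : v = a
      · rw [hva, hya]
      · have hv' : v ∉ A ∪ B := fun h => hv (Finset.mem_erase.mpr ⟨hva, h⟩)
        have h1 := Finset.notMem_union.mp hv'
        simp [flipMap, h1.1, h1.2, hxs v fun h => hv' (hsAB h)]
    · rw [Finset.sum_erase _ hya]
      simp only [flipMap]
      rw [Finset.sum_add_distrib, ← Finset.mul_sum, Finset.sum_sub_distrib,
        ← Finset.sum_subset hsAB fun v _ hv => hxs v hv, hsum]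
      simp only [Finset.sum_ite_mem, Finset.union_inter_cancel_left,
        Finset.union_inter_cancel_right, Finset.sum_const, nsmul_eq_mul]
      field_simp
      ring

/-- Since `B` is not a face, some coordinate on `B` is zero beforehand. Hence the minimum over `B`
afterwards is exactly the amount that was added to each vertex of `B`, and the reverse map takes
away precisely that. -/
theorem flipMap_flipMap {K : PreAbstractSimplicialComplex ι} {A B : Finset ι}
    (hA : A.Nonempty) (hB : B.Nonempty) (hBK : B ∉ K.faces) (hd : Disjoint A B)
    {x : ι → ℝ} (hx : x ∈ realization K) :
    flipMap B A hB (flipMap A B hA x) = x := by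
  obtain ⟨hx0, s, hs, hxs, -⟩ := hx
  obtain ⟨b, hb, hxb⟩ : ∃ b ∈ B, x b = 0 := by
    by_contra! h
    refine hBK ((K.isRelLowerSet_faces hs).2 (fun v hv => ?_) hB)
    by_contra hvs
    exact h v hv (hxs v hvs)
  have hAc : (0 : ℝ) < A.card := by exact_mod_cast hA.card_pos
  have hBc : (0 : ℝ) < B.card := by exact_mod_cast hB.card_pos
  have hmin : B.inf' hB (flipMap A B hA x) = A.inf' hA x * (A.card / B.card) := by
    apply le_antisymm
    · refine (Finset.inf'_le _ hb).trans_eq ?_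
      simp [flipMap, hb, Finset.disjoint_right.mp hd hb, hxb]
    · refine Finset.le_inf' _ _ fun v hv => ?_
      have := hx0 v
      simp [flipMap, hv, Finset.disjoint_right.mp hd hv]
      linarith
  ext v
  rw [flipMap, hmin]
  unfold flipMap
  by_cases hvA : v ∈ A
  · simp [hvA, Finset.disjoint_left.mp hd hvA]
    field_simp
    ring
  · by_cases hvB : v ∈ B
    · simp [hvA, hvB]
    · simp [hvA, hvB]

theorem BistellarFlip.nonempty_homeomorph {d : ℕ} {K K' : PreAbstractSimplicialComplex ι}
    (h : BistellarFlip d K K') : Nonempty (realization K ≃ₜ realization K') := by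
  obtain ⟨A, B, hA, hB, hBK, hd, hc, hl, hK⟩ := h
  obtain ⟨hB', hAne, hAK', hd', hc', hl', hK'⟩ := BistellarFlip.symm hA hB hBK hd hc hl hK
  have h1 := mapsTo_flipMap hAne hB hd hl hK
  have h2 := mapsTo_flipMap hB hAne hd' hl' hK'
  exact ⟨{ toFun := h1.restrict
           invFun := h2.restrict
           left_inv := fun x => Subtype.ext (flipMap_flipMap hAne hB hBK hd x.2)
           right_inv := fun x => Subtype.ext (flipMap_flipMap hB hAne hAK' hd' x.2)
           continuous_toFun := (continuous_flipMap A B hAne).restrict h1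
           continuous_invFun := (continuous_flipMap B A hB).restrict h2 }⟩

theorem BistellarFlip.finite_faces {d : ℕ} {K K' : PreAbstractSimplicialComplex ι}
    (h : BistellarFlip d K K') (hK : K.faces.Finite) : K'.faces.Finite := by
  obtain ⟨A, B, -, -, -, -, -, -, hK'⟩ := h
  refine (hK.union (A ∪ B).powerset.finite_toSet).subset fun t ht => ?_
  rcases (hK' t).1 ht with h | h
  · exact Or.inl h.1
  · exact Or.inr (Finset.mem_coe.mpr (Finset.mem_powerset.mpr h.2.1))

theorem ObtainedByBistellarFlips.isTriangulation {d : ℕ} {K K' : PreAbstractSimplicialComplex ι}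
    (h : ObtainedByBistellarFlips d K K') {X : Type*} [TopologicalSpace X]
    (hK : IsTriangulation K X) : IsTriangulation K' X := by
  induction h with
  | refl => exact hK
  | tail _ h ih =>
    obtain ⟨e⟩ := h.nonempty_homeomorph
    obtain ⟨f⟩ := ih.2
    exact ⟨h.finite_faces ih.1, ⟨e.symm.trans f⟩⟩

end FlipMap

/-! ## Bistellar flips on lists of facets -/

/-- The link condition in terms of facets: every facet containing `A` lies in `A ∪ B`, all the sets
`(A ∪ B).erase b` are facets, and no facet contains `B`. This is the form that can be tested on a
list. -/
theorem complexOf_bistellarFlip {ι : Type*} [DecidableEq ι] {d : ℕ} {F : Set (Finset ι)}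
    {A B : Finset ι} (hA : A.Nonempty) (hB : B.Nonempty) (hd : Disjoint A B)
    (hc : A.card + B.card = d + 2) (hBF : ∀ f ∈ F, ¬ B ⊆ f) (hst : ∀ f ∈ F, A ⊆ f → f ⊆ A ∪ B)
    (hb : ∀ b ∈ B, (A ∪ B).erase b ∈ F) :
    BistellarFlip d (complexOf F)
      (complexOf ({f | f ∈ F ∧ ¬ A ⊆ f} ∪ {f | ∃ a ∈ A, f = (A ∪ B).erase a})) := by
  have hAB : ∀ b ∈ B, A ⊆ (A ∪ B).erase b := fun b hb v hv => Finset.mem_erase.mpr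
    ⟨fun h => Finset.disjoint_left.mp hd hv (h ▸ hb), Finset.mem_union_left _ hv⟩
  refine ⟨A, B, ⟨hA, ?_⟩, hB, ?_, hd, hc, fun t ht => ⟨?_, fun h => ⟨?_, ?_⟩⟩, fun t => ⟨?_, ?_⟩⟩
  · obtain ⟨b, hb'⟩ := hB
    exact ⟨_, hb b hb', hAB b hb'⟩
  · rintro ⟨-, f, hf, h⟩
    exact hBF f hf h
  · rintro ⟨-, f, hf, h⟩
    refine ⟨fun v hv => ?_, fun h' => hBF f hf (h'.trans (Finset.subset_union_right.trans h))⟩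
    rcases Finset.mem_union.mp (hst f hf (Finset.subset_union_left.trans h)
      (h (Finset.mem_union_right _ hv))) with h' | h'
    · exact absurd hv (Finset.disjoint_left.mp ht h')
    · exact h'
  · exact hA.mono Finset.subset_union_left
  · obtain ⟨b, hb', hbt⟩ := Finset.exists_of_ssubset h
    refine ⟨_, hb b hb', Finset.union_subset (hAB b hb') fun v hv => ?_⟩
    exact Finset.mem_erase.mpr ⟨fun h' => hbt (h' ▸ hv), Finset.mem_union_right _ (h.1 hv)⟩
  · rintro ⟨hne, f, hf | ⟨a, ha, rfl⟩, htf⟩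
    · exact Or.inl ⟨⟨hne, f, hf.1, htf⟩, fun h => hf.2 (h.trans htf)⟩
    · have hat : a ∉ t := fun h => Finset.notMem_erase _ _ (htf h)
      have htU := htf.trans (Finset.erase_subset _ _)
      -- A subset of a new facet that misses some `b ∈ B` already lay in the old facet `(A ∪
      -- B).erase b`.
      by_cases hBt : B ⊆ t
      · exact Or.inr ⟨hBt, htU, fun h => hat (h (Finset.mem_union_left _ ha))⟩
      · obtain ⟨b, hb', hbt⟩ := Finset.not_subset.mp hBt
        refine Or.inl ⟨⟨hne, _, hb b hb', fun v hv => ?_⟩, fun h => hat (h ha)⟩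
        exact Finset.mem_erase.mpr ⟨fun h => hbt (h ▸ hv), htU hv⟩
  · have key : t.Nonempty → t ⊆ A ∪ B → ¬ A ⊆ t →
        t ∈ (complexOf ({f | f ∈ F ∧ ¬ A ⊆ f} ∪ {f | ∃ a ∈ A, f = (A ∪ B).erase a})).faces := by
      intro hne htU hAt
      obtain ⟨a, ha, hat⟩ := Finset.not_subset.mp hAt
      exact ⟨hne, _, Or.inr ⟨a, ha, rfl⟩, fun v hv =>
        Finset.mem_erase.mpr ⟨fun h => hat (h ▸ hv), htU hv⟩⟩
    rintro (⟨⟨hne, f, hf, htf⟩, hAt⟩ | ⟨hBt, htU, h⟩)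
    · by_cases hAf : A ⊆ f
      · exact key hne (htf.trans (hst f hf hAf)) hAt
      · exact ⟨hne, f, Or.inl ⟨hf, hAf⟩, htf⟩
    · exact key (hB.mono hBt) htU fun hAt => h (Finset.union_subset hAt hBt)

/-! ### Vertex sets as bit masks -/

/-- The vertex with number `n`: eight vertices per layer, numbered from one. -/
def vertexOfNat : ℕ ↪ ℕ × ℕ where
  toFun n := (n % 8 + 1, n / 8)
  inj' m n h := by simp at h; omega

/-- The number of a vertex. -/
def vertexNumber (p : ℕ × ℕ) : ℕ := 8 * p.2 + (p.1 - 1)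

theorem vertexOfNat_vertexNumber {p : ℕ × ℕ} (h1 : 1 ≤ p.1) (h8 : p.1 ≤ 8) :
    vertexOfNat (vertexNumber p) = p := by
  refine Prod.ext ?_ ?_
  · change (8 * p.2 + (p.1 - 1)) % 8 + 1 = p.1
    omega
  · change (8 * p.2 + (p.1 - 1)) / 8 = p.2
    omega

/-- The set of vertices encoded by the binary digits of `m`. -/
def maskSet (m : ℕ) : Finset (ℕ × ℕ) := m.bitIndices.toFinset.map vertexOfNat

/-- The bit mask of a list of vertex numbers. -/
def mask : List ℕ → ℕ := List.foldr (fun v m => Nat.lor (Nat.pow 2 v) m) 0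

theorem mem_maskSet {m : ℕ} {p : ℕ × ℕ} :
    p ∈ maskSet m ↔ ∃ i, m.testBit i = true ∧ vertexOfNat i = p := by
  simp [maskSet]

theorem vertexOfNat_mem_maskSet {m i : ℕ} : vertexOfNat i ∈ maskSet m ↔ m.testBit i = true := by
  simp [maskSet]

theorem testBit_mask {l : List ℕ} {i : ℕ} : (mask l).testBit i = true ↔ i ∈ l := by
  induction l with
  | nil => simp [mask]
  | cons a l ih =>
    have : mask (a :: l) = 2 ^ a ||| mask l := rfl
    rw [this, Nat.testBit_or, Bool.or_eq_true, ih, Nat.testBit_two_pow]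
    simp [eq_comm]

theorem maskSet_mask (l : List ℕ) : maskSet (mask l) = l.toFinset.map vertexOfNat := by
  ext p
  simp [mem_maskSet, testBit_mask]

theorem maskSet_subset {a b : ℕ} : maskSet a ⊆ maskSet b ↔ Nat.land a b = a := by
  constructor
  · intro h
    refine Nat.eq_of_testBit_eq fun i => ?_
    change (a &&& b).testBit i = _
    rw [Nat.testBit_and]
    have := @h (vertexOfNat i)
    rw [vertexOfNat_mem_maskSet, vertexOfNat_mem_maskSet] at this
    cases ha : a.testBit i
    · simp
    · simp [this ha]
  · intro h p
    rw [mem_maskSet, mem_maskSet]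
    rintro ⟨i, hi, rfl⟩
    refine ⟨i, ?_, rfl⟩
    rw [← h] at hi
    change (a &&& b).testBit i = _ at hi
    rw [Nat.testBit_and] at hi
    simp at hi
    exact hi.2

theorem maskSet_lor (a b : ℕ) : maskSet (Nat.lor a b) = maskSet a ∪ maskSet b := by
  ext p
  simp only [Finset.mem_union, mem_maskSet]
  have : ∀ i, (Nat.lor a b).testBit i = (a.testBit i || b.testBit i) := Nat.testBit_or a b
  simp only [this, Bool.or_eq_true, or_and_right, exists_or]

theorem maskSet_xor_two_pow {m i : ℕ} (h : m.testBit i = true) :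
    maskSet (Nat.xor m (Nat.pow 2 i)) = (maskSet m).erase (vertexOfNat i) := by
  have key : ∀ j, (Nat.xor m (Nat.pow 2 i)).testBit j = (m.testBit j ^^ decide (i = j)) := by
    intro j
    change (m ^^^ 2 ^ i).testBit j = _
    rw [Nat.testBit_xor, Nat.testBit_two_pow]
  ext p
  simp only [Finset.mem_erase, mem_maskSet, key]
  constructor
  · rintro ⟨j, hj, rfl⟩
    by_cases hij : i = j
    · subst hij; simp [h] at hj
    · simp [hij] at hj
      exact ⟨fun h => hij (vertexOfNat.injective h).symm, j, hj, rfl⟩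
  · rintro ⟨hne, j, hj, rfl⟩
    have : i ≠ j := fun h => hne (by rw [h])
    exact ⟨j, by simp [hj, this], rfl⟩

/-- The complex whose facets are encoded by a list of bit masks. -/
def maskComplex (L : List ℕ) : PreAbstractSimplicialComplex (ℕ × ℕ) :=
  complexOf {f | ∃ m ∈ L, f = maskSet m}

/-- Boolean test that a list has no repetitions. -/
def nodupTest (l : List ℕ) : Bool :=
  List.rec true (fun x t ih => t.all (fun y => !Nat.beq x y) && ih) l

theorem nodup_of_nodupTest {l : List ℕ} (h : nodupTest l = true) : l.Nodup := by
  induction l with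
  | nil => exact List.nodup_nil
  | cons x t ih =>
    have h' : (t.all (fun y => !Nat.beq x y) && nodupTest t) = true := h
    rw [Bool.and_eq_true, List.all_eq_true] at h'
    refine List.nodup_cons.mpr ⟨fun hx => ?_, ih h'.2⟩
    have := h'.1 x hx
    simp at this

/-- The conditions for a flip that removes the face with vertices `a` and inserts the one with
vertices `b`; `star` lists the facets that contain `a`, and `rest` the others. -/
def flipTest (a b : List ℕ) (star rest : List ℕ) : Bool :=
  nodupTest (a ++ b) && (Nat.beq (a.length + b.length) 5 &&
  (b.all (fun v => star.any (Nat.beq (Nat.xor (Nat.lor (mask a) (mask b)) (Nat.pow 2 v)))) &&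
  (star.all (fun f => Nat.beq (Nat.land f (Nat.lor (mask a) (mask b))) f &&
      !Nat.beq (Nat.land (mask b) f) (mask b)) &&
  rest.all (fun f => !Nat.beq (Nat.land (mask b) f) (mask b)))))

/-- The facets inserted by a flip. -/
def newFacets (a b : List ℕ) : List ℕ :=
  a.map fun v => Nat.xor (Nat.lor (mask a) (mask b)) (Nat.pow 2 v)

/-- The tests are the hypotheses of `complexOf_bistellarFlip` read on masks. Absence of repetitions
in `a ++ b` gives both the disjointness and the cardinalities. -/
theorem bistellarFlip_of_flipTest {a b L star rest : List ℕ} (ha : a ≠ []) (hb : b ≠ [])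
    (hL : ∀ m, m ∈ L ↔ m ∈ star ∨ m ∈ rest)
    (hstar : ∀ m ∈ star, Nat.land (mask a) m = mask a)
    (hrest : ∀ m ∈ rest, Nat.land (mask a) m ≠ mask a)
    (h : flipTest a b star rest = true) :
    BistellarFlip 3 (maskComplex L) (maskComplex (newFacets a b ++ rest)) := by
  simp only [flipTest, Bool.and_eq_true, List.all_eq_true, List.any_eq_true, Bool.not_eq_true',
    ← Bool.not_eq_true, Nat.beq_eq] at h
  obtain ⟨h1, h2, h3, h4, h5⟩ := h
  have hnd := nodup_of_nodupTest h1
  have hab := List.nodup_append.mp hnd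
  have hU : maskSet (Nat.lor (mask a) (mask b)) = maskSet (mask a) ∪ maskSet (mask b) :=
    maskSet_lor _ _
  -- Exclusive or with `2 ^ v` erases `v` only if the bit is set; otherwise it would insert it.
  have hbit : ∀ v, v ∈ a ∨ v ∈ b → (Nat.lor (mask a) (mask b)).testBit v = true := by
    intro v hv
    have := Nat.testBit_or (mask a) (mask b) v
    change (Nat.lor (mask a) (mask b)).testBit v = _ at this
    rw [this, Bool.or_eq_true, testBit_mask, testBit_mask]
    exact hv
  have hmem : ∀ l p, p ∈ maskSet (mask l) ↔ ∃ v ∈ l, vertexOfNat v = p := by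
    intro l p
    simp [maskSet_mask]
  have hcard : ∀ l : List ℕ, l.Nodup → (maskSet (mask l)).card = l.length := by
    intro l hl
    rw [maskSet_mask, Finset.card_map, List.toFinset_card_of_nodup hl]
  have hne : ∀ l : List ℕ, l ≠ [] → (maskSet (mask l)).Nonempty := by
    intro l hl
    obtain ⟨v, hv⟩ := List.exists_mem_of_ne_nil l hl
    exact ⟨_, (hmem l _).2 ⟨v, hv, rfl⟩⟩
  have key := complexOf_bistellarFlip (d := 3) (F := {f | ∃ m ∈ L, f = maskSet m})
    (A := maskSet (mask a)) (B := maskSet (mask b)) (hne a ha) (hne b hb) ?_ ?_ ?_ ?_ ?_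
  · refine (congrArg (BistellarFlip 3 (maskComplex L)) ?_).mpr key
    refine congrArg complexOf (Set.ext fun f => ?_)
    change (∃ m ∈ newFacets a b ++ rest, f = maskSet m) ↔
      ((∃ m ∈ L, f = maskSet m) ∧ ¬ maskSet (mask a) ⊆ f) ∨ ∃ p ∈ maskSet (mask a),
        f = (maskSet (mask a) ∪ maskSet (mask b)).erase p
    simp only [List.mem_append, or_and_right, exists_or, newFacets, List.mem_map]
    rw [or_comm]
    refine or_congr ⟨?_, ?_⟩ ⟨?_, ?_⟩
    · rintro ⟨m, hm, rfl⟩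
      exact ⟨⟨m, (hL m).2 (Or.inr hm), rfl⟩, fun h => hrest m hm (maskSet_subset.mp h)⟩
    · rintro ⟨⟨m, hm, rfl⟩, h⟩
      rcases (hL m).1 hm with h' | h'
      · exact absurd (maskSet_subset.mpr (hstar m h')) h
      · exact ⟨m, h', rfl⟩
    · rintro ⟨m, ⟨v, hv, rfl⟩, rfl⟩
      refine ⟨vertexOfNat v, (hmem a _).2 ⟨v, hv, rfl⟩, ?_⟩
      rw [maskSet_xor_two_pow (hbit v (Or.inl hv)), hU]
    · rintro ⟨p, hp, rfl⟩
      obtain ⟨v, hv, rfl⟩ := (hmem a p).1 hp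
      exact ⟨_, ⟨v, hv, rfl⟩, by rw [maskSet_xor_two_pow (hbit v (Or.inl hv)), hU]⟩
  · rw [Finset.disjoint_left]
    intro p hp hp'
    obtain ⟨v, hv, rfl⟩ := (hmem a p).1 hp
    obtain ⟨w, hw, hwv⟩ := (hmem b _).1 hp'
    exact hab.2.2 v hv w hw (vertexOfNat.injective hwv).symm
  · rw [hcard a hab.1, hcard b hab.2.1, h2]
  · rintro f ⟨m, hm, rfl⟩ hs
    rw [maskSet_subset] at hs
    rcases (hL m).1 hm with h' | h'
    · exact (h4 m h').2 hs
    · exact h5 m h' hs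
  · rintro f ⟨m, hm, rfl⟩ hs
    rcases (hL m).1 hm with h' | h'
    · rw [← hU, maskSet_subset]
      exact (h4 m h').1
    · exact absurd (maskSet_subset.mp hs) (hrest m h')
  · intro p hp
    obtain ⟨v, hv, rfl⟩ := (hmem b p).1 hp
    obtain ⟨m, hm, rfl⟩ := h3 v hv
    exact ⟨_, (hL _).2 (Or.inl hm), by rw [maskSet_xor_two_pow (hbit v (Or.inr hv)), hU]⟩

/-- Split a list of masks into those that contain `A` and the others, and pass both to `k`. -/
def splitStar (A : ℕ) (L : List ℕ) : List ℕ → List ℕ → (List ℕ → List ℕ → Bool) → Bool :=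
  List.rec (fun star rest k => k star rest)
    (fun f _ ih star rest k => cond (Nat.beq (Nat.land A f) A) (ih (f :: star) rest k)
      (ih star (f :: rest) k)) L

/-- The accumulators reverse the order of the facets, but only membership matters for the complex.
-/
theorem splitStar_eq_true {A : ℕ} {L star rest : List ℕ} {k : List ℕ → List ℕ → Bool}
    (h : splitStar A L star rest k = true) :
    ∃ s r, k s r = true ∧ (∀ m, m ∈ s ↔ m ∈ star ∨ m ∈ L ∧ Nat.land A m = A) ∧
      ∀ m, m ∈ r ↔ m ∈ rest ∨ m ∈ L ∧ Nat.land A m ≠ A := by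
  induction L generalizing star rest with
  | nil => exact ⟨star, rest, h, by simp, by simp⟩
  | cons f L ih =>
    have h' : cond (Nat.beq (Nat.land A f) A) (splitStar A L (f :: star) rest k)
      (splitStar A L star (f :: rest) k) = true := h
    cases hf : Nat.beq (Nat.land A f) A
    · rw [hf] at h'
      obtain ⟨s, r, hk, hs, hr⟩ := ih h'
      have hf' : Nat.land A f ≠ A := by
        rw [Ne, ← Nat.beq_eq, hf]; simp
      refine ⟨s, r, hk, fun m => ?_, fun m => ?_⟩
      · rw [hs]
        simp only [List.mem_cons]
        by_cases hm : m = f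
        · subst hm; tauto
        · simp only [hm, false_or]
      · rw [hr]
        simp only [List.mem_cons]
        by_cases hm : m = f
        · subst hm; tauto
        · simp only [hm, false_or]
    · rw [hf] at h'
      obtain ⟨s, r, hk, hs, hr⟩ := ih h'
      have hf' : Nat.land A f = A := Nat.beq_eq ▸ hf
      refine ⟨s, r, hk, fun m => ?_, fun m => ?_⟩
      · rw [hs]
        simp only [List.mem_cons]
        by_cases hm : m = f
        · subst hm; tauto
        · simp only [hm, false_or]
      · rw [hr]
        simp only [List.mem_cons]
        by_cases hm : m = f
        · subst hm; tauto
        · simp only [hm, false_or]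

/-- Perform a list of flips on a list of facets, checking each of them, and apply the test `k`
to the result. A flip is encoded by a number: its last two binary digits give the size of the
removed face, and the following five digits to base 32 the vertices of the removed face and of
the inserted one. -/
def runFlips (cs : List ℕ) : List ℕ → (List ℕ → Bool) → Bool :=
  List.rec (fun L k => k L)
    (fun c _ ih L k =>
      List.rec (motive := fun _ => List ℕ → List ℕ → Bool) (fun _ _ => false)
        (fun a0 a' _ b _ =>
          List.rec (motive := fun _ => Bool) false (fun b0 b' _ =>
            splitStar (mask (a0 :: a')) L [] [] fun star rest =>
              flipTest (a0 :: a') (b0 :: b') star rest &&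
                ih (newFacets (a0 :: a') (b0 :: b') ++ rest) k) b)
        (List.take (c % 4) [c / 4 % 32, c / 128 % 32, c / 4096 % 32, c / 131072 % 32, c / 4194304])
        (List.drop (c % 4) [c / 4 % 32, c / 128 % 32, c / 4096 % 32, c / 131072 % 32, c / 4194304])
        [])
    cs

/-- Nothing has to be proved about the encoding of the flips: whatever sets are decoded, `flipTest`
establishes that they form a legitimate flip of the current complex. As the removed face is given at
most three of the five digits, facet subdivisions cannot be encoded and no flip adds a vertex. -/
theorem runFlips_eq_true {cs L : List ℕ} {k : List ℕ → Bool} (h : runFlips cs L k = true) :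
    ∃ L', k L' = true ∧ ObtainedByBistellarFlips 3 (maskComplex L) (maskComplex L') := by
  induction cs generalizing L with
  | nil => exact ⟨L, h, Relation.ReflTransGen.refl⟩
  | cons c cs ih =>
    simp only [runFlips] at h
    -- The decoded lists may be arbitrary from here on; an empty one makes the run fail.
    generalize List.take (c % 4)
      [c / 4 % 32, c / 128 % 32, c / 4096 % 32, c / 131072 % 32, c / 4194304] = a at h
    generalize List.drop (c % 4)
      [c / 4 % 32, c / 128 % 32, c / 4096 % 32, c / 131072 % 32, c / 4194304] = b at h
    cases a with
    | nil => simp at h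
    | cons a0 a' =>
      cases b with
      | nil => simp at h
      | cons b0 b' =>
        obtain ⟨s, r, hk, hs, hr⟩ := splitStar_eq_true h
        rw [Bool.and_eq_true] at hk
        obtain ⟨L', hL', hL''⟩ := ih hk.2
        refine ⟨L', hL', Relation.ReflTransGen.head (bistellarFlip_of_flipTest (by simp) (by simp)
          (fun m => ?_) (fun m hm => ?_) (fun m hm => ?_) hk.1) hL''⟩
        · rw [hs, hr]
          simp only [List.not_mem_nil, false_or]
          tauto
        · exact (((hs m).1 hm).resolve_left (by simp)).2
        · exact (((hr m).1 hm).resolve_left (by simp)).2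

/-! ## Facets of the twisted products of the Klein bottle -/

/-- The triangles of `kleinBottle8`, with sorted vertices. -/
def kleinTriangles : List (ℕ × ℕ × ℕ) :=
  [(1, 2, 3), (1, 2, 4), (1, 3, 5), (1, 4, 6), (1, 5, 7), (1, 6, 8), (1, 7, 8),
    (2, 3, 6), (2, 4, 5), (2, 5, 8), (2, 6, 7), (2, 7, 8), (3, 4, 5), (3, 4, 6),
    (5, 6, 7), (5, 6, 8)]

theorem mem_kleinBottle8 {s : Finset ℕ} : s ∈ kleinBottle8.faces ↔
    s.Nonempty ∧ ∃ t ∈ kleinTriangles, s ⊆ {t.1, t.2.1, t.2.2} := by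
  refine and_congr_right fun _ => ?_
  simp only [kleinTriangles, List.mem_cons, List.not_mem_nil, or_false, exists_eq_or_imp,
    exists_eq_left]
  simp only [Set.mem_insert_iff, Set.mem_singleton_iff, exists_eq_or_imp, exists_eq_left]

theorem kleinTriangles_bounds : ∀ t ∈ kleinTriangles,
    1 ≤ t.1 ∧ t.1 < t.2.1 ∧ t.2.1 < t.2.2 ∧ t.2.2 ≤ 8 := by
  decide

theorem mem_interval {s : Finset ℕ} : s ∈ interval.faces ↔
    s.Nonempty ∧ ∃ j < 3, s ⊆ {j, j + 1} := by
  refine and_congr_right fun _ => ⟨?_, ?_⟩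
  · rintro ⟨f, hf, hs⟩
    rcases hf with rfl | rfl | rfl
    exacts [⟨0, by norm_num, hs⟩, ⟨1, by norm_num, hs⟩, ⟨2, by norm_num, hs⟩]
  · rintro ⟨j, hj, hs⟩
    interval_cases j
    exacts [⟨_, by simp, hs⟩, ⟨_, by simp, hs⟩, ⟨_, by simp, hs⟩]

/-- The three maximal chains of the prism over a triangle between the layers `j` and `j + 1`. -/
def prismChains (t : ℕ × ℕ × ℕ) (j : ℕ) : List (List (ℕ × ℕ)) :=
  [[(t.1, j), (t.1, j + 1), (t.2.1, j + 1), (t.2.2, j + 1)],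
    [(t.1, j), (t.2.1, j), (t.2.1, j + 1), (t.2.2, j + 1)],
    [(t.1, j), (t.2.1, j), (t.2.2, j), (t.2.2, j + 1)]]

/-- A chain over a triangle `a < b < c` and two adjacent layers climbs at one vertex of the
triangle, and the three choices of that vertex give the three tetrahedra of the prism. -/
theorem mem_staircaseProduct_kleinBottle8 {s : Finset (ℕ × ℕ)} :
    s ∈ (staircaseProduct kleinBottle8 interval).faces ↔
      s.Nonempty ∧ ∃ t ∈ kleinTriangles, ∃ j < 3, ∃ c ∈ prismChains t j, s ⊆ c.toFinset := by
  constructor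
  · rintro ⟨h1, h2, h3⟩
    obtain ⟨hne, t, ht, hst⟩ := mem_kleinBottle8.1 h1
    obtain ⟨-, j, hj, hsj⟩ := mem_interval.1 h2
    obtain ⟨-, hab, hbc, -⟩ := kleinTriangles_bounds t ht
    obtain ⟨a, b, c⟩ := t
    simp only at hst hab hbc
    refine ⟨Finset.image_nonempty.mp hne, _, ht, j, hj, ?_⟩
    have hs : ∀ u v, (u, v) ∈ s → (u = a ∨ u = b ∨ u = c) ∧ (v = j ∨ v = j + 1) := by
      intro u v huv
      have h4 := hst (Finset.mem_image_of_mem _ huv)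
      have h5 := hsj (Finset.mem_image_of_mem _ huv)
      simpa using And.intro h4 h5
    have hchain : ∀ u u', (u, j) ∈ s → (u', j + 1) ∈ s → u ≤ u' := by
      intro u u' hu hu'
      rcases h3.total hu hu' with h | h
      · exact h.1
      · exact absurd h.2 (by simp)
    simp only [prismChains, List.mem_cons, List.not_mem_nil, or_false, exists_eq_or_imp,
      exists_eq_left]
    -- The tetrahedron is selected by the largest vertex of `s` in the lower layer, which bounds all
    -- vertices in the upper layer from below; if neither `c` nor `b` occurs there, the first chain
    -- serves.
    by_cases hc : (c, j) ∈ s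
    · refine Or.inr (Or.inr ?_)
      rintro ⟨u, v⟩ huv
      have h6 := hs u v huv
      have h7 := hchain c u hc
      simp only [List.toFinset_cons, List.toFinset_nil, Finset.mem_insert, Prod.mk.injEq]
      rcases h6 with ⟨rfl | rfl | rfl, rfl | rfl⟩ <;> simp
      · have := h7 huv; omega
      · have := h7 huv; omega
    · by_cases hb : (b, j) ∈ s
      · refine Or.inr (Or.inl ?_)
        rintro ⟨u, v⟩ huv
        have h6 := hs u v huv
        have h7 := hchain b u hb
        simp only [List.toFinset_cons, List.toFinset_nil, Finset.mem_insert, Prod.mk.injEq]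
        rcases h6 with ⟨rfl | rfl | rfl, rfl | rfl⟩ <;> simp
        · have := h7 huv; omega
        · exact absurd huv hc
      · refine Or.inl ?_
        rintro ⟨u, v⟩ huv
        have h6 := hs u v huv
        simp only [List.toFinset_cons, List.toFinset_nil, Finset.mem_insert, Prod.mk.injEq]
        rcases h6 with ⟨rfl | rfl | rfl, rfl | rfl⟩ <;> simp
        · exact absurd huv hb
        · exact absurd huv hc
  · rintro ⟨hne, t, ht, j, hj, c, hc, hs⟩
    obtain ⟨-, hab, hbc, -⟩ := kleinTriangles_bounds t ht
    refine ⟨mem_kleinBottle8.2 ⟨hne.image _, t, ht, ?_⟩, mem_interval.2 ⟨hne.image _, j, hj, ?_⟩, ?_⟩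
    · intro v hv
      obtain ⟨p, hp, rfl⟩ := Finset.mem_image.mp hv
      have := hs hp
      simp only [prismChains, List.mem_cons, List.not_mem_nil, or_false] at hc
      rcases hc with rfl | rfl | rfl <;> simp at this <;>
        rcases this with rfl | rfl | rfl | rfl <;> simp
    · intro v hv
      obtain ⟨p, hp, rfl⟩ := Finset.mem_image.mp hv
      have := hs hp
      simp only [prismChains, List.mem_cons, List.not_mem_nil, or_false] at hc
      rcases hc with rfl | rfl | rfl <;> simp at this <;>
        rcases this with rfl | rfl | rfl | rfl <;> simp
    · have hss : (s : Set (ℕ × ℕ)) ⊆ c.toFinset := Finset.coe_subset.mpr hs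
      refine IsChain.mono hss ?_
      intro p hp q hq _
      simp only [prismChains, List.mem_cons, List.not_mem_nil, or_false] at hc
      simp only [List.coe_toFinset] at hp hq
      rcases hc with rfl | rfl | rfl <;>
      · simp only [List.mem_cons, List.not_mem_nil, or_false, Set.mem_ofPred_eq] at hp hq
        rcases hp with rfl | rfl | rfl | rfl <;> rcases hq with rfl | rfl | rfl | rfl <;>
          simp only [Prod.mk_le_mk] <;> omega

/-- Bit masks of the facets of the twisted product along the map `f` of the vertices. -/
def twistedMasks (f : ℕ → ℕ) : List ℕ :=
  kleinTriangles.flatMap fun t => [0, 1, 2].flatMap fun j => (prismChains t j).map fun c =>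
    mask (c.map fun p => vertexNumber (if p.2 < 3 then p else (f p.1, 0)))

/-- The function `f` is a version of `σ` on the labels `1` to `8` that evaluates directly, whereas
`σ` is given by cycles. -/
theorem twistedProduct_kleinBottle8 {σ : Equiv.Perm ℕ} {f : ℕ → ℕ}
    (hf : ∀ v ∈ Finset.Icc 1 8, σ v = f v ∧ f v ∈ Finset.Icc 1 8) :
    twistedProduct kleinBottle8 σ = maskComplex (twistedMasks f) := by
  have hmask : ∀ t ∈ kleinTriangles, ∀ j, ∀ c ∈ prismChains t j,
      maskSet (mask (c.map fun p => vertexNumber (if p.2 < 3 then p else (f p.1, 0)))) =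
        c.toFinset.image (glue σ) := by
    intro t ht j c hc
    have hb : ∀ p ∈ c, p.1 ∈ Finset.Icc 1 8 := by
      obtain ⟨h1, h2, h3, h4⟩ := kleinTriangles_bounds t ht
      intro p hp
      simp only [prismChains, List.mem_cons, List.not_mem_nil, or_false] at hc
      rw [Finset.mem_Icc]
      rcases hc with rfl | rfl | rfl <;> simp at hp <;>
        rcases hp with rfl | rfl | rfl | rfl <;> constructor <;> simp only <;> omega
    rw [maskSet_mask]
    ext q
    simp only [Finset.mem_map, List.mem_toFinset, List.mem_map, Finset.mem_image]
    constructor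
    · rintro ⟨_, ⟨p, hp, rfl⟩, rfl⟩
      refine ⟨p, hp, ?_⟩
      obtain ⟨h1, h2⟩ := hf _ (hb p hp)
      have h3 := Finset.mem_Icc.1 (hb p hp)
      have h4 := Finset.mem_Icc.1 h2
      unfold glue
      rw [h1, vertexOfNat_vertexNumber]
      all_goals split_ifs <;> simp_all
    · rintro ⟨p, hp, rfl⟩
      refine ⟨_, ⟨p, hp, rfl⟩, ?_⟩
      obtain ⟨h1, h2⟩ := hf _ (hb p hp)
      have h3 := Finset.mem_Icc.1 (hb p hp)
      have h4 := Finset.mem_Icc.1 h2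
      unfold glue
      rw [h1, vertexOfNat_vertexNumber]
      all_goals split_ifs <;> simp_all
  have hmem : ∀ m, m ∈ twistedMasks f ↔ ∃ t ∈ kleinTriangles, ∃ j < 3, ∃ c ∈ prismChains t j,
      m = mask (c.map fun p => vertexNumber (if p.2 < 3 then p else (f p.1, 0))) := by
    intro m
    have h3 : ∀ j : ℕ, j ∈ [0, 1, 2] ↔ j < 3 := by
      intro j; simp; omega
    simp only [twistedMasks, List.mem_flatMap, h3, List.mem_map, eq_comm (a := m)]
  refine PreAbstractSimplicialComplex.ext (Set.ext fun s => ?_)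
  constructor
  · rintro ⟨s', hs', rfl⟩
    obtain ⟨hne, t, ht, j, hj, c, hc, hs⟩ := mem_staircaseProduct_kleinBottle8.1 hs'
    refine ⟨hne.image _, _, ⟨_, (hmem _).2 ⟨t, ht, j, hj, c, hc, rfl⟩, rfl⟩, ?_⟩
    rw [hmask t ht j c hc]
    exact Finset.image_subset_image hs
  · rintro ⟨hne, _, ⟨m, hm, rfl⟩, hs⟩
    obtain ⟨t, ht, j, hj, c, hc, rfl⟩ := (hmem m).1 hm
    rw [hmask t ht j c hc] at hs
    -- A subset of the image of a chain is the image of a subset of that chain, so the glued complex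
    -- is generated by the images of the facets.
    obtain ⟨s', hs', rfl⟩ := Finset.subset_image_iff.mp hs
    exact ⟨s', mem_staircaseProduct_kleinBottle8.2
      ⟨Finset.image_nonempty.mp hne, t, ht, j, hj, c, hc, Finset.coe_subset.mp hs'⟩, rfl⟩

/-! ### Finiteness and vertex counts of mask complexes -/

theorem finite_faces_maskComplex (L : List ℕ) : (maskComplex L).faces.Finite := by
  refine ((L.map fun m => (maskSet m).powerset).foldr (· ∪ ·) ∅).finite_toSet.subset ?_
  rintro s ⟨-, _, ⟨m, hm, rfl⟩, hs⟩
  induction L with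
  | nil => simp at hm
  | cons a L ih =>
    simp only [List.map_cons, List.foldr_cons, Finset.coe_union, Set.mem_union, Finset.mem_coe,
      Finset.mem_powerset]
    rcases List.mem_cons.mp hm with rfl | hm
    · exact Or.inl hs
    · exact Or.inr (ih hm)

theorem vertices_maskComplex (L : List ℕ) :
    vertices (maskComplex L) = maskSet (L.foldr Nat.lor 0) := by
  ext p
  have h1 : p ∈ vertices (maskComplex L) ↔ ∃ m ∈ L, p ∈ maskSet m := by
    constructor
    · rintro ⟨-, _, ⟨m, hm, rfl⟩, hs⟩
      exact ⟨m, hm, Finset.singleton_subset_iff.mp hs⟩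
    · rintro ⟨m, hm, hp⟩
      exact ⟨Finset.singleton_nonempty p, _, ⟨m, hm, rfl⟩, Finset.singleton_subset_iff.mpr hp⟩
  rw [h1, Finset.mem_coe]
  clear h1
  induction L with
  | nil => simp [maskSet]
  | cons a L ih =>
    rw [List.foldr_cons, maskSet_lor, Finset.mem_union]
    refine Iff.trans ?_ (or_congr_right ih)
    simp

/-- Test that the facets in a list have exactly `n` vertices, out of those in the first three
layers. -/
def vertexCountTest (n : ℕ) (L : List ℕ) : Bool :=
  Nat.beq (L.foldr Nat.lor 0)
    (mask ((List.range 24).filter fun i => Nat.testBit (L.foldr Nat.lor 0) i)) &&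
  Nat.beq ((List.range 24).filter fun i => Nat.testBit (L.foldr Nat.lor 0) i).length n

/-- The union of all facets is the bitwise or of their masks. The first test says that it has no bit
beyond the 24 that are inspected, so that the second one counts all vertices. -/
theorem ncard_of_vertexCountTest {n : ℕ} {L : List ℕ} (h : vertexCountTest n L = true) :
    (vertices (maskComplex L)).ncard = n := by
  rw [vertexCountTest, Bool.and_eq_true, Nat.beq_eq, Nat.beq_eq] at h
  rw [vertices_maskComplex, Set.ncard_coe_finset, h.1, maskSet_mask, Finset.card_map,
    List.toFinset_card_of_nodup (List.nodup_range.filter _), h.2]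

/-! ## The polyhedron of a staircase product -/

/-- Total mass of the vertices below `n`. -/
noncomputable def partialSum (x : ℕ → ℝ) (n : ℕ) : ℝ := ∑ v ∈ Finset.range n, x v

/-- The monotone coupling of two mass distributions on the natural numbers. -/
noncomputable def coupling (x y : ℕ → ℝ) (p : ℕ × ℕ) : ℝ :=
  min (partialSum x (p.1 + 1)) (partialSum y (p.2 + 1)) -
    min (partialSum x p.1) (partialSum y (p.2 + 1)) -
    (min (partialSum x (p.1 + 1)) (partialSum y p.2) - min (partialSum x p.1) (partialSum y p.2))

theorem continuous_partialSum (n : ℕ) : Continuous fun x : ℕ → ℝ => partialSum x n :=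
  continuous_finsetSum _ fun v _ => continuous_apply v

theorem continuous_coupling (p : ℕ × ℕ) :
    Continuous fun z : (ℕ → ℝ) × (ℕ → ℝ) => coupling z.1 z.2 p := by
  unfold coupling
  have h1 := fun n => (continuous_partialSum n).comp (continuous_fst (X := ℕ → ℝ) (Y := ℕ → ℝ))
  have h2 := fun n => (continuous_partialSum n).comp (continuous_snd (X := ℕ → ℝ) (Y := ℕ → ℝ))
  exact (((h1 _).min (h2 _)).sub ((h1 _).min (h2 _))).sub
    (((h1 _).min (h2 _)).sub ((h1 _).min (h2 _)))

theorem partialSum_succ (x : ℕ → ℝ) (n : ℕ) : partialSum x (n + 1) = partialSum x n + x n :=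
  Finset.sum_range_succ _ _

theorem partialSum_mono {x : ℕ → ℝ} (hx : ∀ v, 0 ≤ x v) : Monotone (partialSum x) :=
  monotone_nat_of_le_succ fun n => by rw [partialSum_succ]; linarith [hx n]

theorem partialSum_eq_sum {x : ℕ → ℝ} {s : Finset ℕ} (hs : ∀ v, v ∉ s → x v = 0) {n : ℕ}
    (hn : s ⊆ Finset.range n) : partialSum x n = ∑ v ∈ s, x v :=
  (Finset.sum_subset hn fun v _ hv => hs v hv).symm

theorem partialSum_nonneg {x : ℕ → ℝ} (hx : ∀ v, 0 ≤ x v) (n : ℕ) : 0 ≤ partialSum x n :=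
  Finset.sum_nonneg fun v _ => hx v

theorem coupling_swap (x y : ℕ → ℝ) (p : ℕ × ℕ) : coupling x y p = coupling y x p.swap := by
  simp only [coupling, Prod.fst_swap, Prod.snd_swap]
  rw [min_comm (partialSum y (p.2 + 1)), min_comm (partialSum y p.2),
    min_comm (partialSum y (p.2 + 1)), min_comm (partialSum y p.2)]
  ring

/-- Lay the masses of `x` and of `y` end to end as consecutive intervals on the line: the coupling
at `p` is the length of the overlap of the `p.1`-th interval of `x` with the `p.2`-th interval of
`y`. -/
theorem coupling_nonneg {x y : ℕ → ℝ} (hx : ∀ v, 0 ≤ x v) (hy : ∀ v, 0 ≤ y v) (p : ℕ × ℕ) :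
    0 ≤ coupling x y p := by
  unfold coupling
  have h1 := partialSum_mono hx p.1.le_succ
  have h2 := partialSum_mono hy p.2.le_succ
  simp only [Nat.succ_eq_add_one] at h1 h2
  generalize partialSum x (p.1 + 1) = b at *
  generalize partialSum x p.1 = a at *
  generalize partialSum y (p.2 + 1) = d at *
  generalize partialSum y p.2 = c at *
  rcases min_cases b d with h | h <;> rcases min_cases a d with h' | h' <;>
    rcases min_cases b c with h'' | h'' <;> rcases min_cases a c with h''' | h''' <;> linarith

/-- Positive mass forces the two intervals to overlap; if one ends before the other begins, the four
minima cancel in pairs. -/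
theorem overlap_of_coupling_ne_zero {x y : ℕ → ℝ} (hx : ∀ v, 0 ≤ x v) (hy : ∀ v, 0 ≤ y v)
    {p : ℕ × ℕ} (hp : coupling x y p ≠ 0) :
    partialSum x p.1 < partialSum y (p.2 + 1) ∧ partialSum y p.2 < partialSum x (p.1 + 1) := by
  have h1 := partialSum_mono hx p.1.le_succ
  have h2 := partialSum_mono hy p.2.le_succ
  simp only [Nat.succ_eq_add_one] at h1 h2
  constructor
  · by_contra! h
    apply hp
    unfold coupling
    rw [min_eq_right (h.trans h1), min_eq_right h, min_eq_right ((h2.trans h).trans h1),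
      min_eq_right (h2.trans h)]
    ring
  · by_contra! h
    apply hp
    unfold coupling
    rw [min_eq_left (h.trans h2), min_eq_left ((h1.trans h).trans h2), min_eq_left h,
      min_eq_left (h1.trans h)]
    ring

theorem coupling_eq_zero {x y : ℕ → ℝ} {p : ℕ × ℕ} (h : x p.1 = 0 ∨ y p.2 = 0) :
    coupling x y p = 0 := by
  unfold coupling
  rcases h with h | h
  · rw [partialSum_succ x, h]; simp
  · rw [partialSum_succ y, h]; simp

/-- The sum telescopes, and at the upper end both minima are attained by the partial sums of `x`. -/
theorem sum_range_coupling {x y : ℕ → ℝ} (hx : ∀ v, 0 ≤ x v) {v n : ℕ}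
    (h : partialSum x (v + 1) ≤ partialSum y n) :
    ∑ j ∈ Finset.range n, coupling x y (v, j) = x v := by
  have h0 : partialSum x v ≤ partialSum x (v + 1) := partialSum_mono hx v.le_succ
  have := Finset.sum_range_sub
    (fun j => min (partialSum x (v + 1)) (partialSum y j) - min (partialSum x v) (partialSum y j)) n
  have e : ∀ j, coupling x y (v, j) =
    (min (partialSum x (v + 1)) (partialSum y (j + 1)) - min (partialSum x v) (partialSum y (j + 1)))
    - (min (partialSum x (v + 1)) (partialSum y j) - min (partialSum x v) (partialSum y j)) := by
    intro j; unfold coupling; ring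
  simp only [e, this]
  rw [min_eq_left h, min_eq_left (h0.trans h)]
  have h00 : partialSum y 0 = 0 := Finset.sum_range_zero _
  rw [h00, min_eq_right (partialSum_nonneg hx _), min_eq_right (partialSum_nonneg hx _),
    partialSum_succ]
  ring

theorem exists_partialSum_eq_one {K : PreAbstractSimplicialComplex ℕ} {x : ℕ → ℝ}
    (hx : x ∈ realization K) : ∃ n, ∀ m, n ≤ m → partialSum x m = 1 := by
  obtain ⟨h0, s, hs, hxs, hsum⟩ := hx
  obtain ⟨n, hn⟩ := s.exists_nat_subset_range
  exact ⟨n, fun m hm => by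
    rw [partialSum_eq_sum hxs (hn.trans (Finset.range_subset_range.mpr hm)), hsum]⟩

theorem partialSum_le_one {K : PreAbstractSimplicialComplex ℕ} {x : ℕ → ℝ}
    (hx : x ∈ realization K) (n : ℕ) : partialSum x n ≤ 1 := by
  obtain ⟨m, hm⟩ := exists_partialSum_eq_one hx
  rw [← hm (max n m) (le_max_right _ _)]
  exact partialSum_mono hx.1 (le_max_left _ _)

theorem sum_coupling {K L : PreAbstractSimplicialComplex ℕ} {x y : ℕ → ℝ}
    (hx : x ∈ realization K) (hy : y ∈ realization L) {s : Finset ℕ}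
    (hs : ∀ j, j ∉ s → y j = 0) (v : ℕ) : ∑ j ∈ s, coupling x y (v, j) = x v := by
  obtain ⟨n, hn⟩ := exists_partialSum_eq_one hy
  obtain ⟨m, hm⟩ := s.exists_nat_subset_range
  rw [← sum_range_coupling hx.1 (v := v) (n := max n m)
    (by rw [hn _ (le_max_left _ _)]; exact partialSum_le_one hx _)]
  exact Finset.sum_subset (hm.trans (Finset.range_subset_range.mpr (le_max_right _ _)))
    fun j _ hj => coupling_eq_zero (Or.inr (hs j hj))

/-- The marginals give total mass one and support in the product of the two faces. The support is a
chain because the intervals on either side are met in increasing order. -/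
theorem coupling_mem_realization {K L : PreAbstractSimplicialComplex ℕ} {x y : ℕ → ℝ}
    (hx : x ∈ realization K) (hy : y ∈ realization L) :
    coupling x y ∈ realization (staircaseProduct K L) := by
  classical
  obtain ⟨hx0, s, hs, hxs, hxsum⟩ := id hx
  obtain ⟨hy0, t, ht, hyt, hysum⟩ := id hy
  have hsum : ∑ p ∈ (s ×ˢ t).filter (fun p => coupling x y p ≠ 0), coupling x y p = 1 := by
    rw [Finset.sum_filter_ne_zero, Finset.sum_product, ← hxsum]
    exact Finset.sum_congr rfl fun v _ => sum_coupling hx hy hyt v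
  have hne : ((s ×ˢ t).filter (fun p => coupling x y p ≠ 0)).Nonempty := by
    rw [Finset.nonempty_iff_ne_empty]
    intro h
    rw [h] at hsum
    simp at hsum
  refine ⟨coupling_nonneg hx0 hy0, _, ⟨?_, ?_, ?_⟩, fun p hp => ?_, hsum⟩
  · refine (K.isRelLowerSet_faces hs).2 ?_ (hne.image _)
    intro v hv
    obtain ⟨p, hp, rfl⟩ := Finset.mem_image.mp hv
    exact (Finset.mem_product.mp (Finset.mem_filter.mp hp).1).1
  · refine (L.isRelLowerSet_faces ht).2 ?_ (hne.image _)
    intro v hv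
    obtain ⟨p, hp, rfl⟩ := Finset.mem_image.mp hv
    exact (Finset.mem_product.mp (Finset.mem_filter.mp hp).1).2
  · intro p hp q hq _
    have hp' := overlap_of_coupling_ne_zero hx0 hy0 (Finset.mem_filter.mp hp).2
    have hq' := overlap_of_coupling_ne_zero hx0 hy0 (Finset.mem_filter.mp hq).2
    -- If `p` precedes `q` in the first coordinate but follows it in the second, the inequalities of
    -- the overlaps contradict the monotonicity of the partial sums.
    have key : ∀ p q : ℕ × ℕ, partialSum y p.2 < partialSum x (p.1 + 1) →
        partialSum x q.1 < partialSum y (q.2 + 1) → p.1 < q.1 → p.2 ≤ q.2 := by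
      intro p q h1 h2 h
      by_contra! h'
      have := partialSum_mono hx0 (Nat.succ_le_of_lt h)
      have := partialSum_mono hy0 (Nat.succ_le_of_lt h')
      simp only [Nat.succ_eq_add_one] at *
      linarith
    rcases lt_trichotomy p.1 q.1 with h | h | h
    · exact Or.inl ⟨h.le, key p q hp'.2 hq'.1 h⟩
    · rcases le_total p.2 q.2 with h' | h'
      · exact Or.inl ⟨h.le, h'⟩
      · exact Or.inr ⟨h.ge, h'⟩
    · exact Or.inr ⟨h.le, key q p hq'.2 hp'.1 h⟩
  · by_contra hne0
    refine hp (Finset.mem_filter.mpr ⟨Finset.mem_product.mpr ⟨?_, ?_⟩, hne0⟩)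
    · by_contra h
      exact hne0 (coupling_eq_zero (Or.inl (hxs _ h)))
    · by_contra h
      exact hne0 (coupling_eq_zero (Or.inr (hyt _ h)))

/-- A distribution supported on a chain is the monotone coupling of its marginals. Of the two sets
`p.1 < v` and `p.2 < j`, one contains the other within the chain, so the minimum of the marginal
distribution functions is the joint distribution function. -/
theorem exists_coupling_eq {K L : PreAbstractSimplicialComplex ℕ} {z : ℕ × ℕ → ℝ}
    (hz : z ∈ realization (staircaseProduct K L)) :
    ∃ x ∈ realization K, ∃ y ∈ realization L, coupling x y = z := by
  obtain ⟨hz0, s, ⟨hK, hL, hchain⟩, hzs, hsum⟩ := hz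
  have hmarg : ∀ (M : PreAbstractSimplicialComplex ℕ) (f : ℕ × ℕ → ℕ), s.image f ∈ M.faces →
      (fun v => ∑ p ∈ s with f p = v, z p) ∈ realization M := by
    intro M f hM
    refine ⟨fun v => Finset.sum_nonneg fun p _ => hz0 p, s.image f, hM, fun v hv => ?_, ?_⟩
    · refine Finset.sum_eq_zero fun p hp => absurd ?_ hv
      rw [← (Finset.mem_filter.mp hp).2]
      exact Finset.mem_image_of_mem _ (Finset.mem_filter.mp hp).1
    · rw [← hsum]
      exact Finset.sum_fiberwise_of_maps_to (fun p hp => Finset.mem_image_of_mem _ hp) z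
  have hpart : ∀ (f : ℕ × ℕ → ℕ) (n : ℕ), partialSum (fun v => ∑ p ∈ s with f p = v, z p) n =
      ∑ p ∈ s, if f p < n then z p else 0 := by
    intro f n
    simp only [partialSum, Finset.sum_filter]
    rw [Finset.sum_comm]
    refine Finset.sum_congr rfl fun p _ => ?_
    rw [Finset.sum_ite_eq]
    simp
  refine ⟨_, hmarg K Prod.fst hK, _, hmarg L Prod.snd hL, funext fun q => ?_⟩
  have hmin : ∀ v j, min (partialSum (fun v => ∑ p ∈ s with p.1 = v, z p) v)
      (partialSum (fun v => ∑ p ∈ s with p.2 = v, z p) j) =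
      ∑ p ∈ s, if p.1 < v ∧ p.2 < j then z p else 0 := by
    intro v j
    rw [hpart Prod.fst, hpart Prod.snd]
    -- A point of the chain that is left of `v` but not below `j` forces all points below `j` to be
    -- left of `v`. Without such a point the inclusion goes the other way.
    by_cases h : ∃ p ∈ s, p.1 < v ∧ j ≤ p.2
    · obtain ⟨p, hp, hpv, hpj⟩ := h
      have hall : ∀ q ∈ s, q.2 < j → q.1 < v := by
        intro q hq hqj
        rcases hchain.total hp hq with h | h
        · have := h.2; omega
        · have := h.1; omega
      have e : ∑ p ∈ s, (if p.1 < v ∧ p.2 < j then z p else 0) =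
          ∑ p ∈ s, if p.2 < j then z p else 0 := by
        refine Finset.sum_congr rfl fun q hq => ?_
        have := hall q hq
        by_cases hq' : q.2 < j <;> simp [hq', this]
      rw [e]
      refine min_eq_right (Finset.sum_le_sum fun q hq => ?_)
      have := hall q hq
      by_cases hq' : q.2 < j
      · simp [hq', this]
      · rw [if_neg hq']
        split_ifs
        exacts [hz0 q, le_rfl]
    · push Not at h
      have e : ∑ p ∈ s, (if p.1 < v ∧ p.2 < j then z p else 0) =
          ∑ p ∈ s, if p.1 < v then z p else 0 := by
        refine Finset.sum_congr rfl fun q hq => ?_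
        have := h q hq
        by_cases hq' : q.1 < v
        · simp [hq', this hq']
        · simp [hq']
      rw [e]
      refine min_eq_left (Finset.sum_le_sum fun q hq => ?_)
      have := h q hq
      by_cases hq' : q.1 < v
      · simp [hq', this hq']
      · rw [if_neg hq']
        split_ifs
        exacts [hz0 q, le_rfl]
  unfold coupling
  rw [hmin, hmin, hmin, hmin, ← Finset.sum_sub_distrib, ← Finset.sum_sub_distrib,
    ← Finset.sum_sub_distrib]
  -- Inclusion and exclusion recover the mass at `q` from the joint distribution function at the
  -- corners of a unit square.
  have e : ∀ p : ℕ × ℕ, (if p.1 < q.1 + 1 ∧ p.2 < q.2 + 1 then z p else 0) -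
      (if p.1 < q.1 ∧ p.2 < q.2 + 1 then z p else 0) -
      ((if p.1 < q.1 + 1 ∧ p.2 < q.2 then z p else 0) -
        (if p.1 < q.1 ∧ p.2 < q.2 then z p else 0)) = if q = p then z p else 0 := by
    intro p
    obtain ⟨a, b⟩ := p
    obtain ⟨c, d⟩ := q
    simp only [Prod.mk.injEq]
    by_cases h0 : c = a ∧ d = b
    · obtain ⟨rfl, rfl⟩ := h0
      simp
    · rw [if_neg h0]
      rcases lt_trichotomy a c with h | h | h <;> rcases lt_trichotomy b d with h' | h' | h' <;>
        first
        | (exact absurd (And.intro (Eq.symm h) (Eq.symm h')) h0)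
        | (have h1 : a < c + 1 ∨ ¬ a < c + 1 := em _
           have h2 : b < d + 1 ∨ ¬ b < d + 1 := em _
           have h3 : a < c ∨ ¬ a < c := em _
           have h4 : b < d ∨ ¬ b < d := em _
           rcases h1 with h1 | h1 <;> rcases h2 with h2 | h2 <;> rcases h3 with h3 | h3 <;>
             rcases h4 with h4 | h4 <;> first | omega | simp [h1, h2, h3, h4])
  simp only [e]
  rw [Finset.sum_ite_eq]
  split_ifs with h
  · rfl
  · exact (hzs q h).symm

/-! ## The triangulation of the flat Klein bottle -/

/-- Distance of `t` to the nearest multiple of `T`. -/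
noncomputable def circleDist (T t : ℝ) : ℝ := ‖(t : AddCircle T)‖

theorem continuous_circleDist (T : ℝ) : Continuous (circleDist T) :=
  continuous_norm.comp (AddCircle.continuous_mk' T)

theorem circleDist_neg (T t : ℝ) : circleDist T (-t) = circleDist T t := by
  rw [circleDist, AddCircle.coe_neg, norm_neg, circleDist]

theorem circleDist_congr {T s t : ℝ} (n : ℤ) (h : s = t + n * T) :
    circleDist T s = circleDist T t := by
  have : ((n * T : ℝ) : AddCircle T) = 0 := by
    rw [AddCircle.coe_eq_zero_iff]
    exact ⟨n, by simp⟩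
  rw [circleDist, circleDist, h, AddCircle.coe_add, this, add_zero]

theorem circleDist_eq_abs {T t : ℝ} (hT : 0 < T) (h : |t| ≤ T / 2) : circleDist T t = |t| := by
  rw [circleDist, AddCircle.norm_coe_eq_abs_iff T hT.ne', abs_of_pos hT]
  exact h

/-- The hat function of the lift `(0, 1)` of the vertex `1`. -/
noncomputable def hatOne (x y : ℝ) : ℝ :=
  max 0 (min (1 - (circleDist 8 x + circleDist 4 (y - 1)) / 2) (3 / 2 - circleDist 4 (y - 1 / 2)))

/-- The barycentric coordinate of the vertex `1`. -/
noncomputable def coordOne (x y : ℝ) : ℝ := hatOne x y + hatOne (x + 4) (-y)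

/-- The barycentric coordinate of the vertex `3`. -/
noncomputable def coordThree (x y : ℝ) : ℝ :=
  max 0 (min (1 - (circleDist 4 (x - 1) + circleDist 4 y) / 2)
    (min (1 - circleDist 4 y) (3 / 2 - circleDist 4 (x - 3 / 2))))

/-- Barycentric coordinates in `kleinBottle8` of a point of the plane, where the vertices
`3`, `4` lie at `(1, 0)`, `(3, 0)`, the vertices `1`, `5`, `2`, `6` at `(0, 1)`, `(2, 1)`, `(4, 1)`,
`(6, 1)`, and the vertices `7`, `8` at `(1, 2)`, `(3, 2)`; the Klein bottle is the quotient by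
the group generated by `(x, y) ↦ (x + 4, -y)` and `(x, y) ↦ (x, y + 4)`. -/
noncomputable def kleinCoord (x y : ℝ) : ℕ → ℝ
  | 1 => coordOne x y
  | 2 => coordOne x (-y)
  | 3 => coordThree x y
  | 4 => coordThree (-x) y
  | 5 => coordOne (2 - x) (2 - y)
  | 6 => coordOne (2 - x) (y - 2)
  | 7 => coordThree (2 - x) (2 - y)
  | 8 => coordThree (x - 2) (2 - y)
  | _ => 0


section

variable (x y : ℝ)

theorem kleinCoord_zero : kleinCoord x y 0 = 0 := rfl

theorem kleinCoord_one : kleinCoord x y 1 = coordOne x y := rfl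

theorem kleinCoord_two : kleinCoord x y 2 = coordOne x (-y) := rfl

theorem kleinCoord_three : kleinCoord x y 3 = coordThree x y := rfl

theorem kleinCoord_four : kleinCoord x y 4 = coordThree (-x) y := rfl

theorem kleinCoord_five : kleinCoord x y 5 = coordOne (2 - x) (2 - y) := rfl

theorem kleinCoord_six : kleinCoord x y 6 = coordOne (2 - x) (y - 2) := rfl

theorem kleinCoord_seven : kleinCoord x y 7 = coordThree (2 - x) (2 - y) := rfl

theorem kleinCoord_eight : kleinCoord x y 8 = coordThree (x - 2) (2 - y) := rfl

theorem kleinCoord_of_eight_lt {v : ℕ} (h : 8 < v) : kleinCoord x y v = 0 := by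
  obtain ⟨n, rfl⟩ := Nat.exists_eq_add_of_le' h
  rfl

end

theorem continuous_hatOne : Continuous fun p : ℝ × ℝ => hatOne p.1 p.2 := by
  unfold hatOne
  have h8 := continuous_circleDist 8
  have h4 := continuous_circleDist 4
  fun_prop

theorem continuous_coordOne : Continuous fun p : ℝ × ℝ => coordOne p.1 p.2 := by
  unfold coordOne
  exact continuous_hatOne.add (continuous_hatOne.comp
    (f := fun p : ℝ × ℝ => (p.1 + 4, -p.2)) (by fun_prop))

theorem continuous_coordThree : Continuous fun p : ℝ × ℝ => coordThree p.1 p.2 := by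
  unfold coordThree
  have h4 := continuous_circleDist 4
  fun_prop

theorem continuous_kleinCoord : Continuous fun p : ℝ × ℝ => kleinCoord p.1 p.2 := by
  refine continuous_pi fun v => ?_
  have h1 : ∀ f : ℝ × ℝ → ℝ × ℝ, Continuous f → Continuous fun p => coordOne (f p).1 (f p).2 :=
    fun f hf => continuous_coordOne.comp hf
  have h3 : ∀ f : ℝ × ℝ → ℝ × ℝ, Continuous f → Continuous fun p => coordThree (f p).1 (f p).2 :=
    fun f hf => continuous_coordThree.comp hf
  match v with
  | 0 => exact continuous_const
  | 1 => exact h1 id continuous_id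
  | 2 => exact h1 (fun p => (p.1, -p.2)) (by fun_prop)
  | 3 => exact h3 id continuous_id
  | 4 => exact h3 (fun p => (-p.1, p.2)) (by fun_prop)
  | 5 => exact h1 (fun p => (2 - p.1, 2 - p.2)) (by fun_prop)
  | 6 => exact h1 (fun p => (2 - p.1, p.2 - 2)) (by fun_prop)
  | 7 => exact h3 (fun p => (2 - p.1, 2 - p.2)) (by fun_prop)
  | 8 => exact h3 (fun p => (p.1 - 2, 2 - p.2)) (by fun_prop)
  | n + 9 => exact continuous_const

/-! ### Symmetries -/

theorem hatOne_congr {x y x' y' : ℝ} (m n : ℤ) (hx : x = x' + m * 8) (hy : y = y' + n * 4) :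
    hatOne x y = hatOne x' y' := by
  unfold hatOne
  rw [circleDist_congr m hx, circleDist_congr (s := y - 1) (t := y' - 1) n (by rw [hy]; ring),
    circleDist_congr (s := y - 1 / 2) (t := y' - 1 / 2) n (by rw [hy]; ring)]

theorem hatOne_neg (x y : ℝ) : hatOne (-x) y = hatOne x y := by
  unfold hatOne
  rw [circleDist_neg]

theorem coordOne_congr {x y x' y' : ℝ} (m n : ℤ) (hx : x = x' + m * 8) (hy : y = y' + n * 4) :
    coordOne x y = coordOne x' y' := by
  unfold coordOne
  rw [hatOne_congr m n hx hy, hatOne_congr (x := x + 4) (x' := x' + 4) (y := -y) (y' := -y') m (-n)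
    (by rw [hx]; ring) (by rw [hy]; push_cast; ring)]

/-- `coordOne` adds the hat functions of the two lifts of the vertex modulo `8` and `4`, and the
glide exchanges these lifts. -/
theorem coordOne_glide {x y x' y' : ℝ} (m n : ℤ) (hx : x = x' + 4 + m * 8)
    (hy : y = -y' + n * 4) : coordOne x y = coordOne x' y' := by
  unfold coordOne
  rw [add_comm, hatOne_congr (x := x) (x' := x' + 4) (y := y) (y' := -y') m n hx hy,
    hatOne_congr (x := x + 4) (x' := x') (y := -y) (y' := y') (m + 1) (-n)
    (by rw [hx]; push_cast; ring) (by rw [hy]; push_cast; ring)]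

theorem coordOne_neg (x y : ℝ) : coordOne (-x) y = coordOne x y := by
  unfold coordOne
  rw [hatOne_neg, ← hatOne_neg (-x + 4) (-y), hatOne_congr (x := -(-x + 4)) (x' := x + 4)
    (y' := -y) (-1) 0 (by push_cast; ring) (by push_cast; ring)]

theorem coordThree_congr {x y x' y' : ℝ} (m n : ℤ) (hx : x = x' + m * 4)
    (hy : y = y' + n * 4) : coordThree x y = coordThree x' y' := by
  unfold coordThree
  rw [circleDist_congr n hy, circleDist_congr (s := x - 1) (t := x' - 1) m (by rw [hx]; ring),
    circleDist_congr (s := x - 3 / 2) (t := x' - 3 / 2) m (by rw [hx]; ring)]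

/-- The star of the vertex `3` is symmetric in the axis of the glide, so period `4` in `x` already
accounts for the glide and no second lift has to be added. -/
theorem coordThree_neg (x y : ℝ) : coordThree x (-y) = coordThree x y := by
  unfold coordThree
  rw [circleDist_neg]

/-- Points of the plane that lie over the same point of the Klein bottle. -/
def KleinRel (x y x' y' : ℝ) : Prop :=
  ∃ m n : ℤ, (x' = x + m * 8 ∧ y' = y + n * 4) ∨ (x' = x + 4 + m * 8 ∧ y' = -y + n * 4)

theorem kleinCoord_eq_of_kleinRel {x y x' y' : ℝ} (h : KleinRel x y x' y') :
    kleinCoord x' y' = kleinCoord x y := by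
  obtain ⟨m, n, ⟨hx, hy⟩ | ⟨hx, hy⟩⟩ := h
  · ext v
    match v with
    | 0 => rw [kleinCoord_zero, kleinCoord_zero]
    | 1 =>
      rw [kleinCoord_one, kleinCoord_one]
      exact coordOne_congr m n hx hy
    | 2 =>
      rw [kleinCoord_two, kleinCoord_two]
      exact coordOne_congr m (-n) hx (by rw [hy]; push_cast; ring)
    | 3 =>
      rw [kleinCoord_three, kleinCoord_three]
      exact coordThree_congr (2 * m) n (by rw [hx]; push_cast; ring) hy
    | 4 =>
      rw [kleinCoord_four, kleinCoord_four]
      exact coordThree_congr (-2 * m) n (by rw [hx]; push_cast; ring) hy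
    | 5 =>
      rw [kleinCoord_five, kleinCoord_five]
      exact coordOne_congr (-m) (-n) (by rw [hx]; push_cast; ring) (by rw [hy]; push_cast; ring)
    | 6 =>
      rw [kleinCoord_six, kleinCoord_six]
      exact coordOne_congr (-m) n (by rw [hx]; push_cast; ring) (by rw [hy]; ring)
    | 7 =>
      rw [kleinCoord_seven, kleinCoord_seven]
      exact coordThree_congr (-2 * m) (-n) (by rw [hx]; push_cast; ring)
            (by rw [hy]; push_cast; ring)
    | 8 =>
      rw [kleinCoord_eight, kleinCoord_eight]
      exact coordThree_congr (2 * m) (-n) (by rw [hx]; push_cast; ring)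
            (by rw [hy]; push_cast; ring)
    | n + 9 => rw [kleinCoord_of_eight_lt _ _ (by omega), kleinCoord_of_eight_lt _ _ (by omega)]
  · ext v
    match v with
    | 0 => rw [kleinCoord_zero, kleinCoord_zero]
    | 1 =>
      rw [kleinCoord_one, kleinCoord_one]
      exact coordOne_glide m n hx hy
    | 2 =>
      rw [kleinCoord_two, kleinCoord_two]
      exact coordOne_glide m (-n) hx (by rw [hy]; push_cast; ring)
    | 3 =>
      rw [kleinCoord_three, kleinCoord_three]
      exact (coordThree_congr (y' := -y) (2 * m + 1) n (by rw [hx]; push_cast; ring) hy).trans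
            (coordThree_neg _ _)
    | 4 =>
      rw [kleinCoord_four, kleinCoord_four]
      exact (coordThree_congr (y' := -y) (-2 * m - 1) n (by rw [hx]; push_cast; ring) hy).trans
            (coordThree_neg _ _)
    | 5 =>
      rw [kleinCoord_five, kleinCoord_five]
      exact coordOne_glide (-m - 1) (1 - n) (by rw [hx]; push_cast; ring)
            (by rw [hy]; push_cast; ring)
    | 6 =>
      rw [kleinCoord_six, kleinCoord_six]
      exact coordOne_glide (-m - 1) (n - 1) (by rw [hx]; push_cast; ring)
            (by rw [hy]; push_cast; ring)
    | 7 =>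
      rw [kleinCoord_seven, kleinCoord_seven]
      exact (coordThree_congr (y' := -(2 - y)) (-2 * m - 1) (1 - n)
            (by rw [hx]; push_cast; ring) (by rw [hy]; push_cast; ring)).trans (coordThree_neg _ _)
    | 8 =>
      rw [kleinCoord_eight, kleinCoord_eight]
      exact (coordThree_congr (y' := -(2 - y)) (2 * m + 1) (1 - n)
            (by rw [hx]; push_cast; ring) (by rw [hy]; push_cast; ring)).trans (coordThree_neg _ _)
    | n + 9 => rw [kleinCoord_of_eight_lt _ _ (by omega), kleinCoord_of_eight_lt _ _ (by omega)]

/-- The action of `x ↦ -x` on the vertices. -/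
def flipX : ℕ → ℕ
  | 3 => 4 | 4 => 3 | 5 => 6 | 6 => 5 | 7 => 8 | 8 => 7 | n => n

/-- The action of `y ↦ -y` on the vertices. -/
def flipY : ℕ → ℕ
  | 1 => 2 | 2 => 1 | 5 => 6 | 6 => 5 | n => n

/-- The action of the half turn `(x, y) ↦ (2 - x, 2 - y)` on the vertices. -/
def halfTurn : ℕ → ℕ
  | 1 => 5 | 2 => 6 | 3 => 7 | 4 => 8 | 5 => 1 | 6 => 2 | 7 => 3 | 8 => 4 | n => n

/-- The reflection normalises the deck group and preserves the triangulation. The images of the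
lifts are brought back to the chosen ones by deck transformations; for the vertices `5` and `6` this
takes a glide. -/
theorem kleinCoord_flipX (x y : ℝ) (v : ℕ) : kleinCoord (-x) y v = kleinCoord x y (flipX v) := by
  match v with
  | 0 => rw [kleinCoord_zero, show flipX 0 = 0 from rfl, kleinCoord_zero]
  | 1 =>
    rw [kleinCoord_one, show flipX 1 = 1 from rfl, kleinCoord_one]
    exact coordOne_neg _ _
  | 2 =>
    rw [kleinCoord_two, show flipX 2 = 2 from rfl, kleinCoord_two]
    exact coordOne_neg _ _
  | 3 =>
    rw [kleinCoord_three, show flipX 3 = 4 from rfl, kleinCoord_four]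
  | 4 =>
    rw [kleinCoord_four, show flipX 4 = 3 from rfl, kleinCoord_three]
    exact congrArg (coordThree · y) (neg_neg x)
  | 5 =>
    rw [kleinCoord_five, show flipX 5 = 6 from rfl, kleinCoord_six]
    rw [← coordOne_neg (2 - x)]
    exact coordOne_glide 0 0 (by push_cast; ring) (by push_cast; ring)
  | 6 =>
    rw [kleinCoord_six, show flipX 6 = 5 from rfl, kleinCoord_five]
    rw [← coordOne_neg (2 - x)]
    exact coordOne_glide 0 0 (by push_cast; ring) (by push_cast; ring)
  | 7 =>
    rw [kleinCoord_seven, show flipX 7 = 8 from rfl, kleinCoord_eight]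
    exact coordThree_congr 1 0 (by push_cast; ring) (by push_cast; ring)
  | 8 =>
    rw [kleinCoord_eight, show flipX 8 = 7 from rfl, kleinCoord_seven]
    exact coordThree_congr (-1) 0 (by push_cast; ring) (by push_cast; ring)
  | n + 9 =>
    rw [kleinCoord_of_eight_lt _ _ (by omega), show flipX (n + 9) = n + 9 from rfl,
      kleinCoord_of_eight_lt _ _ (by omega)]

theorem kleinCoord_flipY (x y : ℝ) (v : ℕ) : kleinCoord x (-y) v = kleinCoord x y (flipY v) := by
  match v with
  | 0 => rw [kleinCoord_zero, show flipY 0 = 0 from rfl, kleinCoord_zero]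
  | 1 =>
    rw [kleinCoord_one, show flipY 1 = 2 from rfl, kleinCoord_two]
  | 2 =>
    rw [kleinCoord_two, show flipY 2 = 1 from rfl, kleinCoord_one]
    exact congrArg (coordOne x) (neg_neg y)
  | 3 =>
    rw [kleinCoord_three, show flipY 3 = 3 from rfl, kleinCoord_three]
    exact coordThree_neg _ _
  | 4 =>
    rw [kleinCoord_four, show flipY 4 = 4 from rfl, kleinCoord_four]
    exact coordThree_neg _ _
  | 5 =>
    rw [kleinCoord_five, show flipY 5 = 6 from rfl, kleinCoord_six]
    exact coordOne_congr 0 1 (by push_cast; ring) (by push_cast; ring)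
  | 6 =>
    rw [kleinCoord_six, show flipY 6 = 5 from rfl, kleinCoord_five]
    exact coordOne_congr 0 (-1) (by push_cast; ring) (by push_cast; ring)
  | 7 =>
    rw [kleinCoord_seven, show flipY 7 = 7 from rfl, kleinCoord_seven]
    exact (coordThree_congr (y' := -(2 - y)) 0 1 (by push_cast; ring) (by push_cast; ring)).trans
          (coordThree_neg _ _)
  | 8 =>
    rw [kleinCoord_eight, show flipY 8 = 8 from rfl, kleinCoord_eight]
    exact (coordThree_congr (y' := -(2 - y)) 0 1 (by push_cast; ring) (by push_cast; ring)).trans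
          (coordThree_neg _ _)
  | n + 9 =>
    rw [kleinCoord_of_eight_lt _ _ (by omega), show flipY (n + 9) = n + 9 from rfl,
      kleinCoord_of_eight_lt _ _ (by omega)]

theorem kleinCoord_halfTurn (x y : ℝ) (v : ℕ) :
    kleinCoord (2 - x) (2 - y) v = kleinCoord x y (halfTurn v) := by
  match v with
  | 0 => rw [kleinCoord_zero, show halfTurn 0 = 0 from rfl, kleinCoord_zero]
  | 1 =>
    rw [kleinCoord_one, show halfTurn 1 = 5 from rfl, kleinCoord_five]
  | 2 =>
    rw [kleinCoord_two, show halfTurn 2 = 6 from rfl, kleinCoord_six]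
    exact coordOne_congr 0 0 (by push_cast; ring) (by push_cast; ring)
  | 3 =>
    rw [kleinCoord_three, show halfTurn 3 = 7 from rfl, kleinCoord_seven]
  | 4 =>
    rw [kleinCoord_four, show halfTurn 4 = 8 from rfl, kleinCoord_eight]
    exact coordThree_congr 0 0 (by push_cast; ring) (by push_cast; ring)
  | 5 =>
    rw [kleinCoord_five, show halfTurn 5 = 1 from rfl, kleinCoord_one]
    exact coordOne_congr 0 0 (by push_cast; ring) (by push_cast; ring)
  | 6 =>
    rw [kleinCoord_six, show halfTurn 6 = 2 from rfl, kleinCoord_two]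
    exact coordOne_congr 0 0 (by push_cast; ring) (by push_cast; ring)
  | 7 =>
    rw [kleinCoord_seven, show halfTurn 7 = 3 from rfl, kleinCoord_three]
    exact coordThree_congr 0 0 (by push_cast; ring) (by push_cast; ring)
  | 8 =>
    rw [kleinCoord_eight, show halfTurn 8 = 4 from rfl, kleinCoord_four]
    exact coordThree_congr 0 0 (by push_cast; ring) (by push_cast; ring)
  | n + 9 =>
    rw [kleinCoord_of_eight_lt _ _ (by omega), show halfTurn (n + 9) = n + 9 from rfl,
      kleinCoord_of_eight_lt _ _ (by omega)]

/-! ### Values on a fundamental rectangle of the full symmetry group -/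

theorem circleDist_four {s t : ℝ} (n : ℤ) (h : t = s + n * 4 ∨ t = -s + n * 4) (h0 : 0 ≤ s)
    (h2 : s ≤ 2) : circleDist 4 t = s := by
  have hs : circleDist 4 s = s := by
    rw [circleDist_eq_abs (by norm_num) (by rw [abs_of_nonneg h0]; linarith), abs_of_nonneg h0]
  rcases h with h | h
  · rw [circleDist_congr n h, hs]
  · rw [circleDist_congr n h, circleDist_neg, hs]

theorem circleDist_eight {s t : ℝ} (n : ℤ) (h : t = s + n * 8 ∨ t = -s + n * 8) (h0 : 0 ≤ s)
    (h4 : s ≤ 4) : circleDist 8 t = s := by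
  have hs : circleDist 8 s = s := by
    rw [circleDist_eq_abs (by norm_num) (by rw [abs_of_nonneg h0]; linarith), abs_of_nonneg h0]
  rcases h with h | h
  · rw [circleDist_congr n h, hs]
  · rw [circleDist_congr n h, circleDist_neg, hs]

section Rectangle

variable {x y : ℝ}

/-- The star of the lift `(0, 1)` is the diamond `|x| + |y - 1| ≤ 2` cut off at `y = 2`. The two
terms of the minimum in `hatOne` vanish along the diamond and on the lines `y = -1` and `y = 2`. -/
theorem hatOne_eq_zero (h : 2 ≤ circleDist 8 x + circleDist 4 (y - 1) ∨
    3 / 2 ≤ circleDist 4 (y - 1 / 2)) : hatOne x y = 0 := by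
  unfold hatOne
  refine max_eq_left ?_
  rcases h with h | h
  · exact (min_le_left _ _).trans (by linarith)
  · exact (min_le_right _ _).trans (by linarith)

/-- The star of the lift `(1, 0)` is the diamond `|x - 1| + |y| ≤ 2` cut off at `|y| = 1` and at `x
= 0`. The third term vanishes at `x = 0` and `x = 3`, the two extremes of the star. -/
theorem coordThree_eq_zero (h : 2 ≤ circleDist 4 (x - 1) + circleDist 4 y ∨ 1 ≤ circleDist 4 y ∨
    3 / 2 ≤ circleDist 4 (x - 3 / 2)) : coordThree x y = 0 := by
  unfold coordThree
  refine max_eq_left ?_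
  rcases h with h | h | h
  · exact (min_le_left _ _).trans (by linarith)
  · exact (min_le_right _ _).trans ((min_le_left _ _).trans (by linarith))
  · exact (min_le_right _ _).trans ((min_le_right _ _).trans (by linarith))

theorem circleDist_four_sub_half (hy0 : 0 ≤ y) (hy1 : y ≤ 1) :
    circleDist 4 (y - 1 / 2) = |y - 1 / 2| :=
  circleDist_eq_abs (by norm_num) (by rw [abs_le]; constructor <;> linarith)

theorem kleinCoord_one_rect (hx0 : 0 ≤ x) (hx2 : x ≤ 2) (hy0 : 0 ≤ y) (hy1 : y ≤ 1) :
    kleinCoord x y 1 = max 0 ((1 - x + y) / 2) := by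
  rw [kleinCoord_one, coordOne, hatOne_eq_zero (x := x + 4), add_zero, hatOne,
    circleDist_eight (s := x) 0 (Or.inl (by push_cast; ring)) hx0 (by linarith),
    circleDist_four (s := 1 - y) 0 (Or.inr (by push_cast; ring)) (by linarith) (by linarith),
    circleDist_four_sub_half hy0 hy1, min_eq_left]
  · congr 1; ring
  · rcases abs_cases (y - 1 / 2) with ⟨h, -⟩ | ⟨h, -⟩ <;> rw [h] <;> linarith
  · rw [circleDist_eight (s := 4 - x) 1 (Or.inr (by push_cast; ring)) (by linarith) (by linarith),
      circleDist_four (s := 1 + y) 0 (Or.inr (by push_cast; ring)) (by linarith) (by linarith)]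
    left; linarith

theorem kleinCoord_two_rect (hx0 : 0 ≤ x) (hx2 : x ≤ 2) (hy0 : 0 ≤ y) (hy1 : y ≤ 1) :
    kleinCoord x y 2 = max 0 ((1 - x - y) / 2) := by
  rw [kleinCoord_two, coordOne, hatOne_eq_zero (x := x + 4), add_zero, hatOne,
    circleDist_eight (s := x) 0 (Or.inl (by push_cast; ring)) hx0 (by linarith),
    circleDist_four (s := 1 + y) 0 (Or.inr (by push_cast; ring)) (by linarith) (by linarith),
    circleDist_four (s := y + 1 / 2) 0 (Or.inr (by push_cast; ring)) (by linarith) (by linarith),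
    min_eq_left]
  · congr 1; ring
  · linarith
  · rw [circleDist_eight (s := 4 - x) 1 (Or.inr (by push_cast; ring)) (by linarith) (by linarith),
      circleDist_four (t := - -y - 1) (s := 1 - y) 0 (Or.inr (by push_cast; ring)) (by linarith)
        (by linarith)]
    left; linarith

theorem kleinCoord_three_rect (hx0 : 0 ≤ x) (hx2 : x ≤ 2) (hy0 : 0 ≤ y) (hy1 : y ≤ 1) :
    kleinCoord x y 3 = min x (min (1 - y) ((3 - x - y) / 2)) := by
  have h1 : circleDist 4 (x - 1) = |x - 1| :=
    circleDist_eq_abs (by norm_num) (by rw [abs_le]; constructor <;> linarith)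
  have h2 : circleDist 4 (x - 3 / 2) = |x - 3 / 2| :=
    circleDist_eq_abs (by norm_num) (by rw [abs_le]; constructor <;> linarith)
  rw [kleinCoord_three, coordThree, h1, h2,
    circleDist_four (s := y) 0 (Or.inl (by push_cast; ring)) hy0 (by linarith)]
  have h3 : |x - 1| + y ≤ 2 := by
    rcases abs_cases (x - 1) with ⟨h, -⟩ | ⟨h, -⟩ <;> linarith
  have h4 : |x - 3 / 2| ≤ 3 / 2 := by rw [abs_le]; constructor <;> linarith
  rw [max_eq_right (le_min (by linarith) (le_min (by linarith) (by linarith)))]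
  rcases abs_cases (x - 1) with ⟨h, h'⟩ | ⟨h, h'⟩
  · rw [h, min_eq_right (a := x) ((min_le_right _ _).trans (by linarith)), min_comm (1 - y),
      min_comm (1 - y), ← min_assoc, min_eq_left (b := 3 / 2 - |x - 3 / 2|)]
    · congr 1; ring
    · rcases abs_cases (x - 3 / 2) with ⟨h, -⟩ | ⟨h, -⟩ <;> linarith
  · rw [h, abs_of_nonpos (by linarith), min_eq_left (b := (3 - x - y) / 2) (by linarith),
      min_eq_right, min_comm]
    · congr 1; ring
    · rcases le_total x (1 - y) with h | h
      · exact (min_le_right _ _).trans (by linarith)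
      · exact (min_le_left _ _).trans (by linarith)

theorem kleinCoord_four_rect (hx0 : 0 ≤ x) (hx2 : x ≤ 2) (hy0 : 0 ≤ y) (hy1 : y ≤ 1) :
    kleinCoord x y 4 = max 0 ((x - 1 - y) / 2) := by
  rw [kleinCoord_four]
  rcases le_total x 1 with hx | hx
  · rw [coordThree_eq_zero, max_eq_left (by linarith)]
    rcases le_total x (1 / 2) with h | h
    · rw [circleDist_four (t := -x - 3 / 2) (s := x + 3 / 2) 0 (Or.inr (by push_cast; ring))
        (by linarith) (by linarith)]
      right; right; linarith
    · rw [circleDist_four (t := -x - 3 / 2) (s := 5 / 2 - x) (-1) (Or.inl (by push_cast; ring))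
        (by linarith) (by linarith)]
      right; right; linarith
  · rw [coordThree, circleDist_four (t := y) (s := y) 0 (Or.inl (by push_cast; ring)) hy0
        (by linarith), circleDist_four (t := -x - 1) (s := 3 - x) (-1) (Or.inl (by push_cast; ring)) (by linarith)
        (by linarith)]
    have h2 : circleDist 4 (-x - 3 / 2) = |5 / 2 - x| := by
      rw [circleDist_congr (t := 5 / 2 - x) (-1) (by push_cast; ring)]
      exact circleDist_eq_abs (by norm_num) (by rw [abs_le]; constructor <;> linarith)
    rw [h2, abs_of_nonneg (by linarith), min_eq_left (le_min (by linarith) (by linarith))]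
    congr 1; ring

theorem kleinCoord_five_rect (hx0 : 0 ≤ x) (hx2 : x ≤ 2) (hy0 : 0 ≤ y) (hy1 : y ≤ 1) :
    kleinCoord x y 5 = max 0 (min ((x + y - 1) / 2) y) := by
  rw [kleinCoord_five, coordOne, hatOne_eq_zero (x := 2 - x + 4), add_zero, hatOne,
    circleDist_eight (s := 2 - x) 0 (Or.inl (by push_cast; ring)) (by linarith) (by linarith),
    circleDist_four (s := 1 - y) 0 (Or.inl (by push_cast; ring)) (by linarith) (by linarith),
    circleDist_four (s := 3 / 2 - y) 0 (Or.inl (by push_cast; ring)) (by linarith) (by linarith)]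
  · congr 2 <;> ring
  · rw [circleDist_eight (s := 2 + x) 1 (Or.inr (by push_cast; ring)) (by linarith) (by linarith),
      circleDist_four (s := 1 + y) (-1) (Or.inl (by push_cast; ring)) (by linarith) (by linarith)]
    left; linarith

theorem kleinCoord_six_rect (hx0 : 0 ≤ x) (hx2 : x ≤ 2) (hy0 : 0 ≤ y) (hy1 : y ≤ 1) :
    kleinCoord x y 6 = 0 := by
  rw [kleinCoord_six, coordOne, hatOne_eq_zero (x := 2 - x + 4), add_zero, hatOne_eq_zero]
  · right
    rcases le_total y (1 / 2) with h | h
    · rw [circleDist_four (t := y - 2 - 1 / 2) (s := 3 / 2 + y) (-1) (Or.inl (by push_cast; ring))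
        (by linarith) (by linarith)]
      linarith
    · rw [circleDist_four (t := y - 2 - 1 / 2) (s := 5 / 2 - y) 0 (Or.inr (by push_cast; ring))
        (by linarith) (by linarith)]
      linarith
  · rw [circleDist_eight (s := 2 + x) 1 (Or.inr (by push_cast; ring)) (by linarith) (by linarith),
      circleDist_four (s := 1 - y) 0 (Or.inl (by push_cast; ring)) (by linarith) (by linarith)]
    left; linarith

theorem kleinCoord_seven_rect (hy0 : 0 ≤ y) (hy1 : y ≤ 1) : kleinCoord x y 7 = 0 := by
  rw [kleinCoord_seven, coordThree_eq_zero]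
  right; left
  rw [circleDist_four (s := 2 - y) 0 (Or.inl (by push_cast; ring)) (by linarith) (by linarith)]
  linarith

theorem kleinCoord_eight_rect (hy0 : 0 ≤ y) (hy1 : y ≤ 1) : kleinCoord x y 8 = 0 := by
  rw [kleinCoord_eight, coordThree_eq_zero]
  right; left
  rw [circleDist_four (s := 2 - y) 0 (Or.inl (by push_cast; ring)) (by linarith) (by linarith)]
  linarith

/-- The three triangles that meet the rectangle. -/
theorem kleinCoord_rect (hx0 : 0 ≤ x) (hx2 : x ≤ 2) (hy0 : 0 ≤ y) (hy1 : y ≤ 1) :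
    (kleinCoord x y 6 = 0 ∧ kleinCoord x y 7 = 0 ∧ kleinCoord x y 8 = 0) ∧
    ((x + y ≤ 1 ∧ kleinCoord x y 1 = (1 - x + y) / 2 ∧ kleinCoord x y 2 = (1 - x - y) / 2 ∧
        kleinCoord x y 3 = x ∧ kleinCoord x y 4 = 0 ∧ kleinCoord x y 5 = 0) ∨
      (1 ≤ x + y ∧ x ≤ 1 + y ∧ kleinCoord x y 1 = (1 - x + y) / 2 ∧ kleinCoord x y 2 = 0 ∧
        kleinCoord x y 3 = 1 - y ∧ kleinCoord x y 4 = 0 ∧ kleinCoord x y 5 = (x + y - 1) / 2) ∨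
      (1 + y ≤ x ∧ kleinCoord x y 1 = 0 ∧ kleinCoord x y 2 = 0 ∧
        kleinCoord x y 3 = (3 - x - y) / 2 ∧ kleinCoord x y 4 = (x - 1 - y) / 2 ∧
        kleinCoord x y 5 = y)) := by
  refine ⟨⟨kleinCoord_six_rect hx0 hx2 hy0 hy1, kleinCoord_seven_rect hy0 hy1,
    kleinCoord_eight_rect hy0 hy1⟩, ?_⟩
  rw [kleinCoord_one_rect hx0 hx2 hy0 hy1, kleinCoord_two_rect hx0 hx2 hy0 hy1,
    kleinCoord_three_rect hx0 hx2 hy0 hy1, kleinCoord_four_rect hx0 hx2 hy0 hy1,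
    kleinCoord_five_rect hx0 hx2 hy0 hy1]
  rcases le_total (x + y) 1 with h | h
  · refine Or.inl ⟨h, max_eq_right (by linarith), max_eq_right (by linarith),
      min_eq_left (le_min (by linarith) (by linarith)), max_eq_left (by linarith),
      max_eq_left ((min_le_left _ _).trans (by linarith))⟩
  · rcases le_total x (1 + y) with h' | h'
    · refine Or.inr (Or.inl ⟨h, h', max_eq_right (by linarith), max_eq_left (by linarith), ?_,
        max_eq_left (by linarith), ?_⟩)
      · rw [min_eq_left (by linarith : 1 - y ≤ (3 - x - y) / 2), min_eq_right (by linarith)]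
      · rw [min_eq_left (by linarith), max_eq_right (by linarith)]
    · refine Or.inr (Or.inr ⟨h', max_eq_left (by linarith), max_eq_left (by linarith), ?_,
        max_eq_right (by linarith), ?_⟩)
      · rw [min_eq_right (by linarith : (3 - x - y) / 2 ≤ 1 - y), min_eq_right (by linarith)]
      · rw [min_eq_right (by linarith), max_eq_right (by linarith)]

end Rectangle

/-! ### The Klein bottle as a quotient of the plane -/

theorem KleinRel.refl (x y : ℝ) : KleinRel x y x y := ⟨0, 0, Or.inl ⟨by simp, by simp⟩⟩

theorem KleinRel.of_eq {x y x' y' : ℝ} (hx : x' = x) (hy : y' = y) : KleinRel x y x' y' := by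
  rw [hx, hy]; exact KleinRel.refl x y

theorem KleinRel.glide {x y x' y' : ℝ} (hx : x' = x - 4) (hy : y' = -y) : KleinRel x y x' y' :=
  ⟨-1, 0, Or.inr ⟨by rw [hx]; push_cast; ring, by rw [hy]; push_cast; ring⟩⟩

theorem KleinRel.symm {x y x' y' : ℝ} (h : KleinRel x y x' y') : KleinRel x' y' x y := by
  obtain ⟨m, n, ⟨hx, hy⟩ | ⟨hx, hy⟩⟩ := h
  · exact ⟨-m, -n, Or.inl ⟨by rw [hx]; push_cast; ring, by rw [hy]; push_cast; ring⟩⟩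
  · exact ⟨-m - 1, n, Or.inr ⟨by rw [hx]; push_cast; ring, by rw [hy]; ring⟩⟩

theorem KleinRel.trans {x y x' y' x'' y'' : ℝ} (h : KleinRel x y x' y')
    (h' : KleinRel x' y' x'' y'') : KleinRel x y x'' y'' := by
  obtain ⟨m, n, ⟨hx, hy⟩ | ⟨hx, hy⟩⟩ := h <;> obtain ⟨m', n', ⟨hx', hy'⟩ | ⟨hx', hy'⟩⟩ := h'
  · exact ⟨m + m', n + n', Or.inl ⟨by rw [hx', hx]; push_cast; ring,
      by rw [hy', hy]; push_cast; ring⟩⟩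
  · exact ⟨m + m', -n + n', Or.inr ⟨by rw [hx', hx]; push_cast; ring,
      by rw [hy', hy]; push_cast; ring⟩⟩
  · exact ⟨m + m', n + n', Or.inr ⟨by rw [hx', hx]; push_cast; ring,
      by rw [hy', hy]; push_cast; ring⟩⟩
  · exact ⟨m + m' + 1, -n + n', Or.inl ⟨by rw [hx', hx]; push_cast; ring,
      by rw [hy', hy]; push_cast; ring⟩⟩

theorem KleinRel.flipX {x y x' y' : ℝ} (h : KleinRel x y x' y') : KleinRel (-x) y (-x') y' := by
  obtain ⟨m, n, ⟨hx, hy⟩ | ⟨hx, hy⟩⟩ := h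
  · exact ⟨-m, n, Or.inl ⟨by rw [hx]; push_cast; ring, hy⟩⟩
  · exact ⟨-m - 1, n, Or.inr ⟨by rw [hx]; push_cast; ring, hy⟩⟩

theorem KleinRel.flipY {x y x' y' : ℝ} (h : KleinRel x y x' y') : KleinRel x (-y) x' (-y') := by
  obtain ⟨m, n, ⟨hx, hy⟩ | ⟨hx, hy⟩⟩ := h
  · exact ⟨m, -n, Or.inl ⟨hx, by rw [hy]; push_cast; ring⟩⟩
  · exact ⟨m, -n, Or.inr ⟨hx, by rw [hy]; push_cast; ring⟩⟩

theorem KleinRel.halfTurn {x y x' y' : ℝ} (h : KleinRel x y x' y') :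
    KleinRel (2 - x) (2 - y) (2 - x') (2 - y') := by
  obtain ⟨m, n, ⟨hx, hy⟩ | ⟨hx, hy⟩⟩ := h
  · exact ⟨-m, -n, Or.inl ⟨by rw [hx]; push_cast; ring, by rw [hy]; push_cast; ring⟩⟩
  · exact ⟨-m - 1, -n + 1, Or.inr ⟨by rw [hx]; push_cast; ring, by rw [hy]; push_cast; ring⟩⟩

/-- Subtracting the nearest multiples of `4` from both coordinates leaves a point of `[-2, 2]²`,
whose quadrant is then recorded by signs. -/
theorem exists_signed_kleinRel (x y : ℝ) : ∃ u w : ℝ, 0 ≤ u ∧ u ≤ 2 ∧ 0 ≤ w ∧ w ≤ 2 ∧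
    (KleinRel u w x y ∨ KleinRel (-u) w x y ∨ KleinRel u (-w) x y ∨ KleinRel (-u) (-w) x y) := by
  have hround : ∀ t : ℝ, |t - round (t / 4) * 4| ≤ 2 := by
    intro t
    have := abs_sub_round (t / 4)
    rw [show t - round (t / 4) * 4 = (t / 4 - round (t / 4)) * 4 by ring, abs_mul]
    norm_num
    linarith
  set r := x - round (x / 4) * 4 with hr
  set s := y - round (y / 4) * 4 with hs
  have key : KleinRel r s x y ∨ KleinRel r (-s) x y := by
    -- An even multiple of `4` in the direction of `x` is a translation in the group; an odd one
    -- occurs only in a glide, which costs a sign in `y`.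
    rcases Int.even_or_odd' (round (x / 4)) with ⟨m, hm | hm⟩
    · refine Or.inl ⟨m, round (y / 4), Or.inl ⟨?_, by rw [hs]; ring⟩⟩
      rw [hr, hm]; push_cast; ring
    · refine Or.inr ⟨m, round (y / 4), Or.inr ⟨?_, by rw [hs]; ring⟩⟩
      rw [hr, hm]; push_cast; ring
  refine ⟨|r|, |s|, abs_nonneg _, hround x, abs_nonneg _, hround y, ?_⟩
  rcases abs_choice r with h | h <;> rcases abs_choice s with h' | h' <;> rw [h, h'] <;>
    (try simp only [neg_neg]) <;> tauto

/-- A property of the points of the plane holds everywhere if it holds on the fundamental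
rectangle and is invariant under the symmetries. -/
theorem kleinBottle_induction {p : ℝ → ℝ → Prop}
    (hrect : ∀ a b, 0 ≤ a → a ≤ 2 → 0 ≤ b → b ≤ 1 → p a b)
    (hX : ∀ x y, p x y → p (-x) y) (hY : ∀ x y, p x y → p x (-y))
    (hT : ∀ x y, p x y → p (2 - x) (2 - y))
    (hrel : ∀ x y x' y', KleinRel x y x' y' → p x y → p x' y') (x y : ℝ) : p x y := by
  obtain ⟨u, w, hu0, hu2, hw0, hw2, h⟩ := exists_signed_kleinRel x y
  have huw : p u w := by
    rcases le_total w 1 with h1 | h1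
    · exact hrect u w hu0 hu2 hw0 h1
    · have := hT _ _ (hrect (2 - u) (2 - w) (by linarith) (by linarith) (by linarith)
        (by linarith))
      simpa using this
  rcases h with h | h | h | h
  · exact hrel _ _ _ _ h huw
  · exact hrel _ _ _ _ h (hX _ _ huw)
  · exact hrel _ _ _ _ h (hY _ _ huw)
  · exact hrel _ _ _ _ h (hX _ _ (hY _ _ huw))

/-! ### Plane coordinates take values in the polyhedron of the Klein bottle -/

theorem flipX_flipX (v : ℕ) : flipX (flipX v) = v := by
  match v with
  | 0 | 1 | 2 | 3 | 4 | 5 | 6 | 7 | 8 => rfl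
  | _ + 9 => rfl

theorem flipY_flipY (v : ℕ) : flipY (flipY v) = v := by
  match v with
  | 0 | 1 | 2 | 3 | 4 | 5 | 6 | 7 | 8 => rfl
  | _ + 9 => rfl

theorem halfTurn_halfTurn (v : ℕ) : halfTurn (halfTurn v) = v := by
  match v with
  | 0 | 1 | 2 | 3 | 4 | 5 | 6 | 7 | 8 => rfl
  | _ + 9 => rfl

theorem comp_mem_realization_kleinBottle8 {f : ℕ → ℕ} (hf : ∀ v, f (f v) = v)
    (ht : ∀ t ∈ kleinTriangles, ∃ t' ∈ kleinTriangles,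
      ({f t.1, f t.2.1, f t.2.2} : Finset ℕ) ⊆ {t'.1, t'.2.1, t'.2.2}) {w : ℕ → ℝ}
    (hw : w ∈ realization kleinBottle8) : (fun v => w (f v)) ∈ realization kleinBottle8 := by
  obtain ⟨hw0, s, hs, hws, hsum⟩ := hw
  obtain ⟨hne, t, htm, hst⟩ := mem_kleinBottle8.1 hs
  obtain ⟨t', ht', htt⟩ := ht t htm
  refine ⟨fun v => hw0 _, s.image f, mem_kleinBottle8.2 ⟨hne.image f, t', ht', ?_⟩,
    fun v hv => hws _ fun h => hv ?_, ?_⟩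
  · refine (Finset.image_subset_image hst).trans (Finset.Subset.trans ?_ htt)
    simp [Finset.image_insert]
  · rw [← hf v]
    exact Finset.mem_image_of_mem f h
  · rw [Finset.sum_image fun a _ b _ h => by rw [← hf a, h, hf b], ← hsum]
    simp only [hf]

theorem flipX_triangles : ∀ t ∈ kleinTriangles, ∃ t' ∈ kleinTriangles,
    ({flipX t.1, flipX t.2.1, flipX t.2.2} : Finset ℕ) ⊆ {t'.1, t'.2.1, t'.2.2} := by
  decide

theorem flipY_triangles : ∀ t ∈ kleinTriangles, ∃ t' ∈ kleinTriangles,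
    ({flipY t.1, flipY t.2.1, flipY t.2.2} : Finset ℕ) ⊆ {t'.1, t'.2.1, t'.2.2} := by
  decide

theorem halfTurn_triangles : ∀ t ∈ kleinTriangles, ∃ t' ∈ kleinTriangles,
    ({halfTurn t.1, halfTurn t.2.1, halfTurn t.2.2} : Finset ℕ) ⊆ {t'.1, t'.2.1, t'.2.2} := by
  decide

/-- On the fundamental rectangle the coordinates are those of the triangle `123`, `135` or `345`;
the symmetries carry this to the whole plane, since they act on the vertices by automorphisms. -/
theorem kleinCoord_mem_realization (x y : ℝ) : kleinCoord x y ∈ realization kleinBottle8 := by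
  refine kleinBottle_induction (p := fun x y => kleinCoord x y ∈ realization kleinBottle8)
    ?_ ?_ ?_ ?_ ?_ x y
  · intro x y hx0 hx2 hy0 hy1
    obtain ⟨⟨h6, h7, h8⟩, h⟩ := kleinCoord_rect hx0 hx2 hy0 hy1
    have h0 : kleinCoord x y 0 = 0 := kleinCoord_zero x y
    have key : ∀ t ∈ kleinTriangles, (∀ v ∈ Finset.range 9, 0 ≤ kleinCoord x y v ∧
        (v ∉ ({t.1, t.2.1, t.2.2} : Finset ℕ) → kleinCoord x y v = 0)) →
        kleinCoord x y t.1 + (kleinCoord x y t.2.1 + kleinCoord x y t.2.2) = 1 →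
        kleinCoord x y ∈ realization kleinBottle8 := by
      intro t ht hv hsum
      obtain ⟨h1, h2, h3, h4⟩ := kleinTriangles_bounds t ht
      refine ⟨fun v => ?_, {t.1, t.2.1, t.2.2}, mem_kleinBottle8.2 ⟨by simp, t, ht, subset_rfl⟩,
        fun v hvt => ?_, ?_⟩
      · rcases lt_or_ge 8 v with h | h
        · rw [kleinCoord_of_eight_lt x y h]
        · exact (hv v (by simpa [Nat.lt_succ_iff] using h)).1
      · rcases lt_or_ge 8 v with h | h
        · rw [kleinCoord_of_eight_lt x y h]
        · exact (hv v (by simpa [Nat.lt_succ_iff] using h)).2 hvt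
      · rw [Finset.sum_insert, Finset.sum_pair (by omega), hsum]
        simp; omega
    rcases h with ⟨ha, h1, h2, h3, h4, h5⟩ | ⟨ha, hb, h1, h2, h3, h4, h5⟩ | ⟨ha, h1, h2, h3, h4, h5⟩
    · refine key (1, 2, 3) (by decide) (fun v hv => ?_) (by simp only [h1, h2, h3]; ring)
      rw [Finset.mem_range] at hv
      interval_cases v <;> simp [h0, h1, h2, h3, h4, h5, h6, h7, h8] <;> linarith
    · refine key (1, 3, 5) (by decide) (fun v hv => ?_) (by simp only [h1, h3, h5]; ring)
      rw [Finset.mem_range] at hv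
      interval_cases v <;> simp [h0, h1, h2, h3, h4, h5, h6, h7, h8] <;> linarith
    · refine key (3, 4, 5) (by decide) (fun v hv => ?_) (by simp only [h3, h4, h5]; ring)
      rw [Finset.mem_range] at hv
      interval_cases v <;> simp [h0, h1, h2, h3, h4, h5, h6, h7, h8] <;> linarith
  · intro x y h
    have := comp_mem_realization_kleinBottle8 flipX_flipX flipX_triangles h
    simpa only [← kleinCoord_flipX] using this
  · intro x y h
    have := comp_mem_realization_kleinBottle8 flipY_flipY flipY_triangles h
    simpa only [← kleinCoord_flipY] using this
  · intro x y h
    have := comp_mem_realization_kleinBottle8 halfTurn_halfTurn halfTurn_triangles h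
    simpa only [← kleinCoord_halfTurn] using this
  · intro x y x' y' hr h
    rwa [kleinCoord_eq_of_kleinRel hr]

/-- The eight alternatives are the symmetries that spread the rectangle over `[-2, 2]²`. For each of
them and for each pair of triangles, equal coordinates are a linear system: it is contradictory or
determines how the two points are related. -/
theorem kleinRel_of_rect {a b a' b' x y : ℝ} (f : ℕ → ℕ) (ha0 : 0 ≤ a) (ha2 : a ≤ 2) (hb0 : 0 ≤ b)
    (hb1 : b ≤ 1) (ha0' : 0 ≤ a') (ha2' : a' ≤ 2) (hb0' : 0 ≤ b') (hb1' : b' ≤ 1)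
    (h : ∀ v, kleinCoord a b v = kleinCoord a' b' (f v))
    (hf : (∀ v, f v = v) ∧ x = a' ∧ y = b' ∨ (∀ v, f v = flipX v) ∧ x = -a' ∧ y = b' ∨
      (∀ v, f v = flipY v) ∧ x = a' ∧ y = -b' ∨
      (∀ v, f v = flipY (flipX v)) ∧ x = -a' ∧ y = -b' ∨
      (∀ v, f v = halfTurn v) ∧ x = 2 - a' ∧ y = 2 - b' ∨
      (∀ v, f v = halfTurn (flipX v)) ∧ x = -(2 - a') ∧ y = 2 - b' ∨
      (∀ v, f v = halfTurn (flipY v)) ∧ x = 2 - a' ∧ y = -(2 - b') ∨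
      (∀ v, f v = halfTurn (flipY (flipX v))) ∧ x = -(2 - a') ∧ y = -(2 - b')) :
    KleinRel a b x y := by
  obtain ⟨⟨h6, h7, h8⟩, hp⟩ := kleinCoord_rect ha0 ha2 hb0 hb1
  obtain ⟨⟨h6', h7', h8'⟩, hq⟩ := kleinCoord_rect ha0' ha2' hb0' hb1'
  have e1 := h 1
  have e2 := h 2
  have e3 := h 3
  have e4 := h 4
  have e5 := h 5
  have e6 := h 6
  have e7 := h 7
  have e8 := h 8
  clear h
  rcases hf with ⟨hf, rfl, rfl⟩ | ⟨hf, rfl, rfl⟩ | ⟨hf, rfl, rfl⟩ | ⟨hf, rfl, rfl⟩ |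
    ⟨hf, rfl, rfl⟩ | ⟨hf, rfl, rfl⟩ | ⟨hf, rfl, rfl⟩ | ⟨hf, rfl, rfl⟩ <;>
  · rw [hf] at e1 e2 e3 e4 e5 e6 e7 e8
    try simp only [flipX, flipY, halfTurn] at e1 e2 e3 e4 e5 e6 e7 e8
    clear hf
    rcases hp with ⟨c, h1, h2, h3, h4, h5⟩ | ⟨c, d, h1, h2, h3, h4, h5⟩ | ⟨c, h1, h2, h3, h4, h5⟩ <;>
    rcases hq with ⟨c', h1', h2', h3', h4', h5'⟩ | ⟨c', d', h1', h2', h3', h4', h5'⟩ |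
      ⟨c', h1', h2', h3', h4', h5'⟩ <;>
    · simp only [h1, h2, h3, h4, h5, h6, h7, h8, h1', h2', h3', h4', h5', h6', h7', h8']
        at e1 e2 e3 e4 e5 e6 e7 e8
      clear h1 h2 h3 h4 h5 h6 h7 h8 h1' h2' h3' h4' h5' h6' h7' h8'
      -- Two such points coincide, unless the first lies on the edge `x = 2` and the second on `x =
      -- -2`, which the glide identifies.
      first
      | exact KleinRel.of_eq (by linarith) (by linarith)
      | exact KleinRel.glide (by linarith) (by linarith)

theorem kleinRel_of_kleinCoord_eq_rect {a b x y : ℝ} (ha0 : 0 ≤ a) (ha2 : a ≤ 2) (hb0 : 0 ≤ b)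
    (hb1 : b ≤ 1) (h : kleinCoord a b = kleinCoord x y) : KleinRel a b x y := by
  obtain ⟨u, w, hu0, hu2, hw0, hw2, hr⟩ := exists_signed_kleinRel x y
  obtain ⟨a', b', ha0', ha2', hb0', hb1', huw⟩ : ∃ a' b' : ℝ, 0 ≤ a' ∧ a' ≤ 2 ∧ 0 ≤ b' ∧ b' ≤ 1 ∧
      ((u = a' ∧ w = b') ∨ (u = 2 - a' ∧ w = 2 - b')) := by
    rcases le_total w 1 with h1 | h1
    · exact ⟨u, w, hu0, hu2, hw0, h1, Or.inl ⟨rfl, rfl⟩⟩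
    · exact ⟨2 - u, 2 - w, by linarith, by linarith, by linarith, by linarith,
        Or.inr ⟨by ring, by ring⟩⟩
  have key : ∀ x' y', KleinRel x' y' x y → ∀ f : ℕ → ℕ,
      (∀ v, kleinCoord x' y' v = kleinCoord a' b' (f v)) →
      (((∀ v, kleinCoord a b v = kleinCoord a' b' (f v)) → KleinRel a b x' y') →
      KleinRel a b x y) := by
    intro x' y' hr' f hf h'
    refine (h' fun v => ?_).trans hr'
    rw [h, kleinCoord_eq_of_kleinRel hr', hf]
  rcases huw with ⟨rfl, rfl⟩ | ⟨rfl, rfl⟩ <;> rcases hr with hr | hr | hr | hr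
  · refine key _ _ hr id (fun v => rfl) fun h' => kleinRel_of_rect _ ha0 ha2 hb0 hb1 ha0' ha2' hb0'
      hb1' h' ?_
    simp
  · refine key _ _ hr flipX (kleinCoord_flipX _ _) fun h' => kleinRel_of_rect _ ha0 ha2 hb0 hb1
      ha0' ha2' hb0' hb1' h' ?_
    simp
  · refine key _ _ hr flipY (kleinCoord_flipY _ _) fun h' => kleinRel_of_rect _ ha0 ha2 hb0 hb1
      ha0' ha2' hb0' hb1' h' ?_
    simp
  · refine key _ _ hr (fun v => flipY (flipX v))
      (fun v => by rw [kleinCoord_flipX, kleinCoord_flipY]) fun h' =>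
      kleinRel_of_rect _ ha0 ha2 hb0 hb1 ha0' ha2' hb0' hb1' h' ?_
    simp
  · refine key _ _ hr halfTurn (kleinCoord_halfTurn _ _) fun h' => kleinRel_of_rect _ ha0 ha2 hb0
      hb1 ha0' ha2' hb0' hb1' h' ?_
    simp
  · refine key _ _ hr (fun v => halfTurn (flipX v))
      (fun v => by rw [kleinCoord_flipX, kleinCoord_halfTurn]) fun h' =>
      kleinRel_of_rect _ ha0 ha2 hb0 hb1 ha0' ha2' hb0' hb1' h' ?_
    simp
  · refine key _ _ hr (fun v => halfTurn (flipY v))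
      (fun v => by rw [kleinCoord_flipY, kleinCoord_halfTurn]) fun h' =>
      kleinRel_of_rect _ ha0 ha2 hb0 hb1 ha0' ha2' hb0' hb1' h' ?_
    simp
  · refine key _ _ hr (fun v => halfTurn (flipY (flipX v)))
      (fun v => by rw [kleinCoord_flipX, kleinCoord_flipY, kleinCoord_halfTurn]) fun h' =>
      kleinRel_of_rect _ ha0 ha2 hb0 hb1 ha0' ha2' hb0' hb1' h' ?_
    simp

/-- Injectivity modulo the deck group. The second point is arbitrary throughout, so a symmetry that
moves the first point into the rectangle can be applied to both. -/
theorem kleinRel_of_kleinCoord_eq {x y x' y' : ℝ} (h : kleinCoord x y = kleinCoord x' y') :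
    KleinRel x y x' y' := by
  refine kleinBottle_induction
    (p := fun x y => ∀ x' y', kleinCoord x y = kleinCoord x' y' → KleinRel x y x' y')
    ?_ ?_ ?_ ?_ ?_ x y x' y' h
  · intro a b ha0 ha2 hb0 hb1 x' y' h
    exact kleinRel_of_kleinCoord_eq_rect ha0 ha2 hb0 hb1 h
  · intro x y hxy x' y' h
    have := (hxy (-x') y' (funext fun v => ?_)).flipX
    · rwa [neg_neg] at this
    · rw [kleinCoord_flipX, ← h, kleinCoord_flipX, flipX_flipX]
  · intro x y hxy x' y' h
    have := (hxy x' (-y') (funext fun v => ?_)).flipY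
    · rwa [neg_neg] at this
    · rw [kleinCoord_flipY, ← h, kleinCoord_flipY, flipY_flipY]
  · intro x y hxy x' y' h
    have := (hxy (2 - x') (2 - y') (funext fun v => ?_)).halfTurn
    · rwa [sub_sub_cancel, sub_sub_cancel] at this
    · rw [kleinCoord_halfTurn, ← h, kleinCoord_halfTurn, halfTurn_halfTurn]
  · intro x y x' y' hr hxy x'' y'' h
    rw [kleinCoord_eq_of_kleinRel hr] at h
    exact hr.symm.trans (hxy _ _ h)

/-! ### Every point of the polyhedron comes from the plane -/

/-- Every point of the simplex `s` is the image of a point of the plane. -/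
def Covered (s : Finset ℕ) : Prop :=
  ∀ w : ℕ → ℝ, (∀ v, 0 ≤ w v) → (∀ v, v ∉ s → w v = 0) → ∑ v ∈ s, w v = 1 →
    ∃ x y, kleinCoord x y = w

theorem Covered.image {f : ℕ → ℕ} (hf : ∀ v, f (f v) = v)
    (h : ∀ x y, ∃ x' y', ∀ v, kleinCoord x' y' v = kleinCoord x y (f v)) {s s' : Finset ℕ}
    (hs : Covered s) (hs' : s.image f = s') : Covered s' := by
  intro w hw0 hws hsum
  subst hs'
  have h1 : ∀ v, v ∉ s → w (f v) = 0 := by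
    refine fun v hv => hws _ fun h' => hv ?_
    obtain ⟨u, hu, huv⟩ := Finset.mem_image.mp h'
    rw [← hf v, ← huv, hf]
    exact hu
  have h2 : ∑ v ∈ s, w (f v) = 1 := by
    rw [← hsum, Finset.sum_image fun a _ b _ h => by rw [← hf a, h, hf b]]
  obtain ⟨x, y, hxy⟩ := hs (fun v => w (f v)) (fun v => hw0 _) h1 h2
  obtain ⟨x', y', hxy'⟩ := h x y
  exact ⟨x', y', funext fun v => by rw [hxy', hxy]; exact congrArg w (hf v)⟩

/-- A triangle that is cut in two by the boundary of the rectangle is invariant under a reflection;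
only the half inside the rectangle has to be treated. -/
theorem covered_of_le {s : Finset ℕ} {f : ℕ → ℕ} (hf : ∀ v, f (f v) = v) (hfs : s.image f = s)
    (h : ∀ x y, ∃ x' y', ∀ v, kleinCoord x' y' v = kleinCoord x y (f v)) (a : ℕ)
    (hs : ∀ w : ℕ → ℝ, (∀ v, 0 ≤ w v) → (∀ v, v ∉ s → w v = 0) → ∑ v ∈ s, w v = 1 →
      w (f a) ≤ w a → ∃ x y, kleinCoord x y = w) : Covered s := by
  intro w hw0 hws hsum
  rcases le_total (w (f a)) (w a) with h' | h'
  · exact hs w hw0 hws hsum h'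
  · have h1 : ∀ v, v ∉ s → w (f v) = 0 := by
      refine fun v hv => hws _ fun h' => hv ?_
      rw [← hfs, ← hf v]
      exact Finset.mem_image_of_mem f h'
    have h2 : ∑ v ∈ s, w (f v) = 1 := by
      rw [← hsum]
      conv_rhs => rw [← hfs]
      rw [Finset.sum_image fun a _ b _ h => by rw [← hf a, h, hf b]]
    obtain ⟨x, y, hxy⟩ := hs (fun v => w (f v)) (fun v => hw0 _) h1 h2
      (by simpa only [hf] using h')
    obtain ⟨x', y', hxy'⟩ := h x y
    exact ⟨x', y', funext fun v => by rw [hxy', hxy]; exact congrArg w (hf v)⟩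

theorem exists_flipX (x y : ℝ) : ∃ x' y', ∀ v, kleinCoord x' y' v = kleinCoord x y (flipX v) :=
  ⟨-x, y, kleinCoord_flipX x y⟩

theorem exists_flipY (x y : ℝ) : ∃ x' y', ∀ v, kleinCoord x' y' v = kleinCoord x y (flipY v) :=
  ⟨x, -y, kleinCoord_flipY x y⟩

theorem exists_halfTurn (x y : ℝ) :
    ∃ x' y', ∀ v, kleinCoord x' y' v = kleinCoord x y (halfTurn v) :=
  ⟨2 - x, 2 - y, kleinCoord_halfTurn x y⟩

theorem eq_kleinCoord_of_rect {x y : ℝ} {w : ℕ → ℝ} (hx0 : 0 ≤ x) (hx2 : x ≤ 2) (hy0 : 0 ≤ y)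
    (hy1 : y ≤ 1) (h0 : w 0 = 0) (h8 : ∀ v, 5 < v → w v = 0)
    (h : w 1 = max 0 ((1 - x + y) / 2) ∧ w 2 = max 0 ((1 - x - y) / 2) ∧
      w 3 = min x (min (1 - y) ((3 - x - y) / 2)) ∧ w 4 = max 0 ((x - 1 - y) / 2) ∧
      w 5 = max 0 (min ((x + y - 1) / 2) y)) : kleinCoord x y = w := by
  obtain ⟨h1, h2, h3, h4, h5⟩ := h
  ext v
  rcases lt_or_ge 8 v with hv | hv
  · rw [kleinCoord_of_eight_lt x y hv, h8 v (by omega)]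
  · interval_cases v
    · rw [kleinCoord_zero, h0]
    · rw [h1, kleinCoord_one_rect hx0 hx2 hy0 hy1]
    · rw [h2, kleinCoord_two_rect hx0 hx2 hy0 hy1]
    · rw [h3, kleinCoord_three_rect hx0 hx2 hy0 hy1]
    · rw [h4, kleinCoord_four_rect hx0 hx2 hy0 hy1]
    · rw [h5, kleinCoord_five_rect hx0 hx2 hy0 hy1]
    · rw [kleinCoord_six_rect hx0 hx2 hy0 hy1, h8 6 (by omega)]
    · rw [kleinCoord_seven_rect hy0 hy1, h8 7 (by omega)]
    · rw [kleinCoord_eight_rect hy0 hy1, h8 8 (by omega)]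

theorem covered_123 : Covered {1, 2, 3} := by
  refine covered_of_le flipY_flipY (by decide) exists_flipY 1 fun w hw0 hws hsum hle => ?_
  have e : ∑ v ∈ ({1, 2, 3} : Finset ℕ), w v = w 1 + (w 2 + w 3) := by
    rw [Finset.sum_insert (by decide), Finset.sum_pair (by decide)]
  rw [e] at hsum
  have h1 := hw0 1
  have h2 := hw0 2
  have h3 := hw0 3
  change w 2 ≤ w 1 at hle
  -- The witness is the barycentre with weights `w` of the vertices `(0, 1)`, `(0, -1)`, `(1, 0)`.
  refine ⟨w 3, w 1 - w 2, eq_kleinCoord_of_rect h3 (by linarith) (by linarith) (by linarith)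
    (hws 0 (by decide)) (fun v hv => hws v (by simp; omega)) ⟨?_, ?_, ?_, ?_, ?_⟩⟩
  · rw [max_eq_right] <;> linarith
  · rw [max_eq_right] <;> linarith
  · rw [min_eq_left (le_min (by linarith) (by linarith))]
  · rw [hws 4 (by decide), max_eq_left]; linarith
  · rw [hws 5 (by decide), max_eq_left]; exact (min_le_left _ _).trans (by linarith)

theorem covered_135 : Covered {1, 3, 5} := by
  intro w hw0 hws hsum
  have e : ∑ v ∈ ({1, 3, 5} : Finset ℕ), w v = w 1 + (w 3 + w 5) := by
    rw [Finset.sum_insert (by decide), Finset.sum_pair (by decide)]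
  rw [e] at hsum
  have h1 := hw0 1
  have h3 := hw0 3
  have h5 := hw0 5
  -- The vertices are `(0, 1)`, `(1, 0)`, `(2, 1)`; the second coordinate `w 1 + w 5` is rewritten
  -- by means of the total mass.
  refine ⟨w 3 + 2 * w 5, 1 - w 3, eq_kleinCoord_of_rect (by linarith) (by linarith) (by linarith)
    (by linarith) (hws 0 (by decide)) (fun v hv => hws v (by simp; omega)) ⟨?_, ?_, ?_, ?_, ?_⟩⟩
  · rw [max_eq_right] <;> linarith
  · rw [hws 2 (by decide), max_eq_left]; linarith
  · rw [min_eq_left (by linarith : 1 - (1 - w 3) ≤ _), min_eq_right] <;> linarith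
  · rw [hws 4 (by decide), max_eq_left]; linarith
  · rw [min_eq_left, max_eq_right] <;> linarith

theorem covered_345 : Covered {3, 4, 5} := by
  have hinv : ∀ v, flipY (flipX (flipY (flipX v))) = v := by
    intro v
    match v with
    | 0 | 1 | 2 | 3 | 4 | 5 | 6 | 7 | 8 => rfl
    | _ + 9 => rfl
  -- Modulo the glide, `(-x, -y)` is the reflection `(4 - x, y)` in the side `x = 2` of the
  -- rectangle, which halves this triangle.
  refine covered_of_le (f := fun v => flipY (flipX v)) hinv (by decide) (fun x y => ⟨-x, -y, ?_⟩)
    3 fun w hw0 hws hsum hle => ?_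
  · intro v
    rw [kleinCoord_flipX, kleinCoord_flipY]
  have e : ∑ v ∈ ({3, 4, 5} : Finset ℕ), w v = w 3 + (w 4 + w 5) := by
    rw [Finset.sum_insert (by decide), Finset.sum_pair (by decide)]
  rw [e] at hsum
  have h3 := hw0 3
  have h4 := hw0 4
  have h5 := hw0 5
  change w 4 ≤ w 3 at hle
  -- The vertices are `(1, 0)`, `(3, 0)`, `(2, 1)`.
  refine ⟨w 3 + 3 * w 4 + 2 * w 5, w 5, eq_kleinCoord_of_rect (by linarith) (by linarith)
    (by linarith) (by linarith) (hws 0 (by decide)) (fun v hv => hws v (by simp; omega))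
    ⟨?_, ?_, ?_, ?_, ?_⟩⟩
  · rw [hws 1 (by decide), max_eq_left]; linarith
  · rw [hws 2 (by decide), max_eq_left]; linarith
  · rw [min_eq_right (by linarith : _ ≤ 1 - w 5), min_eq_right] <;> linarith
  · rw [max_eq_right] <;> linarith
  · rw [min_eq_right, max_eq_right] <;> linarith

/-- All sixteen triangles are images of `123`, `135` and `345` under the symmetries. -/
theorem exists_kleinCoord_eq {w : ℕ → ℝ} (hw : w ∈ realization kleinBottle8) :
    ∃ x y, kleinCoord x y = w := by
  obtain ⟨hw0, s, hs, hws, hsum⟩ := hw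
  obtain ⟨-, t, ht, hst⟩ := mem_kleinBottle8.1 hs
  suffices h : Covered {t.1, t.2.1, t.2.2} by
    refine h w hw0 (fun v hv => hws v fun h' => hv (hst h')) ?_
    rw [← hsum]
    exact (Finset.sum_subset hst fun v _ hv => hws v hv).symm
  have mX : ∀ s s' : Finset ℕ, Covered s → s.image flipX = s' → Covered s' :=
    fun s s' => Covered.image flipX_flipX exists_flipX
  have mY : ∀ s s' : Finset ℕ, Covered s → s.image flipY = s' → Covered s' :=
    fun s s' => Covered.image flipY_flipY exists_flipY
  have mT : ∀ s s' : Finset ℕ, Covered s → s.image halfTurn = s' → Covered s' :=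
    fun s s' => Covered.image halfTurn_halfTurn exists_halfTurn
  have c124 : Covered {1, 2, 4} := mX _ _ covered_123 (by decide)
  have c146 : Covered {1, 4, 6} := mX _ _ covered_135 (by decide)
  have c236 : Covered {2, 3, 6} := mY _ _ covered_135 (by decide)
  have c245 : Covered {2, 4, 5} := mX _ _ c236 (by decide)
  have c346 : Covered {3, 4, 6} := mY _ _ covered_345 (by decide)
  simp only [kleinTriangles, List.mem_cons, List.not_mem_nil, or_false] at ht
  rcases ht with rfl | rfl | rfl | rfl | rfl | rfl | rfl | rfl | rfl | rfl | rfl | rfl | rfl |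
    rfl | rfl | rfl
  · exact covered_123
  · exact c124
  · exact covered_135
  · exact c146
  · exact mT _ _ covered_135 (by decide)
  · exact mT _ _ c245 (by decide)
  · exact mT _ _ covered_345 (by decide)
  · exact c236
  · exact c245
  · exact mT _ _ c146 (by decide)
  · exact mT _ _ c236 (by decide)
  · exact mT _ _ c346 (by decide)
  · exact covered_345
  · exact c346
  · exact mT _ _ covered_123 (by decide)
  · exact mT _ _ c124 (by decide)

/-! ## Polyhedra of images and of mapping tori -/

/-- Push a mass distribution on a finite set `s` forward along `g`. -/
theorem pushforward_mem_realization {α β : Type*} [DecidableEq β]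
    {K : PreAbstractSimplicialComplex α} (g : α → β) {z : α → ℝ} {s : Finset α}
    (hz0 : ∀ p, 0 ≤ z p) (hs : s ∈ K.faces) (hsum : ∑ p ∈ s, z p = 1) :
    (fun q => ∑ p ∈ s with g p = q, z p) ∈ realization (K.map g) := by
  refine ⟨fun q => Finset.sum_nonneg fun p _ => hz0 p, s.image g, ⟨s, hs, rfl⟩, fun q hq => ?_, ?_⟩
  · refine Finset.sum_eq_zero fun p hp => absurd ?_ hq
    rw [← (Finset.mem_filter.mp hp).2]
    exact Finset.mem_image_of_mem _ (Finset.mem_filter.mp hp).1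
  · rw [← hsum]
    exact Finset.sum_fiberwise_of_maps_to (fun p hp => Finset.mem_image_of_mem _ hp) z

/-- Every face of the image is the image of a face on which `g` is injective, and along an injection
a mass distribution can be lifted vertex by vertex. -/
theorem exists_pushforward_eq {α β : Type*} [DecidableEq α] [DecidableEq β]
    {K : PreAbstractSimplicialComplex α} {g : α → β} {u : β → ℝ} (hu : u ∈ realization (K.map g)) :
    ∃ z : α → ℝ, ∃ s ∈ K.faces, (∀ p, 0 ≤ z p) ∧ (∀ p, p ∉ s → z p = 0) ∧ ∑ p ∈ s, z p = 1 ∧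
      (fun q => ∑ p ∈ s with g p = q, z p) = u := by
  obtain ⟨hu0, t, ⟨s, hs, rfl⟩, hut, hsum⟩ := hu
  simp only at hut hsum
  have hsurj : (s : Set α).SurjOn g (s.image g : Finset β) := by
    rw [Finset.coe_image]
    exact Set.surjOn_image g _
  obtain ⟨r, hrs, hinj, hr⟩ := Finset.exists_subset_injOn_image_eq_of_surjOn (s : Set α) _ hsurj
  have hne : r.Nonempty := by
    rw [← Finset.image_nonempty (f := g), hr, Finset.image_nonempty]
    exact (K.isRelLowerSet_faces hs).1
  refine ⟨fun p => if p ∈ r then u (g p) else 0, r,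
    (K.isRelLowerSet_faces hs).2 (Finset.coe_subset.mp hrs) hne, fun p => ?_,
    fun p hp => if_neg hp, ?_, funext fun q => ?_⟩
  · simp only
    split_ifs
    exacts [hu0 _, le_rfl]
  · rw [← hsum, ← hr, Finset.sum_image hinj]
    exact Finset.sum_congr rfl fun p hp => if_pos hp
  · by_cases hq : q ∈ s.image g
    · rw [← hr] at hq
      obtain ⟨p, hp, rfl⟩ := Finset.mem_image.mp hq
      have hm : p ∈ r.filter (fun p' => g p' = g p) := Finset.mem_filter.mpr ⟨hp, rfl⟩
      rw [Finset.sum_eq_single_of_mem p hm]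
      · exact if_pos hp
      intro p' hp' hne
      exact absurd (hinj (Finset.mem_filter.mp hp').1 hp (Finset.mem_filter.mp hp').2) hne
    · rw [hut q hq]
      refine Finset.sum_eq_zero fun p hp => absurd ?_ hq
      rw [← (Finset.mem_filter.mp hp).2, ← hr]
      exact Finset.mem_image_of_mem _ (Finset.mem_filter.mp hp).1

/-- Push a mass distribution forward along `glue σ`. -/
def pushGlue (σ : Equiv.Perm ℕ) (z : ℕ × ℕ → ℝ) (q : ℕ × ℕ) : ℝ :=
  if q.2 = 0 then z (q.1, 0) + z (σ⁻¹ q.1, 3) else if q.2 < 3 then z q else 0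

/-- In the layers `0` to `3`, the fibre of `glue σ` over a vertex `(v, 0)` is `{(v, 0), (σ⁻¹ v,
3)}`, and those over the layers `1` and `2` are single points. -/
theorem pushGlue_eq_sum (σ : Equiv.Perm ℕ) {z : ℕ × ℕ → ℝ} {s : Finset (ℕ × ℕ)}
    (hs : ∀ p ∈ s, p.2 ≤ 3) (hz : ∀ p, p ∉ s → z p = 0) :
    pushGlue σ z = fun q => ∑ p ∈ s with glue σ p = q, z p := by
  funext q
  obtain ⟨v, j⟩ := q
  have key : ∀ t : Finset (ℕ × ℕ), (∀ p ∈ s, glue σ p = (v, j) → p ∈ t) →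
      (∀ p ∈ t, glue σ p = (v, j)) → ∑ p ∈ s with glue σ p = (v, j), z p = ∑ p ∈ t, z p := by
    intro t h1 h2
    refine Finset.sum_subset (fun p hp => ?_) fun p hp hp' => hz p fun h => hp' ?_
    · exact h1 p (Finset.mem_filter.mp hp).1 (Finset.mem_filter.mp hp).2
    · exact Finset.mem_filter.mpr ⟨h, h2 p hp⟩
  unfold pushGlue
  by_cases hj : j = 0
  · subst hj
    rw [if_pos rfl, key {(v, 0), (σ⁻¹ v, 3)}, Finset.sum_pair (by simp)]
    · rintro ⟨a, b⟩ hp hg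
      have := hs _ hp
      unfold glue at hg
      split_ifs at hg with hb
      · simp [hg]
      · have hb3 : b = 3 := by simp only at this hb; omega
        have ha : σ a = v := congrArg Prod.fst hg
        simp [hb3, ← ha]
    · simp [glue]
  · simp only [hj, if_false]
    by_cases hj3 : j < 3
    · rw [if_pos hj3, key {(v, j)}, Finset.sum_singleton]
      · rintro ⟨a, b⟩ hp hg
        unfold glue at hg
        split_ifs at hg with hb
        · simp [hg]
        · exact absurd (congrArg Prod.snd hg).symm hj
      · simp [glue, hj3]
    · rw [if_neg hj3, key ∅, Finset.sum_empty]
      · rintro ⟨a, b⟩ hp hg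
        unfold glue at hg
        split_ifs at hg with hb
        · rw [hg] at hb
          exact absurd hb hj3
        · exact absurd (congrArg Prod.snd hg).symm hj
      · simp

theorem snd_le_three {M : PreAbstractSimplicialComplex ℕ} {s : Finset (ℕ × ℕ)}
    (hs : s ∈ (staircaseProduct M interval).faces) : ∀ p ∈ s, p.2 ≤ 3 := by
  intro p hp
  obtain ⟨-, j, hj, h⟩ := mem_interval.1 hs.2.1
  have := h (Finset.mem_image_of_mem Prod.snd hp)
  simp at this
  omega

theorem pushGlue_mem_realization {M : PreAbstractSimplicialComplex ℕ} (σ : Equiv.Perm ℕ)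
    {z : ℕ × ℕ → ℝ} (hz : z ∈ realization (staircaseProduct M interval)) :
    pushGlue σ z ∈ realization (twistedProduct M σ) := by
  obtain ⟨hz0, s, hs, hzs, hsum⟩ := hz
  rw [pushGlue_eq_sum σ (snd_le_three hs) hzs]
  exact pushforward_mem_realization _ hz0 hs hsum

theorem exists_pushGlue_eq {M : PreAbstractSimplicialComplex ℕ} {σ : Equiv.Perm ℕ}
    {u : ℕ × ℕ → ℝ} (hu : u ∈ realization (twistedProduct M σ)) :
    ∃ z ∈ realization (staircaseProduct M interval), pushGlue σ z = u := by
  obtain ⟨z, s, hs, hz0, hzs, hsum, h⟩ := exists_pushforward_eq hu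
  exact ⟨z, ⟨hz0, s, hs, hzs, hsum⟩, by rw [pushGlue_eq_sum σ (snd_le_three hs) hzs, h]⟩

/-! ### Coordinates on the mapping torus of a simplicial automorphism -/

/-- Barycentric coordinates on the interval `[0, 3]`. -/
noncomputable def intervalCoord (t : ℝ) (j : ℕ) : ℝ := max 0 (1 - |t - j|)

theorem intervalCoord_eq_zero {t : ℝ} {j : ℕ} (h : t + 1 ≤ j ∨ (j : ℝ) + 1 ≤ t) :
    intervalCoord t j = 0 := by
  refine max_eq_left ?_
  rcases h with h | h
  · rw [abs_of_nonpos (by linarith)]; linarith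
  · rw [abs_of_nonneg (by linarith)]; linarith

theorem intervalCoord_left {t : ℝ} {j : ℕ} (h : (j : ℝ) ≤ t) (h' : t ≤ j + 1) :
    intervalCoord t j = 1 - (t - j) := by
  rw [intervalCoord, abs_of_nonneg (by linarith), max_eq_right (by linarith)]

theorem intervalCoord_right {t : ℝ} {j : ℕ} (h : (j : ℝ) ≤ t) (h' : t ≤ j + 1) :
    intervalCoord t (j + 1) = t - j := by
  rw [intervalCoord, abs_of_nonpos (by push_cast; linarith), max_eq_right (by push_cast; linarith)]
  push_cast
  ring

theorem exists_layer {t : ℝ} (h0 : 0 ≤ t) (h3 : t ≤ 3) :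
    ∃ j < 3, ((j : ℕ) : ℝ) ≤ t ∧ t ≤ j + 1 := by
  rcases le_total t 1 with h | h
  · exact ⟨0, by norm_num, by push_cast; linarith, by push_cast; linarith⟩
  · rcases le_total t 2 with h' | h'
    · exact ⟨1, by norm_num, by push_cast; linarith, by push_cast; linarith⟩
    · exact ⟨2, by norm_num, by push_cast; linarith, by push_cast; linarith⟩

theorem intervalCoord_mem {t : ℝ} (h0 : 0 ≤ t) (h3 : t ≤ 3) :
    intervalCoord t ∈ realization interval := by
  obtain ⟨j, hj, h, h'⟩ := exists_layer h0 h3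
  refine ⟨fun v => le_max_left _ _, {j, j + 1}, mem_interval.2 ⟨by simp, j, hj, subset_rfl⟩,
    fun v hv => intervalCoord_eq_zero ?_, ?_⟩
  · simp only [Finset.mem_insert, Finset.mem_singleton, not_or] at hv
    rcases lt_or_gt_of_ne hv.1 with h1 | h1
    · right
      have : ((v + 1 : ℕ) : ℝ) ≤ j := by exact_mod_cast h1
      push_cast at this
      linarith
    · left
      have : ((j + 2 : ℕ) : ℝ) ≤ v := by exact_mod_cast (by omega : j + 2 ≤ v)
      push_cast at this
      linarith
  · rw [Finset.sum_pair (by omega), intervalCoord_left h h', intervalCoord_right h h']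
    ring

theorem exists_intervalCoord_eq {y : ℕ → ℝ} (hy : y ∈ realization interval) :
    ∃ t, 0 ≤ t ∧ t ≤ 3 ∧ intervalCoord t = y := by
  obtain ⟨hy0, s, hs, hys, hsum⟩ := hy
  obtain ⟨-, j, hj, hsj⟩ := mem_interval.1 hs
  have hys' : ∀ v, v ∉ ({j, j + 1} : Finset ℕ) → y v = 0 := fun v hv => hys v fun h => hv (hsj h)
  have hsum' : y j + y (j + 1) = 1 := by
    rw [← Finset.sum_pair (by omega : j ≠ j + 1), ← hsum]
    exact (Finset.sum_subset hsj fun v _ hv => hys v hv).symm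
  have h0 := hy0 j
  have h1 := hy0 (j + 1)
  have hj2 : (j : ℝ) ≤ 2 := by exact_mod_cast (by omega : j ≤ 2)
  have hj0 : (0 : ℝ) ≤ j := j.cast_nonneg
  have ht0 : 0 ≤ j + y (j + 1) := by linarith
  have ht3 : j + y (j + 1) ≤ 3 := by linarith
  have hl := intervalCoord_left (j := j) (t := j + y (j + 1)) (by linarith) (by linarith)
  have hr := intervalCoord_right (j := j) (t := j + y (j + 1)) (by linarith) (by linarith)
  refine ⟨j + y (j + 1), ht0, ht3, funext fun v => ?_⟩
  by_cases hv : v = j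
  · rw [hv, hl]; linarith
  · by_cases hv' : v = j + 1
    · rw [hv', hr]; ring
    · rw [hys' v (by simp [hv, hv'])]
      apply intervalCoord_eq_zero
      rcases lt_or_gt_of_ne hv with h2 | h2
      · right
        have : ((v + 1 : ℕ) : ℝ) ≤ j := by exact_mod_cast h2
        push_cast at this
        linarith
      · left
        have : ((j + 2 : ℕ) : ℝ) ≤ v := by exact_mod_cast (by omega : j + 2 ≤ v)
        push_cast at this
        linarith

theorem continuous_intervalCoord : Continuous intervalCoord :=
  continuous_pi fun j => by unfold intervalCoord; fun_prop

/-- The point of the twisted product at height `t` over a point of the base. -/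
noncomputable def gluedCoord (σ : Equiv.Perm ℕ) (w : ℕ → ℝ) (t : ℝ) : ℕ × ℕ → ℝ :=
  pushGlue σ (coupling w (intervalCoord t))

theorem continuous_gluedCoord (σ : Equiv.Perm ℕ) :
    Continuous fun p : (ℕ → ℝ) × ℝ => gluedCoord σ p.1 p.2 := by
  have h : ∀ q, Continuous fun p : (ℕ → ℝ) × ℝ => coupling p.1 (intervalCoord p.2) q := fun q =>
    (continuous_coupling q).comp
      (continuous_fst.prodMk (continuous_intervalCoord.comp continuous_snd))
  refine continuous_pi fun q => ?_
  unfold gluedCoord pushGlue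
  split_ifs
  exacts [(h _).add (h _), h _, continuous_const]

section Glued

variable {M : PreAbstractSimplicialComplex ℕ} {σ : Equiv.Perm ℕ} {w w' : ℕ → ℝ} {t t' : ℝ}

theorem gluedCoord_mem (hw : w ∈ realization M) (h0 : 0 ≤ t) (h3 : t ≤ 3) :
    gluedCoord σ w t ∈ realization (twistedProduct M σ) :=
  pushGlue_mem_realization σ (coupling_mem_realization hw (intervalCoord_mem h0 h3))

theorem exists_gluedCoord_eq {u : ℕ × ℕ → ℝ} (hu : u ∈ realization (twistedProduct M σ)) :
    ∃ w ∈ realization M, ∃ t, 0 ≤ t ∧ t ≤ 3 ∧ gluedCoord σ w t = u := by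
  obtain ⟨z, hz, rfl⟩ := exists_pushGlue_eq hu
  obtain ⟨w, hw, y, hy, rfl⟩ := exists_coupling_eq hz
  obtain ⟨t, h0, h3, rfl⟩ := exists_intervalCoord_eq hy
  exact ⟨w, hw, t, h0, h3, rfl⟩

theorem intervalCoord_zero_or (h3 : t ≤ 3) :
    ∀ j, j ∉ ({0, 1, 2, 3} : Finset ℕ) → intervalCoord t j = 0 := by
  intro j hj
  simp at hj
  refine intervalCoord_eq_zero (Or.inl ?_)
  have : ((4 : ℕ) : ℝ) ≤ j := by exact_mod_cast (by omega : 4 ≤ j)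
  push_cast at this
  linarith

theorem sum_layers (hw : w ∈ realization M) (h0 : 0 ≤ t) (h3 : t ≤ 3) (v : ℕ) :
    coupling w (intervalCoord t) (v, 0) + (coupling w (intervalCoord t) (v, 1) +
      (coupling w (intervalCoord t) (v, 2) + coupling w (intervalCoord t) (v, 3))) = w v := by
  rw [← sum_coupling hw (intervalCoord_mem h0 h3) (intervalCoord_zero_or h3) v,
    Finset.sum_insert (by decide), Finset.sum_insert (by decide), Finset.sum_pair (by decide)]

/-- At height `3` all mass sits in the top layer, and the gluing moves it to the bottom layer with
vertices relabelled by `σ`. -/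
theorem gluedCoord_three (hw : w ∈ realization M) (hw' : w' ∈ realization M)
    (h : ∀ v, w' v = w (σ⁻¹ v)) : gluedCoord σ w 3 = gluedCoord σ w' 0 := by
  have e3 : ∀ v, ∀ j < 3, coupling w (intervalCoord 3) (v, j) = 0 := fun v j hj =>
    coupling_eq_zero (Or.inr (intervalCoord_eq_zero (Or.inr (by
      have : ((j + 1 : ℕ) : ℝ) ≤ (3 : ℕ) := by exact_mod_cast hj
      push_cast at this
      exact this))))
  have e0 : ∀ v j, 0 < j → coupling w' (intervalCoord 0) (v, j) = 0 := fun v j hj =>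
    coupling_eq_zero (Or.inr (intervalCoord_eq_zero (Or.inl (by
      have : ((1 : ℕ) : ℝ) ≤ j := by exact_mod_cast hj
      push_cast at this
      linarith))))
  have s3 : ∀ v, coupling w (intervalCoord 3) (v, 3) = w v := fun v => by
    have := sum_layers hw (t := 3) (by norm_num) le_rfl v
    rw [e3 v 0 (by norm_num), e3 v 1 (by norm_num), e3 v 2 (by norm_num)] at this
    linarith
  have s0 : ∀ v, coupling w' (intervalCoord 0) (v, 0) = w' v := fun v => by
    have := sum_layers hw' (t := 0) le_rfl (by norm_num) v
    rw [e0 v 1 (by norm_num), e0 v 2 (by norm_num), e0 v 3 (by norm_num)] at this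
    linarith
  ext ⟨v, j⟩
  unfold gluedCoord pushGlue
  simp only
  split_ifs with hj hj3
  · rw [e3 v 0 (by norm_num), s3, s0, e0 _ 3 (by norm_num), h]
    ring
  · rw [e3 v j hj3, e0 v j (by omega)]
  · rfl

/-- The height and the base point are determined by the point of the twisted product. -/
theorem gluedCoord_injective {s : Finset ℕ} (hMs : ∀ w ∈ realization M, ∀ v, v ∉ s → w v = 0)
    (hσ : ∀ v, v ∈ s ↔ σ v ∈ s) (hw : w ∈ realization M) (hw' : w' ∈ realization M)
    (h0 : 0 ≤ t) (h3 : t < 3) (h0' : 0 ≤ t') (h3' : t' < 3)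
    (h : gluedCoord σ w t = gluedCoord σ w' t') : t = t' ∧ w = w' := by
  -- The mass of each layer is a coordinate of the height, by the second marginal of the coupling.
  -- Layer `0` collects both ends of the interval; reindexing the top end uses that `σ` preserves
  -- `s`.
  have hlayer : ∀ (w : ℕ → ℝ) (t : ℝ), w ∈ realization M → 0 ≤ t → t < 3 →
      ∑ v ∈ s, gluedCoord σ w t (v, 0) = intervalCoord t 0 + intervalCoord t 3 ∧
      ∑ v ∈ s, gluedCoord σ w t (v, 1) = intervalCoord t 1 ∧
      ∑ v ∈ s, gluedCoord σ w t (v, 2) = intervalCoord t 2 := by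
    intro w t hw h0 h3
    have e : ∀ j, ∑ v ∈ s, coupling w (intervalCoord t) (v, j) = intervalCoord t j := by
      intro j
      simp only [coupling_swap w (intervalCoord t)]
      exact sum_coupling (intervalCoord_mem h0 h3.le) hw (hMs w hw) j
    refine ⟨?_, ?_, ?_⟩
    · simp only [gluedCoord, pushGlue, if_true]
      rw [Finset.sum_add_distrib, e 0, ← e 3]
      congr 1
      exact Finset.sum_equiv σ⁻¹ (fun v => by rw [hσ (σ⁻¹ v)]; simp)
        fun v _ => rfl
    · simpa [gluedCoord, pushGlue] using e 1
    · simpa [gluedCoord, pushGlue] using e 2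
  have ht : t = t' := by
    obtain ⟨a0, a1, a2⟩ := hlayer w t hw h0 h3
    obtain ⟨b0, b1, b2⟩ := hlayer w' t' hw' h0' h3'
    rw [h] at a0 a1 a2
    rw [a0] at b0
    rw [a1] at b1
    rw [a2] at b2
    -- The three layer masses are barycentric coordinates on a triangle, around whose boundary `t`
    -- runs once; hence they determine `t` in `[0, 3)`.
    have cases3 : ∀ t : ℝ, 0 ≤ t → t < 3 →
        (t ≤ 1 ∧ intervalCoord t 0 + intervalCoord t 3 = 1 - t ∧ intervalCoord t 1 = t ∧
          intervalCoord t 2 = 0) ∨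
        (1 ≤ t ∧ t ≤ 2 ∧ intervalCoord t 0 + intervalCoord t 3 = 0 ∧ intervalCoord t 1 = 2 - t ∧
          intervalCoord t 2 = t - 1) ∨
        (2 ≤ t ∧ intervalCoord t 0 + intervalCoord t 3 = t - 2 ∧ intervalCoord t 1 = 0 ∧
          intervalCoord t 2 = 3 - t) := by
      intro t h0 h3
      rcases le_total t 1 with h1 | h1
      · refine Or.inl ⟨h1, ?_, ?_, ?_⟩
        · rw [intervalCoord_left (j := 0) (by simpa) (by simpa), intervalCoord_eq_zero]
          · push_cast; ring
          · left; push_cast; linarith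
        · rw [intervalCoord_right (j := 0) (by simpa) (by simpa)]; simp
        · exact intervalCoord_eq_zero (by left; push_cast; linarith)
      · rcases le_total t 2 with h2 | h2
        · refine Or.inr (Or.inl ⟨h1, h2, ?_, ?_, ?_⟩)
          · rw [intervalCoord_eq_zero, intervalCoord_eq_zero, add_zero]
            · left; push_cast; linarith
            · right; push_cast; linarith
          · rw [intervalCoord_left (j := 1) (by simpa) (by push_cast; linarith)]
            push_cast; ring
          · rw [intervalCoord_right (j := 1) (by simpa) (by push_cast; linarith)]
            push_cast; ring
        · refine Or.inr (Or.inr ⟨h2, ?_, ?_, ?_⟩)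
          · rw [intervalCoord_eq_zero, intervalCoord_right (j := 2) (by simpa)
              (by push_cast; linarith)]
            · push_cast; ring
            · right; push_cast; linarith
          · exact intervalCoord_eq_zero (by right; push_cast; linarith)
          · rw [intervalCoord_left (j := 2) (by simpa) (by push_cast; linarith)]
            push_cast; ring
    rcases cases3 t h0 h3 with ⟨c, c0, c1, c2⟩ | ⟨c, d, c0, c1, c2⟩ | ⟨c, c0, c1, c2⟩ <;>
      rcases cases3 t' h0' h3' with ⟨c', c0', c1', c2'⟩ | ⟨c', d', c0', c1', c2'⟩ |
        ⟨c', c0', c1', c2'⟩ <;> linarith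
  refine ⟨ht, funext fun v => ?_⟩
  subst ht
  rw [← sum_layers hw h0 h3.le, ← sum_layers hw' h0 h3.le]
  have g0 := congrFun h (v, 0)
  have g1 := congrFun h (v, 1)
  have g2 := congrFun h (v, 2)
  have g3 := congrFun h (σ v, 0)
  simp only [gluedCoord, pushGlue, if_true, one_ne_zero, if_false,
    OfNat.ofNat_ne_zero, Nat.one_lt_ofNat, Nat.lt_add_one] at g0 g1 g2 g3
  simp at g0 g1 g2 g3
  -- Up to height `2` the top layer is empty, so layer `0` shows the bottom masses themselves. Above
  -- it the bottom is empty, and the top mass at `v` is read off at `(σ v, 0)`.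
  rcases le_total t 2 with h2 | h2
  · have z : ∀ w : ℕ → ℝ, ∀ v, coupling w (intervalCoord t) (v, 3) = 0 := fun w v =>
      coupling_eq_zero (Or.inr (intervalCoord_eq_zero (by left; push_cast; linarith)))
    rw [z, z] at g0
    rw [z, z]
    linarith
  · have z0 : ∀ w : ℕ → ℝ, ∀ v, coupling w (intervalCoord t) (v, 0) = 0 := fun w v =>
      coupling_eq_zero (Or.inr (intervalCoord_eq_zero (by right; push_cast; linarith)))
    rw [z0, z0] at g3
    rw [z0, z0]
    linarith

end Glued

/-! ## The twisted products as quotients of Euclidean space -/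

/-- Barycentric coordinates in the twisted product of the Klein bottle along `σ` of a point of
`ℝ² × ℝ`; the gluing takes place at the heights divisible by three. -/
noncomputable def torusCoord (σ : Equiv.Perm ℕ) (P : (ℝ × ℝ) × ℝ) : ℕ × ℕ → ℝ :=
  gluedCoord σ (fun v => kleinCoord P.1.1 P.1.2 ((σ ^ ⌊P.2 / 3⌋)⁻¹ v)) (P.2 - 3 * ⌊P.2 / 3⌋)

section Torus

variable {σ : Equiv.Perm ℕ} {τ : Equiv.Perm (ℝ × ℝ)}

/-- The hypothesis says that `τ` is a lift of the automorphism `σ` to the plane; this passes to all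
integral powers. -/
theorem kleinCoord_zpow
    (hτ : ∀ p v, kleinCoord (τ p).1 (τ p).2 (σ v) = kleinCoord p.1 p.2 v) (n : ℤ) :
    ∀ p v, kleinCoord ((τ ^ n) p).1 ((τ ^ n) p).2 ((σ ^ n) v) = kleinCoord p.1 p.2 v := by
  have hτ' : ∀ p v, kleinCoord (τ⁻¹ p).1 (τ⁻¹ p).2 (σ⁻¹ v) = kleinCoord p.1 p.2 v := by
    intro p v
    have := hτ (τ⁻¹ p) (σ⁻¹ v)
    rw [show τ (τ⁻¹ p) = p from τ.apply_symm_apply p,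
      show σ (σ⁻¹ v) = v from σ.apply_symm_apply v] at this
    exact this.symm
  induction n with
  | zero => intro p v; rfl
  | succ n ih =>
    intro p v
    rw [zpow_add_one, zpow_add_one, Equiv.Perm.mul_apply, Equiv.Perm.mul_apply, ih, hτ]
  | pred n ih =>
    intro p v
    rw [zpow_sub_one, zpow_sub_one, Equiv.Perm.mul_apply, Equiv.Perm.mul_apply, ih, hτ']

theorem kleinCoord_zpow_inv
    (hτ : ∀ p v, kleinCoord (τ p).1 (τ p).2 (σ v) = kleinCoord p.1 p.2 v) (n : ℤ) (p : ℝ × ℝ) :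
    (fun v => kleinCoord p.1 p.2 ((σ ^ n)⁻¹ v)) = kleinCoord ((τ ^ n) p).1 ((τ ^ n) p).2 := by
  funext v
  rw [← kleinCoord_zpow hτ n p]
  simp

/-- On the closed slab, including its upper end, where the floor jumps to `k + 1`: there the gluing
relation identifies the formula for `k` at relative height `3` with the one for `k + 1` at relative
height `0`. -/
theorem torusCoord_eq (hτ : ∀ p v, kleinCoord (τ p).1 (τ p).2 (σ v) = kleinCoord p.1 p.2 v)
    {P : (ℝ × ℝ) × ℝ} {k : ℤ} (h : 3 * k ≤ P.2) (h' : P.2 ≤ 3 * k + 3) :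
    torusCoord σ P =
      gluedCoord σ (fun v => kleinCoord P.1.1 P.1.2 ((σ ^ k)⁻¹ v)) (P.2 - 3 * k) := by
  rcases h'.lt_or_eq with h'' | h''
  · have : ⌊P.2 / 3⌋ = k := by
      rw [Int.floor_eq_iff]
      constructor <;> linarith
    rw [torusCoord, this]
  · have : ⌊P.2 / 3⌋ = k + 1 := by
      rw [Int.floor_eq_iff]
      push_cast
      constructor <;> linarith
    rw [torusCoord, this, h'']
    push_cast
    rw [show (3 * k + 3 - 3 * (k + 1) : ℝ) = 0 by ring, show (3 * k + 3 - 3 * k : ℝ) = 3 by ring]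
    symm
    rw [kleinCoord_zpow_inv hτ, kleinCoord_zpow_inv hτ]
    refine gluedCoord_three (kleinCoord_mem_realization _ _) (kleinCoord_mem_realization _ _) ?_
    intro v
    rw [← kleinCoord_zpow_inv hτ, ← kleinCoord_zpow_inv hτ, add_comm k 1, zpow_one_add, mul_inv_rev]
    rfl

/-- The slabs form a locally finite closed cover, and `torusCoord_eq` gives a continuous formula on
each of them. -/
theorem continuous_torusCoord
    (hτ : ∀ p v, kleinCoord (τ p).1 (τ p).2 (σ v) = kleinCoord p.1 p.2 v) :
    Continuous (torusCoord σ) := by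
  have hlf : LocallyFinite fun k : ℤ => Set.Icc (3 * (k : ℝ)) (3 * k + 3) := by
    refine locallyFinite_Icc_of_tendsto ?_ ?_
    · exact Filter.Tendsto.const_mul_atTop (by norm_num) tendsto_intCast_atTop_atTop
    · exact Filter.tendsto_atBot_add_const_right _ _
        (Filter.Tendsto.const_mul_atBot (by norm_num) (tendsto_intCast_atBot_iff.2 Filter.tendsto_id))
  have hlf' := hlf.preimage_continuous (continuous_snd (X := ℝ × ℝ) (Y := ℝ))
  refine hlf'.continuous ?_ (fun k => isClosed_Icc.preimage continuous_snd) fun k => ?_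
  · refine Set.eq_univ_of_forall fun P => Set.mem_iUnion.mpr ⟨⌊P.2 / 3⌋, ?_⟩
    have h1 := Int.floor_le (P.2 / 3)
    have h2 := Int.lt_floor_add_one (P.2 / 3)
    constructor <;> linarith
  · have hc : Continuous fun P : (ℝ × ℝ) × ℝ =>
        gluedCoord σ (fun v => kleinCoord P.1.1 P.1.2 ((σ ^ k)⁻¹ v)) (P.2 - 3 * k) := by
      refine (continuous_gluedCoord σ).comp (Continuous.prodMk ?_ (by fun_prop))
      exact continuous_pi fun v =>
        (continuous_pi_iff.1 continuous_kleinCoord ((σ ^ k)⁻¹ v)).comp continuous_fst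
    exact hc.continuousOn.congr fun P hP => torusCoord_eq hτ hP.1 hP.2

theorem torusCoord_mem (hτ : ∀ p v, kleinCoord (τ p).1 (τ p).2 (σ v) = kleinCoord p.1 p.2 v)
    (P : (ℝ × ℝ) × ℝ) : torusCoord σ P ∈ realization (twistedProduct kleinBottle8 σ) := by
  have h1 := Int.floor_le (P.2 / 3)
  have h2 := Int.lt_floor_add_one (P.2 / 3)
  unfold torusCoord
  rw [kleinCoord_zpow_inv hτ]
  exact gluedCoord_mem (kleinCoord_mem_realization _ _) (by linarith) (by linarith)

theorem torusCoord_of_kleinRel {P Q : (ℝ × ℝ) × ℝ} (h : KleinRel P.1.1 P.1.2 Q.1.1 Q.1.2)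
    (ht : Q.2 = P.2) : torusCoord σ Q = torusCoord σ P := by
  unfold torusCoord
  rw [ht, kleinCoord_eq_of_kleinRel h]

/-- Descending by one slab lowers the power of `σ` by one, and `τ` on the base point makes up for
it. -/
theorem torusCoord_shift (hτ : ∀ p v, kleinCoord (τ p).1 (τ p).2 (σ v) = kleinCoord p.1 p.2 v)
    (P : (ℝ × ℝ) × ℝ) : torusCoord σ (τ P.1, P.2 - 3) = torusCoord σ P := by
  unfold torusCoord
  have hfl : ⌊(P.2 - 3) / 3⌋ = ⌊P.2 / 3⌋ - 1 := by
    rw [← Int.floor_sub_one]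
    congr 1
    ring
  simp only [hfl]
  rw [kleinCoord_zpow_inv hτ, kleinCoord_zpow_inv hτ, ← Equiv.Perm.mul_apply, ← zpow_add_one,
    sub_add_cancel]
  congr 1
  push_cast
  ring

/-- The relative heights agree, and so do the base points after applying `τ ^ k` and `τ ^ l`, where
`k` and `l` number the slabs. Cancelling the common power leaves the exponent `l - k`. -/
theorem eq_of_torusCoord_eq
    (hτ : ∀ p v, kleinCoord (τ p).1 (τ p).2 (σ v) = kleinCoord p.1 p.2 v)
    (hσ : ∀ v, v ∈ Finset.Icc 1 8 ↔ σ v ∈ Finset.Icc 1 8) {P Q : (ℝ × ℝ) × ℝ}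
    (h : torusCoord σ P = torusCoord σ Q) :
    ∃ n : ℤ, KleinRel P.1.1 P.1.2 ((τ ^ n) Q.1).1 ((τ ^ n) Q.1).2 ∧ P.2 = Q.2 - 3 * n := by
  have hsupp : ∀ w ∈ realization kleinBottle8, ∀ v, v ∉ Finset.Icc 1 8 → w v = 0 := by
    rintro w ⟨-, s, hs, hws, -⟩ v hv
    refine hws v fun h => hv ?_
    obtain ⟨-, t, ht, hst⟩ := mem_kleinBottle8.1 hs
    obtain ⟨h1, h2, h3, h4⟩ := kleinTriangles_bounds t ht
    have := hst h
    simp only [Finset.mem_insert, Finset.mem_singleton] at this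
    rw [Finset.mem_Icc]
    omega
  have hP1 := Int.floor_le (P.2 / 3)
  have hP2 := Int.lt_floor_add_one (P.2 / 3)
  have hQ1 := Int.floor_le (Q.2 / 3)
  have hQ2 := Int.lt_floor_add_one (Q.2 / 3)
  unfold torusCoord at h
  rw [kleinCoord_zpow_inv hτ, kleinCoord_zpow_inv hτ] at h
  generalize ⌊P.2 / 3⌋ = k at *
  generalize ⌊Q.2 / 3⌋ = l at *
  obtain ⟨ht, hw⟩ := gluedCoord_injective hsupp hσ (kleinCoord_mem_realization _ _)
    (kleinCoord_mem_realization _ _) (by linarith) (by linarith) (by linarith) (by linarith) h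
  refine ⟨l - k, kleinRel_of_kleinCoord_eq ?_, by push_cast; linarith⟩
  funext v
  have h1 := congrFun hw ((σ ^ k) v)
  rw [kleinCoord_zpow hτ] at h1
  rw [h1, show l = k + (l - k) by ring, zpow_add, Equiv.Perm.mul_apply, kleinCoord_zpow hτ]
  simp

/-- The points of a fundamental box attain all values of `torusCoord`. -/
theorem exists_torusCoord_eq
    (hτ : ∀ p v, kleinCoord (τ p).1 (τ p).2 (σ v) = kleinCoord p.1 p.2 v) {u : ℕ × ℕ → ℝ}
    (hu : u ∈ realization (twistedProduct kleinBottle8 σ)) :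
    ∃ P ∈ (Set.Icc (-2) 2 ×ˢ Set.Icc (-2) 2) ×ˢ Set.Icc 0 3, torusCoord σ P = u := by
  obtain ⟨w, hw, t, h0, h3, rfl⟩ := exists_gluedCoord_eq hu
  obtain ⟨x, y, rfl⟩ := exists_kleinCoord_eq hw
  obtain ⟨a, b, ha0, ha2, hb0, hb2, h⟩ := exists_signed_kleinRel x y
  have key : ∀ a b : ℝ, a ∈ Set.Icc (-2) 2 → b ∈ Set.Icc (-2) 2 → KleinRel a b x y →
      ∃ P ∈ (Set.Icc (-2 : ℝ) 2 ×ˢ Set.Icc (-2 : ℝ) 2) ×ˢ Set.Icc (0 : ℝ) 3,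
        torusCoord σ P = gluedCoord σ (kleinCoord x y) t := by
    intro a b ha hb h
    refine ⟨((a, b), t), ⟨⟨ha, hb⟩, h0, h3⟩, ?_⟩
    rw [torusCoord_eq hτ (k := 0) (by simpa) (by simpa), kleinCoord_zpow_inv hτ,
      kleinCoord_eq_of_kleinRel h]
    simp
  rcases h with h | h | h | h
  · exact key _ _ ⟨by linarith, ha2⟩ ⟨by linarith, hb2⟩ h
  · exact key _ _ ⟨by linarith, by linarith⟩ ⟨by linarith, hb2⟩ h
  · exact key _ _ ⟨by linarith, ha2⟩ ⟨by linarith, by linarith⟩ h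
  · exact key _ _ ⟨by linarith, by linarith⟩ ⟨by linarith, by linarith⟩ h

theorem zpow_translate {C : E3 → (ℝ × ℝ) × ℝ} {g : E3 ≃ᵢ E3} {d : (ℝ × ℝ) × ℝ}
    (h : ∀ X, C (g X) = C X + d) (n : ℤ) : ∀ X, C ((g ^ n) X) = C X + n • d := by
  have h' : ∀ X, C (g⁻¹ X) = C X - d := fun X => by
    have := h (g⁻¹ X)
    rw [IsometryEquiv.apply_inv_self] at this
    rw [this, add_sub_cancel_right]
  induction n with
  | zero => intro X; simp
  | succ n ih =>
    intro X
    rw [zpow_add_one, IsometryEquiv.mul_apply, ih, h, add_zsmul, one_zsmul]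
    abel
  | pred n ih =>
    intro X
    rw [zpow_sub_one, IsometryEquiv.mul_apply, ih, h', sub_zsmul, one_zsmul]
    abel

theorem zpow_shift {C : E3 → (ℝ × ℝ) × ℝ} {g : E3 ≃ᵢ E3}
    (h : ∀ X, C (g X) = (τ (C X).1, (C X).2 - 3)) (n : ℤ) :
    ∀ X, C ((g ^ n) X) = ((τ ^ n) (C X).1, (C X).2 - 3 * n) := by
  have h' : ∀ X, C (g⁻¹ X) = (τ⁻¹ (C X).1, (C X).2 + 3) := fun X => by
    have := h (g⁻¹ X)
    rw [IsometryEquiv.apply_inv_self] at this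
    rw [this]
    ext <;> simp
  induction n with
  | zero => intro X; simp
  | succ n ih =>
    intro X
    rw [zpow_add_one, zpow_add_one, IsometryEquiv.mul_apply, Equiv.Perm.mul_apply, ih, h]
    refine Prod.ext rfl ?_
    push_cast
    ring
  | pred n ih =>
    intro X
    rw [zpow_sub_one, zpow_sub_one, IsometryEquiv.mul_apply, Equiv.Perm.mul_apply, ih, h']
    refine Prod.ext rfl ?_
    push_cast
    ring

/-- A twisted product of the Klein bottle triangulates an orbit space of Euclidean space, if in
suitable coordinates the group is generated by the deck transformations of the Klein bottle and
the gluing map. -/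
theorem isTriangulation_twistedProduct
    (hτ : ∀ p v, kleinCoord (τ p).1 (τ p).2 (σ v) = kleinCoord p.1 p.2 v)
    (hσ : ∀ v, v ∈ Finset.Icc 1 8 ↔ σ v ∈ Finset.Icc 1 8) {S : Set (E3 ≃ᵢ E3)}
    (C : E3 ≃ₜ (ℝ × ℝ) × ℝ)
    (hS : ∀ g ∈ S, ∀ X, torusCoord σ (C (g X)) = torusCoord σ (C X))
    (ha : ∃ g ∈ Subgroup.closure S, ∀ X, C (g X) = (((C X).1.1 + 4, -(C X).1.2), (C X).2))
    (hb : ∃ g ∈ Subgroup.closure S, ∀ X, C (g X) = (((C X).1.1, (C X).1.2 + 4), (C X).2))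
    (hs : ∃ g ∈ Subgroup.closure S, ∀ X, C (g X) = (τ (C X).1, (C X).2 - 3)) :
    Nonempty (realization (twistedProduct kleinBottle8 σ) ≃ₜ
      Quotient (orbitSetoid (Subgroup.closure S))) := by
  have hinv : ∀ g ∈ Subgroup.closure S, ∀ X, torusCoord σ (C (g X)) = torusCoord σ (C X) := by
    intro g hg
    induction hg using Subgroup.closure_induction with
    | mem g hg => exact hS g hg
    | one => intro X; rfl
    | mul g k _ _ hg hk => intro X; rw [IsometryEquiv.mul_apply, hg, hk]
    | inv g _ hg => intro X; rw [← hg, IsometryEquiv.apply_inv_self]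
  have horb : ∀ X Y, torusCoord σ (C X) = torusCoord σ (C Y) →
      ∃ g ∈ Subgroup.closure S, g X = Y := by
    intro X Y h
    obtain ⟨n, ⟨k, l, hkl⟩, ht⟩ := eq_of_torusCoord_eq hτ hσ h
    obtain ⟨a, ha, hCa⟩ := ha
    obtain ⟨b, hb, hCb⟩ := hb
    obtain ⟨s, hs, hCs⟩ := hs
    have hCn := zpow_shift hCs n Y
    -- The square of the glide is the translation by `(8, 0)`. Together with `b` it provides the
    -- translations in `KleinRel`, and one further factor `a` provides the glides.
    have hCa2 : ∀ X, C ((a * a) X) = C X + ((8, 0), 0) := by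
      intro X
      rw [IsometryEquiv.mul_apply, hCa, hCa]
      refine Prod.ext (Prod.ext ?_ ?_) ?_ <;> simp
      ring
    have hCb' : ∀ X, C (b X) = C X + ((0, 4), 0) := by
      intro X
      rw [hCb]
      refine Prod.ext (Prod.ext ?_ ?_) ?_ <;> simp
    have hz1 := zpow_translate hCa2 k
    have hz2 := zpow_translate hCb' l
    have hcl : ∀ g ∈ Subgroup.closure S, g X = (s ^ n) Y → ∃ g ∈ Subgroup.closure S, g X = Y := by
      intro g hg h
      refine ⟨(s ^ n)⁻¹ * g, Subgroup.mul_mem _ (Subgroup.inv_mem _ (Subgroup.zpow_mem _ hs n)) hg,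
        ?_⟩
      rw [IsometryEquiv.mul_apply, h, IsometryEquiv.inv_apply_self]
    have hab : (a * a) ^ k * b ^ l ∈ Subgroup.closure S := Subgroup.mul_mem _
      (Subgroup.zpow_mem _ (Subgroup.mul_mem _ ha ha) k) (Subgroup.zpow_mem _ hb l)
    rcases hkl with ⟨h1, h2⟩ | ⟨h1, h2⟩
    · refine hcl _ hab (C.injective ?_)
      rw [IsometryEquiv.mul_apply, hz1, hz2, hCn]
      refine Prod.ext (Prod.ext ?_ ?_) ?_
      · rw [h1]; simp
      · rw [h2]; simp
      · rw [← ht]; simp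
    · refine hcl _ (Subgroup.mul_mem _ hab ha) (C.injective ?_)
      rw [IsometryEquiv.mul_apply, IsometryEquiv.mul_apply, hz1, hz2, hCa, hCn]
      refine Prod.ext (Prod.ext ?_ ?_) ?_
      · rw [h1]; simp
      · rw [h2]; simp
      · rw [← ht]; simp
  let F : Quotient (orbitSetoid (Subgroup.closure S)) →
      realization (twistedProduct kleinBottle8 σ) :=
    Quotient.lift (fun X => ⟨torusCoord σ (C X), torusCoord_mem hτ _⟩) fun X Y ⟨g, hg, h⟩ =>
      Subtype.ext (by rw [← h]; exact (hinv g hg X).symm)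
  have hFc : Continuous F := Continuous.quotient_lift
    (((continuous_torusCoord hτ).comp C.continuous).subtype_mk _) _
  have hFi : Function.Injective F := by
    rintro ⟨X⟩ ⟨Y⟩ h
    exact Quotient.sound (horb X Y (congrArg Subtype.val h))
  -- A compact box already meets every orbit, which yields compactness of the orbit space as well as
  -- surjectivity.
  have hbox : ∀ u : realization (twistedProduct kleinBottle8 σ),
      ∃ X ∈ C.symm '' ((Set.Icc (-2) 2 ×ˢ Set.Icc (-2) 2) ×ˢ Set.Icc 0 3),
        F (Quotient.mk _ X) = u := by
    rintro ⟨u, hu⟩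
    obtain ⟨P, hP, rfl⟩ := exists_torusCoord_eq hτ hu
    refine ⟨C.symm P, ⟨P, hP, rfl⟩, Subtype.ext ?_⟩
    change torusCoord σ (C (C.symm P)) = _
    rw [C.apply_symm_apply]
  have hFs : Function.Surjective F := fun u => by
    obtain ⟨X, -, h⟩ := hbox u
    exact ⟨_, h⟩
  have hcomp : CompactSpace (Quotient (orbitSetoid (Subgroup.closure S))) := by
    have hK : IsCompact (C.symm '' ((Set.Icc (-2) 2 ×ˢ Set.Icc (-2) 2) ×ˢ Set.Icc 0 3)) :=
      ((isCompact_Icc.prod isCompact_Icc).prod isCompact_Icc).image C.symm.continuous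
    have hK' := hK.image (continuous_quotient_mk' (s := orbitSetoid (Subgroup.closure S)))
    refine ⟨?_⟩
    convert hK'
    symm
    refine Set.eq_univ_of_forall fun q => ?_
    obtain ⟨X, hX, h⟩ := hbox (F q)
    exact ⟨X, hX, hFi h⟩
  exact ⟨(Continuous.homeoOfEquivCompactToT2 (f := Equiv.ofBijective F ⟨hFi, hFs⟩) hFc).symm⟩

end Torus

/-! ### The gluing automorphisms -/

theorem flipX_mem_iff (v : ℕ) : flipX v ∈ Finset.Icc 1 8 ↔ v ∈ Finset.Icc 1 8 := by
  match v with
  | 0 | 1 | 2 | 3 | 4 | 5 | 6 | 7 | 8 => decide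
  | n + 9 => rfl

theorem flipY_mem_iff (v : ℕ) : flipY v ∈ Finset.Icc 1 8 ↔ v ∈ Finset.Icc 1 8 := by
  match v with
  | 0 | 1 | 2 | 3 | 4 | 5 | 6 | 7 | 8 => decide
  | n + 9 => rfl

theorem halfTurn_mem_iff (v : ℕ) : halfTurn v ∈ Finset.Icc 1 8 ↔ v ∈ Finset.Icc 1 8 := by
  match v with
  | 0 | 1 | 2 | 3 | 4 | 5 | 6 | 7 | 8 => decide
  | n + 9 => rfl

/-- Identifies the gluing with the effect on labels of the translation by `(2, 2)`, the composite of
the half turn `(2 - x, 2 - y)` with `(-x, -y)`. -/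
theorem gluing_two_apply (v : ℕ) :
    (c[1, 6, 2, 5] * c[3, 8] * c[4, 7] : Equiv.Perm ℕ) v = halfTurn (flipX (flipY v)) := by
  match v with
  | 0 | 1 | 2 | 3 | 4 | 5 | 6 | 7 | 8 => rfl
  | n + 9 => rfl

theorem gluing_three_apply (v : ℕ) :
    (c[1, 2] * c[3, 4] * c[7, 8] : Equiv.Perm ℕ) v = flipX (flipY v) := by
  match v with
  | 0 | 1 | 2 | 3 | 4 | 5 | 6 | 7 | 8 => rfl
  | n + 9 => rfl

theorem gluing_four_apply (v : ℕ) :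
    (c[1, 5] * c[2, 6] * c[3, 7] * c[4, 8] : Equiv.Perm ℕ) v = halfTurn v := by
  match v with
  | 0 | 1 | 2 | 3 | 4 | 5 | 6 | 7 | 8 => rfl
  | n + 9 => rfl

/-! ### Coordinates adapted to the flat manifolds -/

theorem signedTranslation_apply (ε : Fin 3 → ℤˣ) (b : Fin 3 → ℝ) (X : E3) (i : Fin 3) :
    signedTranslation ε b X i = ((ε i : ℤ) : ℝ) * X i + b i := rfl

theorem translation_apply (b : Fin 3 → ℝ) (X : E3) (i : Fin 3) :
    translation b X i = X i + b i := by
  rw [translation, signedTranslation_apply]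
  simp

/-- Linear coordinates of space in which the fibres of the projection to the circle are the level
sets of `X 1`. -/
noncomputable def fibredChart (k c : ℝ) (hc : c ≠ 0) : E3 ≃ₜ (ℝ × ℝ) × ℝ where
  toFun X := ((8 * X 0 + k * X 1, 4 * X 2), -c * X 1)
  invFun P := !₂[(P.1.1 + k * (P.2 / c)) / 8, -(P.2 / c), P.1.2 / 4]
  left_inv X := by
    ext i
    fin_cases i <;> simp <;> field_simp <;> ring
  right_inv P := by
    refine Prod.ext (Prod.ext ?_ ?_) ?_ <;> simp <;> field_simp <;> ring
  continuous_toFun := by fun_prop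
  continuous_invFun := by fun_prop

/-- Affine coordinates of space in which the fibres of the projection to the circle are the level
sets of `X 0`. -/
noncomputable def screwChart (k : ℝ) : E3 ≃ₜ (ℝ × ℝ) × ℝ where
  toFun X := ((8 * X 1 + k, 4 * X 2 - k), -6 * X 0)
  invFun P := !₂[-(P.2 / 6), (P.1.1 - k) / 8, (P.1.2 + k) / 4]
  left_inv X := by
    ext i
    fin_cases i <;> simp <;> field_simp
  right_inv P := by
    refine Prod.ext (Prod.ext ?_ ?_) ?_ <;> simp <;> field_simp <;> ring
  continuous_toFun := by fun_prop
  continuous_invFun := by fun_prop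

theorem fibredChart_apply (k c : ℝ) (hc : c ≠ 0) (X : E3) :
    fibredChart k c hc X = ((8 * X 0 + k * X 1, 4 * X 2), -c * X 1) := rfl

theorem screwChart_apply (k : ℝ) (X : E3) :
    screwChart k X = ((8 * X 1 + k, 4 * X 2 - k), -6 * X 0) := rfl

theorem torusCoord_of_shift {σ : Equiv.Perm ℕ} {τ : Equiv.Perm (ℝ × ℝ)}
    (hτ : ∀ p v, kleinCoord (τ p).1 (τ p).2 (σ v) = kleinCoord p.1 p.2 v) {P Q : (ℝ × ℝ) × ℝ}
    (h : KleinRel (τ P.1).1 (τ P.1).2 Q.1.1 Q.1.2) (ht : Q.2 = P.2 - 3) :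
    torusCoord σ Q = torusCoord σ P := by
  rw [← torusCoord_shift hτ P]
  exact torusCoord_of_kleinRel h ht

theorem torusCoord_of_shift_shift {σ : Equiv.Perm ℕ} {τ : Equiv.Perm (ℝ × ℝ)}
    (hτ : ∀ p v, kleinCoord (τ p).1 (τ p).2 (σ v) = kleinCoord p.1 p.2 v) {P Q : (ℝ × ℝ) × ℝ}
    (h : KleinRel (τ (τ P.1)).1 (τ (τ P.1)).2 Q.1.1 Q.1.2) (ht : Q.2 = P.2 - 6) :
    torusCoord σ Q = torusCoord σ P := by
  rw [← torusCoord_shift hτ P]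
  exact torusCoord_of_shift hτ h (by rw [ht]; ring)

/-- The half turn `(x, y) ↦ (k - x, k - y)`. -/
def pointReflection (k : ℝ) : Equiv.Perm (ℝ × ℝ) where
  toFun p := (k - p.1, k - p.2)
  invFun p := (k - p.1, k - p.2)
  left_inv p := by simp
  right_inv p := by simp

theorem pointReflection_apply (k : ℝ) (p : ℝ × ℝ) : pointReflection k p = (k - p.1, k - p.2) := rfl

/-! ### Triangulations of the flat manifolds -/

/-- With trivial monodromy the translation along `X 1` is the gluing map. The factors `8` and `4` in
the chart turn the glide reflection and the unit translation along `X 2` into the deck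
transformations of the Klein bottle, and `-3` turns a unit step into one period downwards. -/
theorem triangulates_one :
    Nonempty (realization (twistedProduct kleinBottle8 1) ≃ₜ FlatB 0) := by
  have hτ : ∀ (p : ℝ × ℝ) (v : ℕ), kleinCoord ((1 : Equiv.Perm (ℝ × ℝ)) p).1
      ((1 : Equiv.Perm (ℝ × ℝ)) p).2 ((1 : Equiv.Perm ℕ) v) = kleinCoord p.1 p.2 v :=
    fun _ _ => rfl
  refine isTriangulation_twistedProduct (S := flatGenerators 0) hτ (fun _ => Iff.rfl)
    (fibredChart 0 3 (by norm_num)) ?_ ?_ ?_ ?_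
  · rintro g (rfl | rfl | rfl | rfl) X
    · refine torusCoord_of_kleinRel ⟨1, 0, Or.inl ⟨?_, ?_⟩⟩ ?_ <;>
        simp [fibredChart_apply, translation_apply] <;> ring
    · refine torusCoord_of_shift hτ ⟨0, 0, Or.inl ⟨?_, ?_⟩⟩ ?_ <;>
        simp [fibredChart_apply, translation_apply] <;> ring
    · refine torusCoord_of_kleinRel ⟨0, 1, Or.inl ⟨?_, ?_⟩⟩ ?_ <;>
        simp [fibredChart_apply, translation_apply] <;> ring
    · refine torusCoord_of_kleinRel ⟨0, 0, Or.inr ⟨?_, ?_⟩⟩ ?_ <;>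
        simp [fibredChart_apply, signedTranslation_apply] <;> ring
  · refine ⟨signedTranslation ![1, 1, -1] ![1 / 2, 0, 0],
      Subgroup.subset_closure (by simp [flatGenerators]), fun X => ?_⟩
    refine Prod.ext (Prod.ext ?_ ?_) ?_ <;>
        simp [fibredChart_apply, signedTranslation_apply] <;> ring
  · refine ⟨translation ![0, 0, 1],
      Subgroup.subset_closure (by simp [flatGenerators]), fun X => ?_⟩
    refine Prod.ext (Prod.ext ?_ ?_) ?_ <;>
        simp [fibredChart_apply, translation_apply] <;> ring
  · refine ⟨translation ![0, 1, 0],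
      Subgroup.subset_closure (by simp [flatGenerators]), fun X => ?_⟩
    refine Prod.ext (Prod.ext ?_ ?_) ?_ <;>
        simp [fibredChart_apply, translation_apply] <;> ring

/-- The half-lattice vector `(1/2, 1/2, 1/2)` serves as the gluing map, so half a unit of `X 1` has
to be one period, which gives `c = 6`. The shear `k = -4` makes this vector act on the fibre as the
translation by `(2, 2)`. -/
theorem triangulates_two :
    Nonempty (realization (twistedProduct kleinBottle8 (c[1, 6, 2, 5] * c[3, 8] * c[4, 7])) ≃ₜ
      FlatB 1) := by
  have hτ : ∀ (p : ℝ × ℝ) (v : ℕ), kleinCoord (Equiv.addRight ((2 : ℝ), (2 : ℝ)) p).1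
      (Equiv.addRight ((2 : ℝ), (2 : ℝ)) p).2
      ((c[1, 6, 2, 5] * c[3, 8] * c[4, 7] : Equiv.Perm ℕ) v) = kleinCoord p.1 p.2 v := by
    intro p v
    rw [gluing_two_apply, show (Equiv.addRight ((2 : ℝ), (2 : ℝ)) p).1 = 2 - -p.1 by
      simp [add_comm], show (Equiv.addRight ((2 : ℝ), (2 : ℝ)) p).2 = 2 - -p.2 by
      simp [add_comm], kleinCoord_halfTurn, halfTurn_halfTurn, kleinCoord_flipX, flipX_flipX,
      kleinCoord_flipY, flipY_flipY]
  have hg : ∀ b : Fin 3 → ℝ, translation b ∈ flatGenerators 1 → translation b ∈ flatGroup 1 :=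
    fun b h => Subgroup.subset_closure h
  refine isTriangulation_twistedProduct (S := flatGenerators 1) hτ (fun v => ?_)
    (fibredChart (-4) 6 (by norm_num)) ?_ ?_ ?_ ?_
  · rw [gluing_two_apply, halfTurn_mem_iff, flipX_mem_iff, flipY_mem_iff]
  · rintro g (rfl | rfl | rfl | rfl) X
    · refine torusCoord_of_kleinRel ⟨1, 0, Or.inl ⟨?_, ?_⟩⟩ ?_ <;>
        simp [fibredChart_apply, translation_apply] <;> ring
    · refine torusCoord_of_shift_shift hτ ⟨-1, -1, Or.inl ⟨?_, ?_⟩⟩ ?_ <;>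
        simp [fibredChart_apply, translation_apply] <;> ring
    · refine torusCoord_of_shift hτ ⟨0, 0, Or.inl ⟨?_, ?_⟩⟩ ?_ <;>
        simp [fibredChart_apply, translation_apply] <;> ring
    · refine torusCoord_of_kleinRel ⟨0, 0, Or.inr ⟨?_, ?_⟩⟩ ?_ <;>
        simp [fibredChart_apply, signedTranslation_apply] <;> ring
  · refine ⟨signedTranslation ![1, 1, -1] ![1 / 2, 0, 0],
      Subgroup.subset_closure (by simp [flatGenerators]), fun X => ?_⟩
    refine Prod.ext (Prod.ext ?_ ?_) ?_ <;>
        simp [fibredChart_apply, signedTranslation_apply] <;> ring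
  · refine ⟨translation ![0, 0, 1], ?_, fun X => ?_⟩
    · have h1 := hg ![1, 0, 0] (by simp [flatGenerators])
      have h2 := hg ![0, 1, 0] (by simp [flatGenerators])
      have h3 := hg ![1 / 2, 1 / 2, 1 / 2] (by simp [flatGenerators])
      -- The translation along `X 2` is not among the generators; it is twice the half-lattice
      -- vector minus the two other unit vectors.
      have h : translation ![0, 0, 1] * (translation ![1, 0, 0] * translation ![0, 1, 0]) =
          translation ![1 / 2, 1 / 2, 1 / 2] * translation ![1 / 2, 1 / 2, 1 / 2] := by
        ext X i
        simp only [IsometryEquiv.mul_apply, translation_apply]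
        fin_cases i <;> simp <;> ring
      refine ((flatGroup 1).mul_mem_cancel_right ((flatGroup 1).mul_mem h1 h2)).mp ?_
      rw [h]
      exact (flatGroup 1).mul_mem h3 h3
    · refine Prod.ext (Prod.ext ?_ ?_) ?_ <;>
        simp [fibredChart_apply, translation_apply] <;> ring
  · refine ⟨translation ![1 / 2, 1 / 2, 1 / 2],
      Subgroup.subset_closure (by simp [flatGenerators]), fun X => ?_⟩
    refine Prod.ext (Prod.ext ?_ ?_) ?_ <;>
        simp [fibredChart_apply, translation_apply] <;> ring

/-- The screw motion is the gluing map, a half turn of the fibres `X 0 = const`, and the glide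
reflection acts within these fibres. -/
theorem triangulates_three :
    Nonempty (realization (twistedProduct kleinBottle8 (c[1, 2] * c[3, 4] * c[7, 8])) ≃ₜ
      FlatB 2) := by
  have hτ : ∀ (p : ℝ × ℝ) (v : ℕ), kleinCoord (pointReflection 0 p).1
      (pointReflection 0 p).2
      ((c[1, 2] * c[3, 4] * c[7, 8] : Equiv.Perm ℕ) v) = kleinCoord p.1 p.2 v := by
    intro p v
    rw [gluing_three_apply, pointReflection_apply, zero_sub, zero_sub, kleinCoord_flipX,
      flipX_flipX, kleinCoord_flipY, flipY_flipY]
  refine isTriangulation_twistedProduct (S := flatGenerators 2) hτ (fun v => ?_)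
    (screwChart 0) ?_ ?_ ?_ ?_
  · rw [gluing_three_apply, flipX_mem_iff, flipY_mem_iff]
  · rintro g (rfl | rfl | rfl | rfl | rfl) X
    · refine torusCoord_of_shift_shift hτ ⟨0, 0, Or.inl ⟨?_, ?_⟩⟩ ?_ <;>
        simp [screwChart_apply, translation_apply, pointReflection_apply] <;> ring
    · refine torusCoord_of_kleinRel ⟨1, 0, Or.inl ⟨?_, ?_⟩⟩ ?_ <;>
        simp [screwChart_apply, translation_apply] <;> ring
    · refine torusCoord_of_kleinRel ⟨0, 1, Or.inl ⟨?_, ?_⟩⟩ ?_ <;>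
        simp [screwChart_apply, translation_apply] <;> ring
    · refine torusCoord_of_shift hτ ⟨0, 0, Or.inl ⟨?_, ?_⟩⟩ ?_ <;>
        simp [screwChart_apply, signedTranslation_apply, pointReflection_apply] <;> ring
    · refine torusCoord_of_kleinRel ⟨0, 0, Or.inr ⟨?_, ?_⟩⟩ ?_ <;>
        simp [screwChart_apply, signedTranslation_apply] <;> ring
  · refine ⟨signedTranslation ![1, 1, -1] ![0, 1 / 2, 0],
      Subgroup.subset_closure (by simp [flatGenerators]), fun X => ?_⟩
    refine Prod.ext (Prod.ext ?_ ?_) ?_ <;>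
        simp [screwChart_apply, signedTranslation_apply] <;> ring
  · refine ⟨translation ![0, 0, 1],
      Subgroup.subset_closure (by simp [flatGenerators]), fun X => ?_⟩
    refine Prod.ext (Prod.ext ?_ ?_) ?_ <;>
        simp [screwChart_apply, translation_apply] <;> ring
  · refine ⟨signedTranslation ![1, -1, -1] ![1 / 2, 0, 0],
      Subgroup.subset_closure (by simp [flatGenerators]), fun X => ?_⟩
    refine Prod.ext (Prod.ext ?_ ?_) ?_ <;>
        simp [screwChart_apply, signedTranslation_apply, pointReflection_apply] <;> ring

/-- The mirror plane of the glide reflection is at `X 2 = 1/4`, and the shift by `-1` in the chart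
moves it to `y = 0`. The shift by `+1` in the other coordinate then turns the screw motion, up to a
deck translation, into the half turn `(2 - x, 2 - y)`. -/
theorem triangulates_four :
    Nonempty (realization (twistedProduct kleinBottle8
      (c[1, 5] * c[2, 6] * c[3, 7] * c[4, 8])) ≃ₜ FlatB 3) := by
  have hτ : ∀ (p : ℝ × ℝ) (v : ℕ), kleinCoord (pointReflection 2 p).1
      (pointReflection 2 p).2
      ((c[1, 5] * c[2, 6] * c[3, 7] * c[4, 8] : Equiv.Perm ℕ) v) = kleinCoord p.1 p.2 v := by
    intro p v
    rw [gluing_four_apply, pointReflection_apply, kleinCoord_halfTurn, halfTurn_halfTurn]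
  refine isTriangulation_twistedProduct (S := flatGenerators 3) hτ (fun v => ?_)
    (screwChart 1) ?_ ?_ ?_ ?_
  · rw [gluing_four_apply, halfTurn_mem_iff]
  · rintro g (rfl | rfl | rfl | rfl | rfl) X
    · refine torusCoord_of_shift_shift hτ ⟨0, 0, Or.inl ⟨?_, ?_⟩⟩ ?_ <;>
        simp [screwChart_apply, translation_apply, pointReflection_apply] <;> ring
    · refine torusCoord_of_kleinRel ⟨1, 0, Or.inl ⟨?_, ?_⟩⟩ ?_ <;>
        simp [screwChart_apply, translation_apply] <;> ring
    · refine torusCoord_of_kleinRel ⟨0, 1, Or.inl ⟨?_, ?_⟩⟩ ?_ <;>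
        simp [screwChart_apply, translation_apply] <;> ring
    · refine torusCoord_of_shift hτ ⟨0, -1, Or.inl ⟨?_, ?_⟩⟩ ?_ <;>
        simp [screwChart_apply, signedTranslation_apply, pointReflection_apply] <;> ring
    · refine torusCoord_of_kleinRel ⟨0, 0, Or.inr ⟨?_, ?_⟩⟩ ?_ <;>
        simp [screwChart_apply, signedTranslation_apply] <;> ring
  · refine ⟨signedTranslation ![1, 1, -1] ![0, 1 / 2, 1 / 2],
      Subgroup.subset_closure (by simp [flatGenerators]), fun X => ?_⟩
    refine Prod.ext (Prod.ext ?_ ?_) ?_ <;>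
        simp [screwChart_apply, signedTranslation_apply] <;> ring
  · refine ⟨translation ![0, 0, 1],
      Subgroup.subset_closure (by simp [flatGenerators]), fun X => ?_⟩
    refine Prod.ext (Prod.ext ?_ ?_) ?_ <;>
        simp [screwChart_apply, translation_apply] <;> ring
  · refine ⟨translation ![0, 0, 1] * signedTranslation ![1, -1, -1] ![1 / 2, 0, 0],
      mul_mem (Subgroup.subset_closure (by simp [flatGenerators]))
        (Subgroup.subset_closure (by simp [flatGenerators])), fun X => ?_⟩
    refine Prod.ext (Prod.ext ?_ ?_) ?_ <;>
        simp [screwChart_apply, translation_apply, signedTranslation_apply,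
          pointReflection_apply] <;> ring

/-! ### The flip sequences -/

/-- A flip sequence from the twisted product triangulation of `B₁` to a triangulation with
`17` vertices, in the encoding of `runFlips`. -/
def flipsOne : List ℕ := [
  94717987, 86018890, 38763079, 81348011, 93486022, 80697367, 77288743, 25494019, 89430326,
  81304110, 59007491, 90200478, 25691914, 68427907, 77087115, 42651911, 17180978, 8521770, 72960423,
  54793494, 76372119, 86415538, 72823971, 42390923, 80906414, 90331418, 67633930, 51656074,
  97212447, 94717987, 77288743, 90209174, 90007219, 94030522, 89430326, 77154731, 86018890,
  34433603, 93668899, 34568899, 94962714, 85494570, 86419762, 68774435, 38051971, 90007207,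
  99288094, 55715078, 94018234, 94930994, 93668899, 68364451, 34433603, 85494570, 94962714,
  81828002, 42516875, 50734354, 97056435, 46711175, 64670610, 50730386, 88397095, 64410627,
  34568899, 79738019, 93668899, 99288094, 47352194, 42516875, 69104259, 97998499, 50734354,
  97056435, 30017598, 98481826, 64670610, 55876234, 84359315, 81938958, 42111235, 75539619,
  43157762, 63361667, 38012166, 55183246, 29823495, 71832462, 85947943, 98081342, 85494570,
  92858035, 79894543, 60476178, 93018651, 88397095, 55876234, 90142383, 90098614, 73415046,
  92882971, 90729238, 68968963, 90082222, 86010642, 85746323, 25692218, 38196491, 55846030,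
  38336007, 68563075, 88146839, 77153571, 82102826, 51210963, 95110682, 34298307, 85648019,
  68049538, 59394614, 63361667, 64492690, 63230607, 25840186, 90637334, 88553751, 12716078,
  55195530, 55183246, 82074254, 92858035, 73298695, 55505539, 55461782, 34137603, 99042855,
  29823495, 30152894, 71832462, 85498830, 38492487, 72892807, 99047459, 93341490, 94717475,
  17176754, 94702114, 92464807, 60463878, 68494499, 33867011, 34088450, 90510486, 76711978,
  88143267, 90213326, 92476315, 88696499, 90064562, 72248070, 92989075, 60443414, 51210963,
  38806786, 79738019, 90572194, 69040931, 98264871, 73298439, 69104387, 34404099, 55370375,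
  34359042, 73294726, 42517515, 89786286, 38492487, 59381402, 90510486, 30148670, 85619347,
  42481162, 93673127, 25498247, 30034486, 88553751, 99387450, 90192278, 71963402, 95110682,
  68494499, 51346131, 73069459, 69104387, 99304990, 94149558, 92591399, 76711978, 55876362,
  38196491, 55846030, 30148670, 42652043, 54928662, 89824042, 94336807, 96663079, 64527238,
  98343742, 34534147, 38192519, 63850678, 63702046, 38365879, 51778702, 80693415, 94311323,
  80628294, 41976331, 34088194, 85619347, 50377863, 79991811, 81266086, 50726278, 72248126,
  38799754, 41976331, 34088194, 76499347, 95081618, 97212959, 68774475, 69171875, 90733462,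
  30034486, 29819523, 94971954, 88418455, 99256382, 67765134, 94336807, 98343742, 93635603,
  56145167, 88484118, 25498247, 81728403, 71963402, 47462066, 51399466, 51346131, 92464807,
  51542994, 60463878, 72239550, 86395166, 81295910, 88274451, 76499379, 50635795, 50734354,
  76433998, 64506502, 72431655, 63377927, 64500230, 81828002, 60389287, 60299174, 68694147,
  12716082, 81728403, 80042255, 56145167, 29819523, 56108302, 90454410, 56100238, 67765134,
  72239550, 38306051, 59036807, 59385478, 73158919, 68774179, 97318691, 21239994, 64785306,
  29562779, 73099943, 86035274, 64190259, 98355110, 73294726, 25485959, 33817746, 72098438,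
  68494883, 77105194, 95066294, 55616651, 43132578, 71365531, 88877206, 51040651, 54928918,
  63858818, 72937999, 90007187, 86207131, 72882062, 93673127, 89824042, 79873155, 89955126,
  51513734, 42517515, 95054406, 81483139, 81446274, 34036163, 81438254, 69171875, 90625325,
  99256382, 90637326, 55370379, 58782747, 55330582, 51389714, 76367891, 42517515, 42385931,
  59245594, 97347615, 79873155, 55850506, 94718003, 94403482, 77289899, 86035274, 81744899,
  50652295, 77253034, 81713794, 59905546, 51513734, 69040931, 86001946, 73163015, 25434298,
  77241002, 80042255, 80435215, 93635603, 90454410, 73201159, 51399466, 90192278, 59733543,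
  94141350, 64493754, 51181319, 72902534, 73095463, 99387450, 71369095, 72876422, 71567366,
  55616651, 92625051, 80435215, 90192278, 77235494, 56133930, 92333075, 33998099, 90336010,
  33957138, 59788034, 55588394, 97085219, 76239243, 94145426, 51040643, 54920726, 54715147,
  88484118, 94066451, 51696655, 55588106, 94328467, 89803582, 56132009, 94018234, 94558886,
  88160163, 81693314, 55711498, 75569163, 68888099, 59036423, 77105206, 59909766, 94705319,
  73046858, 86451743, 38364983, 77101646, 29807235, 76023818, 94164114, 80042255, 90454410,
  68039298, 63361923, 97085219, 94145426, 92595879, 89012246, 33722627, 60463882, 88160183,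
  73201179, 94718003, 86035274, 55445390, 50648079, 73143834, 89131454, 51189691, 25612939,
  88879754, 38011910, 55588362, 63624083, 34569019, 68189146, 55461782, 50663555, 89160642,
  51519618, 51124410, 67846931, 38306051, 60302470, 84690966, 51128454, 94718003, 38594187,
  33817746, 94668850, 68968963, 84366231, 60433562, 25692218, 89020942, 90011555, 89967550,
  89917346, 89947042, 68841859, 60317957, 89965533, 86207131, 89339939, 89262498, 29755446,
  76367891, 86001946, 95054406, 63361923, 76235667, 55445390, 84822294, 84366231, 67445251,
  73410818, 89020942, 72427559, 81728403, 77633698, 38594187, 72239550, 60433562, 38222019,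
  80827523, 89262498, 64050947, 38594059, 89917346, 60302490, 89274818, 85615251, 85775123,
  85619346, 38306051, 63378963, 21025679, 72894350, 55456386, 80028175, 55331386, 90581262,
  75962407, 73439502, 75962407, 73439502, 33817746, 68841859, 85027139, 80564619, 76372363,
  29755446, 34433603, 77752970, 85494602, 85775123, 34499394, 94311323, 81863179, 55331386,
  76032450, 72248126, 92718099, 75969291, 73201179, 80488718, 73147930, 92595879, 77402891,
  72100154, 60463882, 68968963, 21025679, 25692218, 55456386, 51399438, 64050947, 51210787,
  69030943, 69104387, 89159738, 38353039, 94930458, 38685126, 89917346, 68895507, 30148670,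
  51189515, 64514234, 84690998, 29681191, 60330890, 88421135, 94328339, 94705319, 94296722,
  80493194, 73046858, 75585975, 77072822, 73201179, 64514234, 94722203, 90336074, 68751619,
  68895507, 29702419, 88380419, 73229991, 82068362, 72442779, 68696194, 84690998, 38800010,
  94017722, 64050947, 89917346, 81863179, 93218978, 81995787, 81946890, 88683663, 92333075,
  94722203, 75962407, 94689990, 94405531, 73439502, 34499394, 71370251, 71698482, 92718099,
  80886418, 68887715, 84333463, 59788034, 51399438, 94673078, 55466510, 84366231, 85603222,
  84686486, 76711990, 90726805, 83952403, 67914242, 63361923, 59167499, 73069459, 55445390,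
  90401051, 63850678, 55322382, 94661318, 92362679, 75839683, 81987850, 94636726, 94840987,
  77753166, 64054803, 84202255, 38627655, 55327242, 72414739, 38693702, 64506018, 94454811,
  94401562, 68887715, 77555331, 63235611, 76711990, 75962407, 73279002, 80827523, 93865890,
  93980990, 89262498, 68895507, 92718099, 68765987, 77556355, 73439502, 95029566, 84690998,
  86280242, 85141539, 77629990, 85141539, 63361923, 77629990, 51399438, 75979163, 90597646,
  68895507, 84690998, 34433055, 84962114, 77555331, 90503938, 85141539, 55445390, 73069459,
  77629990, 63850678, 73200395, 77420419, 63711418, 80757131, 85945011, 85141539, 17181090,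
  90048826, 68841859, 29755446, 89867023, 77629990, 92595879, 85141539, 95078974, 84687542,
  77629990, 75839643, 81946890, 73069459, 75979163, 60463882, 90597646, 89876799, 94698166,
  94540699, 83940239, 63850678, 38693702, 55458306, 88696755, 89859971, 95082814, 92756507,
  89803582, 51210787, 63361923, 64164755, 72239014, 94930458, 90729230, 55445390, 88421135,
  73069459, 63850678, 80493194, 94405531, 29693851, 63361923, 68895507, 84690998, 73294730,
  34499394, 64164763, 64112798, 90371603, 86463247, 92595879, 88881742, 29681191, 64506566,
  81695635, 92333075, 75839507, 55445390, 77736386, 76294598, 93202214, 38685118, 51189643,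
  72283291, 75979163, 73279002, 72401423, 75901338, 76036490, 64120990, 68751747, 68692098,
  50870434, 59167499, 72283283, 59986947, 64112798, 80566543, 63378963, 55322382, 89130790,
  72894350, 90454426, 59788034, 51189643, 73279002, 88401439, 60324490, 68895507, 69104387,
  84690998, 30148670, 72401423, 94328467, 94292626, 50870434, 85945011, 95078974, 92333075,
  68841859, 68862338, 12650163, 77534363, 29755446, 72509758, 59788034, 92363063, 85945011,
  90495746, 85808671, 63378963, 84202255, 85912242, 89733379, 55327242, 89835778, 89692546,
  64012815, 64108690, 50870178, 64012815, 94405531, 50870178, 34499394, 94454811, 94401562,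
  84211507, 84813618, 85115787, 59982731, 94147466, 71370255, 68696194, 71370255, 60463882,
  51189643, 71567410, 73056643, 69035039, 93354042, 50727094, 73279002, 75563531, 77727754,
  88684815, 89278862, 34398723, 88426427, 94577819, 85912202, 59245594, 76704582, 92718099,
  64055859, 68841859, 29755446, 51399438, 63982386, 63976978, 88417039, 67445251, 76298890,
  80173331, 73410818, 60376971, 34433055, 90458510, 94401562, 60332554, 92756507, 90729230,
  60324390, 69104387, 30148670, 50940191, 79779367, 68751619, 81283358, 68696194, 34433055,
  94401562, 51530142, 89672138, 85141539, 93906079, 34433603, 34499394, 59931442, 84202255,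
  89692562, 55327242, 89690189, 68841859, 29755446, 84224019, 77629990, 83940239, 55458306,
  77547043, 77613578, 69146123, 85494078, 69089458, 69113998, 92333075, 85141539, 69030943,
  59788034, 77629990, 71763879, 69113998, 77533963, 77502618, 89159738, 77658278, 94454811,
  94401562, 92362679, 75590327, 95082754, 90102530, 76506267, 93481246, 68887715, 88417039,
  76711990, 77656389]

/-- A flip sequence from the twisted product triangulation of `B₂` to a triangulation with
`16` vertices, in the encoding of `runFlips`. -/
def flipsTwo : List ℕ := [
  68503843, 86280234, 88135075, 38336007, 92333603, 77027755, 60328706, 86292906, 64492690,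
  77153707, 85371186, 72892811, 56003202, 72876554, 38187139, 72880654, 77492995, 64406663,
  84607363, 67504662, 96532259, 64785282, 77468570, 46269582, 59036295, 55187210, 72794503,
  72754702, 46732807, 64374278, 33774019, 92493967, 77153571, 94902926, 90637318, 97994279,
  85231922, 17241479, 98481702, 72749582, 69149571, 60081155, 51382058, 88946951, 76417086,
  82057882, 72024851, 67913878, 34404099, 33727619, 43123718, 92333603, 17110531, 72876554,
  68833675, 68813454, 85947951, 81090863, 69040931, 68817546, 85892014, 90011683, 98601658,
  90487210, 68604299, 99387450, 73319827, 60328706, 64750618, 68969107, 68552334, 25839674,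
  77394691, 73274770, 77338522, 73298438, 77288743, 68368547, 77249194, 92358671, 55505539,
  73163267, 68842114, 85682867, 77788038, 77633698, 96553099, 99146418, 85908402, 25692346,
  96663335, 92408334, 16974615, 64789382, 67916294, 72024979, 68044950, 75814315, 90007207,
  55461782, 94018234, 56011018, 68474251, 68425354, 33913667, 68969107, 68830102, 68948758,
  89140162, 86125442, 94336807, 89466535, 51188227, 98343742, 68997766, 71829018, 88135075,
  55379719, 56003202, 38742211, 68949658, 33774019, 33823426, 94336807, 77241002, 94276538,
  73070099, 96553099, 38107975, 73192979, 56117434, 93782403, 67504942, 99423370, 73037714,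
  93782411, 88162567, 34137603, 99224074, 73454482, 73204499, 93718542, 42517507, 34420743,
  51381522, 59713411, 92858035, 77792414, 93341490, 81794074, 95029766, 94722183, 93720962,
  67913914, 60384275, 60294162, 90315594, 60476178, 94548362, 68997653, 50534319, 77465374,
  73315846, 92858035, 93652363, 68561706, 94548109, 63510195, 60476178, 84473523, 64670226,
  94717955, 51595183, 85898790, 73058194, 98657291, 94669378, 81484079, 81431214, 93334466,
  34535043, 64619550, 69149571, 94849283, 69129090, 68728075, 86248270, 96687115, 86075683,
  47458354, 29435967, 96602762, 73463454, 80286467, 72427559, 85986122, 60081155, 81954854,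
  90122375, 81807514, 77732542, 51382058, 77658270, 77656093, 73213831, 77469882, 84490371,
  81551875, 81847058, 81532954, 82109190, 81922578, 82108441, 60081155, 73218067, 81807546,
  51382058, 77153571, 85231922, 80020487, 60085383, 55711530, 81733379, 68163978, 77334974,
  60098183, 68818730, 85801219, 82053690, 50534319, 73205395, 89995527, 82057914, 90270211,
  89602359, 81979410, 73315846, 82107054, 94898882, 73189010, 73140626, 51553283, 42993190,
  60081155, 73187345, 51382058, 60085383, 72663299, 84240419, 64283783, 94722215, 68986502,
  84114051, 90348362, 94407178, 72787466, 97849603, 89995527, 82057914, 97784066, 59905962,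
  93681803, 51595183, 54753955, 93759626, 85898790, 63273763, 59074467, 94902914, 85597142,
  94275338, 99387274, 51595183, 85898790, 94414218, 81402530, 77208270, 50534319, 46491691,
  73315846, 64308783, 93985490, 94414218, 73311790, 94722183, 94689926, 89466535, 77241002,
  94673606, 68368547, 81954854, 94688469, 98112771, 72616882, 81741223, 81086383, 85899690,
  85367230, 80020487, 98396067, 94276538, 99043495, 98961990, 68163978, 86177195, 86165418,
  50555447, 98125751, 85908402, 80020487, 68163978, 59049223, 94950918, 68425482, 98396067,
  98343742, 68364451, 59049223, 68425482, 86169522, 85792435, 81828002, 94955186, 98599175,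
  98607366, 85756722, 72427559, 77633698, 72435243, 99419146, 85502114, 94336803, 94280634,
  81086767, 99419401, 86292906, 81069831, 72402179, 68950442, 73172482, 86148914, 64283783,
  59905962, 97995175, 98370823, 68426682, 98482726, 60377251, 86148650, 60229291, 68855598,
  50403107, 73172482, 60229291, 86172721]

/-- A flip sequence from the twisted product triangulation of `B₃` to a triangulation with
`17` vertices, in the encoding of `runFlips`. -/
def flipsThree : List ℕ := [
  38632263, 42686923, 90645782, 85093318, 77153571, 88135075, 80562343, 79738019, 84355091,
  68969095, 90007207, 25827386, 77613582, 90572194, 96663079, 89967414, 98310054, 34023619,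
  77792270, 80497222, 38065415, 55841930, 85231922, 85881491, 76498963, 86001950, 97056263,
  86201239, 64494482, 81483139, 33781691, 88277783, 77027755, 67918470, 89020998, 25494151,
  81431170, 75694607, 93668899, 94066483, 98493446, 90614062, 94018234, 30034494, 94722215,
  67769098, 85494570, 67647750, 71500035, 67373190, 75539619, 86192915, 47274423, 43157762,
  94336803, 77288743, 90625442, 98339646, 33781691, 98493446, 88422423, 94689958, 81439406,
  51342035, 47265411, 90450326, 60085383, 80497222, 82107050, 55711530, 81397154, 55536307,
  81712131, 55577022, 33867011, 80159243, 85881491, 88549527, 84198827, 80435467, 90450326,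
  34437827, 51816970, 88484118, 85677599, 99146418, 90585354, 33726723, 99288090, 38758555,
  42206214, 63361667, 51643402, 47269419, 34163011, 55183246, 68833543, 94950942, 75848079,
  94336803, 76032398, 77424295, 86311954, 68368547, 81954854, 89352519, 68473095, 89291590,
  94591271, 55370387, 98339646, 33896643, 73099979, 68419846, 95103158, 68997767, 34564675,
  89750071, 30034494, 85501346, 94017850, 81986570, 73099559, 68969094, 94673078, 68839190,
  46846347, 75694607, 95110814, 97478683, 97680154, 97961095, 68385567, 54928790, 88150935,
  95078966, 99137062, 67647750, 99383334, 94962718, 68329603, 68850950, 88475798, 79869059,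
  68774435, 59699971, 29819399, 67638158, 8569359, 90479430, 59643802, 68973318, 84112943, 94590111,
  64190215, 85072814, 51342035, 88678795, 94930994, 68982406, 80680091, 86381990, 50868486,
  72509854, 89824074, 90007219, 94030522, 95110686, 85947527, 63759235, 51175939, 97655358,
  38230343, 85682867, 97056435, 59639706, 72044931, 72243842, 90589450, 95078966, 89291590,
  98310054, 59246106, 99042459, 60081155, 51382058, 85093326, 96999346, 73167619, 34437827,
  73155330, 54752787, 98059910, 46846347, 46711179, 54928790, 50734482, 90510478, 51553283,
  88150935, 88475798, 34535171, 99042459, 42551755, 64750622, 63754899, 99288090, 85093326,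
  42993190, 93156511, 72892675, 73187842, 84198827, 97680154, 85636363, 94717987, 55199642,
  83936547, 86451474, 38207619, 67241102, 84149802, 86018890, 99047075, 47458870, 54702467,
  94721703, 89824074, 81401218, 73065235, 99027618, 81753763, 80435211, 98208190, 98777123,
  73327491, 33899779, 90188182, 73058066, 51390978, 51342035, 8569359, 92501799, 98900003, 33782587,
  80435211, 97212955, 98589338, 98982594, 59639998, 95110686, 46405134, 96548515, 47269387,
  73436106, 34420903, 81957914, 98436770, 83965063, 86192915, 97994247, 93157407, 80878082,
  69104135, 90007207, 55670659, 47483402, 89967414, 96811031, 80171531, 80497222, 29890622,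
  63970234, 93481886, 80362122, 85466030, 54793614, 80680091, 72509854, 81812362, 34174903,
  16839575, 81824710, 98916791, 34085822, 55514907, 98777123, 72679683, 34535171, 73164446,
  75539619, 51608071, 88963607, 64750622, 89466535, 98395143, 63853058, 46584071, 71500163,
  50770183, 81431426, 90236583, 67504262, 46405134, 81824710, 81347975, 99113626, 43157762,
  90220198, 99096102, 82066066, 90627018, 90614070, 54793614, 85334450, 67373226, 93018655,
  98343686, 75837967, 72045443, 46216839, 42158511, 89000086, 68751619, 81401218, 89204007,
  71567410, 90343718, 90733334, 80230666, 21156227, 72044931, 86422790, 72243842, 97478683,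
  21239438, 97868215, 97680154, 90626986, 85813939, 93156511, 97680154, 92501799, 93330362,
  81347975, 85756722, 88700595, 96811031, 85334450, 81347975, 81812362, 88308275, 55510811,
  73037594, 42128779, 77023659, 34023619, 81008302, 85334450, 51687687, 59315891, 89933490,
  99142278, 89143622, 84355107, 51676554, 73327491, 93931299, 86419758, 59639998, 34535171,
  42516743, 64750622, 85756722, 85501346, 60119095, 90232618, 51643402, 86193307, 55784451,
  80898630, 50599186, 80742054, 85203374, 77629966, 72679683, 72917250, 88278823, 98777123,
  71483915, 50866310, 68983430, 88307219, 71500163, 71963010, 51553283, 81824710, 90708914,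
  34272915, 34211766, 93157407, 92882975, 93012883, 80680091, 94717987, 72509854, 56170259,
  34533895, 84822806, 38357403, 93481886, 72501658, 55783555, 94045083, 73156274, 34494354,
  68053814, 77812751, 88150935, 94652994, 34473878, 59799430, 77792270, 72243842, 42993190,
  98920483, 77425187, 86078231, 75694607, 76764451, 76507155, 64545795, 76421138, 25393959,
  99390214, 94931258, 77731854, 94407626, 85669127, 59770782, 86276882, 75539619, 85500077,
  85629318, 38090899, 92883231, 83940487, 86378150, 67721015, 89970706, 79839627, 80351626,
  42651911, 97278530, 98395143, 64275459, 56186643, 29841559, 86075683, 68441738, 90329998,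
  93330362, 67687191, 77765282, 82055694, 73058066, 55334930, 84227219, 60102147, 64792066,
  94669378, 38486803, 96811031, 84690070, 93026331, 50394403, 80890378, 55787651, 64259586,
  84018854, 60065714, 85763618, 60063805, 89223687, 89820050, 43157762, 59446147, 81812362,
  72222486, 86276882, 90606518, 54829703, 98593558, 76231047, 90462606, 55793707, 77748878,
  94861347, 42604170, 90220198, 98916759, 77398919, 59319175, 98601806, 77746317, 59786118,
  34394771, 81281287, 33896615, 77268767, 90594250, 54854935, 81957898, 55787651, 68974902,
  54793494, 51189395, 84018854, 51581715, 51521682, 94590111, 29567035, 17045938, 59409299,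
  77652870, 94528670, 93026331, 42551755, 86173227, 86451474, 34490134, 16861607, 86413826,
  96552071, 29567035, 60336710, 88409771, 38501147, 55198746, 25262631, 33896643, 81335435,
  92883231, 81282186, 99128066, 94044951, 81269258, 94009370, 68856458, 97076379, 88159907,
  29890874, 99378326, 84198663, 16810903, 8460331, 73441538, 93669155, 59245598, 97143322, 94557082,
  85072770, 38501147, 86276882, 85756714, 77425187, 98265111, 51649034, 94395318, 8442503, 81986570,
  77376034, 81431170, 94861335, 38423450, 55185666, 55797915, 92894359, 56137882, 94800834,
  55051286, 97671954, 86020227, 68761739, 68724874, 55728922, 85014147, 98261411, 86179971,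
  77154091, 75838087, 85764402, 77154091, 85764402, 67242566, 81398306, 80353546, 84198663,
  90606518, 85599494, 77285803, 75569159, 42931971, 90495402, 86207135, 73139486, 76155014,
  37882434, 98916759, 95058502, 55722774, 98261451, 86033675, 90647478, 90594250, 51653186,
  92616727, 81812234, 88156311, 51066891, 81074227, 81798678, 93936187, 90762034, 81012786,
  89000086, 85089170, 75838087, 56136217, 80353546, 98261411, 98395271, 42157579, 85468422,
  38758583, 98339590, 42153483, 89291590, 34529799, 34473746, 75843243, 85633290, 90606518,
  81274118, 34302403, 80693523, 94831638, 75838087, 80615698, 92604055, 80353546, 94775318,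
  92459659, 98264215, 59278215, 93477814, 34477842, 59065899, 94557343, 95098014, 72046851,
  88425991, 94769802, 85501706, 92362911, 85465738, 92853399, 85027131, 86173227, 55728914,
  98261411, 90441878, 51041427, 90340098, 94693922, 55723542, 60336710, 97076375, 90606518,
  85089170, 93936187, 42157579, 85010219, 55843338, 34306895, 94931258, 38733575, 89152462,
  68949150, 92362911, 81008138, 33909187, 51460263, 99046423, 90762034, 81958434, 90340098,
  89152462, 38750611, 86020227, 94831626, 86394014, 59278215, 34477842, 77398919, 51460263,
  42931971, 97076375, 73139486, 92894359, 93936187, 37882434, 93996182, 38500883, 81958434,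
  68032826, 90762034, 99107990, 98263699, 71906855, 73025062, 98212626, 38750611, 59332275,
  98751635, 29714487, 73156274, 86394014, 71513619, 94425994, 86209683, 97667654, 99030163,
  38500883, 99423910, 72620466, 72502222, 29714487, 51466759, 88610338, 99107990, 92895399,
  38750611, 86394014, 93998022, 99050519, 97475095, 86207135, 90725278, 94425994, 55784451,
  85629314, 55712258, 67838083, 99300374, 95058502, 38733575, 92328583, 92949430, 92800662,
  42538803, 75630614, 68949150, 8480391, 42473650, 93669155, 85756714, 79746211, 17131139, 55740802,
  81021062, 55269835, 42938887, 93979146, 93982978, 90646166, 80221470, 38759111, 51466759,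
  93663495, 95098014, 94019846, 76100487, 94414474, 88610338, 94831881, 51466759, 88610338,
  80615698, 34306895, 83973015, 99431446, 89020930, 81623843, 79782535, 98261411, 82051718,
  86075679, 90573078, 90606518, 34306767, 99300374, 86207135, 95058502, 86018890, 34238979,
  98130439, 29885462, 98261411, 67713195, 99387834, 77398919, 81963026, 96559763, 92949378,
  94722215, 68032826, 34306895, 38501139, 81306119, 85089170, 42473906, 59472675, 59923418,
  90606518, 89152462, 90708914, 83940487, 55712258, 97444871, 38762247, 90348362, 98309278,
  59775902, 76106143, 86407442, 21195139, 99046423, 67721015, 38733575, 68949150, 89970706,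
  55271939, 94765702, 81597715, 92800662, 89152462, 83915411, 72632762, 90702742, 72049811,
  67721015, 38750611, 21199523, 86394014, 59382690, 56182023, 93472918, 38411194, 55271939,
  72050323, 84548518, 93997206, 92800662, 38750611, 51594887, 85595686, 89970706, 85202610,
  76100487, 80615698, 81617943, 86207135, 86394014, 86117022, 77415715, 85231930, 94711939,
  76241283, 93346234, 90573078, 79825738, 72934675, 55271939, 92800662, 42918915, 81617943,
  56170259, 73156274, 93346234, 38733575, 60049586, 51466759, 88610338, 59770142, 76241283,
  90573078, 68949150, 90722525, 67856803, 94799894, 55271939, 92800662, 94717987, 77425187,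
  77376034, 38733575, 68949150, 30073863, 94665282, 59773846, 85014183, 56186643, 89933490,
  81435170, 30097923, 84411286, 71510019, 77596806, 81597715, 85027131, 85231930, 72632762,
  55271939, 72047107, 92800662, 42952759, 94426398, 90704022, 77398919, 68032826, 77425187,
  94931258, 71513363, 77398919, 81021062, 81601415, 76421562, 89031175, 34085534, 81617943,
  71510019, 89065271, 68032826, 77596806, 93346234, 38733575, 71510019, 68999838, 68949150,
  77596806, 51463979, 38733575, 71510019, 85763618, 42938887, 77596806, 56182023, 51463979,
  85763618, 68949150, 93902087, 55843634, 72049811, 55273619, 89031175, 55184146, 85202610,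
  34085534, 80221470, 42918915, 59770142, 42931971, 73139486, 92878087, 77398919, 81617943,
  93346234, 67856803, 93889031, 68032826, 67721015, 77415715, 94799894, 85231930, 81355271,
  89031175, 92805554, 34085534, 89970706, 42474290, 81009426, 67713195, 42931971, 73139486,
  81963026, 77415715, 42952759, 94693922, 38750611, 86394014, 85021319, 51468807, 51399302,
  94426398, 30107831, 94557078, 76100487, 89065271, 68999838, 86075679, 80615698, 94665282,
  89090631, 42952759, 86075679, 94426398, 89000518, 88261651, 90707490, 88742434, 94665282,
  85021319, 93936187, 71513363, 90762034, 88742434, 92852867, 94520982, 76241283, 55264391,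
  76106143, 93472918, 67721015, 85071510, 55264391, 90573078, 86407442, 89970706, 85071510,
  56182023, 85202610, 85014183, 81435170, 76100487, 80615698, 81021062, 30073863, 71510019,
  77596806, 85010219, 94931258, 59773846, 56182023, 38733575, 86193299, 68949150, 42931971,
  73139486, 85202610, 55264391, 80890438, 85071510, 51075591, 56186643, 90707478, 42952759,
  76106143, 77398919, 94426398, 89933490, 68032826, 86407442, 42952759, 81617943, 51075591,
  76100487, 80615698, 94426398, 86201219, 93346234, 86075679, 94665282, 51593863, 94968478,
  84547110, 90707478, 72049811, 89031175, 34085534, 93472918, 93936187, 56182023, 85202610,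
  51463979, 76241283, 93882938, 71510019, 89081987, 86117022, 90573078, 77596806, 30073863,
  59773846, 67822727, 59906070, 55269795, 90605206, 86075679, 94665282, 30073863, 85791619,
  59773846, 56186643, 72223290, 72049811, 51604155, 95086118, 89933490, 89081987, 86117022,
  85791619, 93472918, 81617943, 93346234, 71513363, 77153571, 72968915, 95111346, 72223290,
  81617943, 85231922, 85812771, 72049811, 90762034, 85763618, 81021062, 93472918, 93346234,
  42918915, 51075591, 90707478, 72049811, 93472918, 77425187, 59770142, 71513363, 94931258,
  51466759, 88610338, 72917511, 42473650, 67721015, 89970706, 81021062, 72934675, 86075683,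
  60049586, 94669378, 76100487, 80615698, 51075591, 55264391, 90707478, 71510019, 77596806,
  42918915, 76106143, 89031175, 86407442, 59770142, 81617943, 38733575, 93346234, 85071510,
  34085534, 68949150, 42952759, 94426398, 89031175, 34085534, 67856803, 94799894, 71510019,
  77596806, 67721015, 76241283, 89970706, 93936187, 90573078, 90762034, 77415715, 94693922,
  55271939, 92800662, 85014183, 71513363, 81435170, 72047107, 85027131, 38733575, 72917511,
  42473650, 68949150, 76100487, 51075591, 90707478, 85231930, 81021062, 90704022, 89065271,
  86075679, 38733575, 86264222, 94665282, 89290810, 42918915, 59770142, 86075683, 86014794,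
  30097923, 84411286, 30073991, 81597715, 34494214, 51466759, 88610338, 80683527, 69031071,
  55264391, 58938899, 68999838, 85727922, 60036626, 81532178, 86407442, 67721015, 71510019,
  85071510, 81323271, 89970706, 77596806, 72047107, 60037554, 90704022, 85762225]

/-- A flip sequence from the twisted product triangulation of `B₄` to a triangulation with
`17` vertices, in the encoding of `runFlips`. -/
def flipsFour : List ℕ := [
  96553103, 33867011, 86129538, 51643402, 89078023, 82057886, 33731715, 38463111, 47318022,
  46711179, 73163399, 50734482, 25827514, 73235239, 99391674, 88942727, 60429462, 73298563,
  73027847, 21239990, 30017726, 77732506, 72829351, 69104275, 86415534, 69079954, 73027979,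
  73007758, 73011850, 59699971, 63702814, 68698507, 17180722, 85947943, 98081342, 81483171,
  81439406, 96688655, 90717062, 33731715, 42996866, 75847815, 90315018, 68909731, 99256374,
  51046035, 64509586, 38238791, 93469638, 96688655, 98572942, 37790727, 68901283, 47318022,
  98622114, 84883587, 77023659, 55370375, 73032326, 21165587, 64504454, 86419758, 80169127,
  86153614, 81922590, 75847815, 90315018, 88565899, 94513806, 68698507, 68686350, 69124614,
  68682250, 68704146, 92494347, 72702247, 94509706, 72648998, 84883587, 81922590, 59210535,
  99391246, 73192215, 55335098, 94336803, 98339646, 89221683, 94948002, 55109143, 60315282,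
  42386827, 34044739, 55850378, 99419150, 60085383, 68495523, 93673127, 77760554, 55711530,
  73192199, 68368547, 55318714, 94546598, 81954854, 21170079, 69104262, 94722219, 94640838,
  63505943, 68704146, 73192215, 73298563, 73143962, 73462678, 73323138, 94853419, 94771914,
  94821034, 71893783, 73155350, 33731715, 42996866, 93796011, 97994279, 34002307, 85498798,
  33953154, 81439534, 72942227, 73320470, 73187986, 73058198, 51189523, 96551303, 73192981,
  73156122, 84286338, 81348007, 81308206, 76769451, 76712106, 34404099, 98780303, 64750618,
  99423374, 77293995, 94808374, 46454031, 99042855, 55850378, 85498830, 80135595, 81409450,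
  96532131, 80754350, 64654210, 34404099, 64750618, 34137603, 60294162, 76088067, 77744154,
  68503843, 96823439, 94518154, 86280234, 38598407, 72688803, 38221219, 77492999, 51526062,
  77464474, 64754842, 38147630, 38809773, 55515011, 73270942, 76712106, 67969539, 73427218,
  68468995, 55383815, 50595882, 73143962, 92358667, 92408330, 72667531, 72619658, 96553103,
  86129538, 68503843, 86280234, 81724295, 82113414, 81983518, 60081155, 81660190, 81981469,
  55383815, 73143962, 51382058, 76088067, 67897618, 76088067, 67897618, 37833159, 86447234,
  68503843, 69014291, 68995218, 86280234, 68945426, 68968465, 60081155, 96553103, 51382058,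
  86129538, 90532231, 60085383, 94771914, 73180806, 94152358, 90007219, 94030522, 37833159,
  86447234, 81618603, 68469131, 94022074, 89225271, 90605622, 68421130, 99042855, 85498830,
  96532259, 64785282, 54749903, 95106694, 99042855, 85498830, 68901283, 51185411, 54749903,
  68819662, 72902714, 98622114, 77293959, 77245262, 98179778, 85682823, 99146374, 85642070,
  99145301, 96532259, 64785282, 68993795, 73459226, 55801779, 98485926, 77423911, 93624634,
  50660611, 68421130, 63362051, 73283202, 96553103, 55798059, 60463914, 96602638, 54618631,
  98175494, 84375683, 98699790, 33857667, 42075146, 34416835, 77792282, 37790727, 94840455,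
  77208398, 42996866, 93668899, 85494570, 34404099, 64750618, 64296591, 73021354, 93651203,
  67373866, 68351495, 64493606, 75970219, 81438990, 51189819, 51120186, 42800903, 73143578,
  99042855, 99031590, 98961990, 37781895, 33952898, 37781895, 77394691, 33952898, 63703354,
  94861479, 77394695, 98736974, 77783814, 68351495, 77334426, 68302342, 84113027, 98175494,
  69019803, 77752378, 93651203, 93589762, 94544134, 93599754, 81602439, 64283783, 81529150,
  59905962, 84358699, 81308174, 85801219, 82053690, 94544265, 50504707, 97872015, 98609934,
  37781895, 42993158, 64296591, 43123718, 69019803, 68946202, 68995226, 73021354, 68993049]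

set_option maxRecDepth 100000

/-- Pure evaluation: every flip is tested on the current list of masks, and the vertices left at the
end are counted. All operations are arithmetic on binary numerals, which keeps long sequences
feasible. -/
theorem runFlips_one :
    runFlips flipsOne (twistedMasks id) (vertexCountTest 17) = true := by
  decide +kernel

theorem runFlips_two :
    runFlips flipsTwo (twistedMasks fun v => halfTurn (flipX (flipY v)))
      (vertexCountTest 16) = true := by
  decide +kernel

theorem runFlips_three :
    runFlips flipsThree (twistedMasks fun v => flipX (flipY v)) (vertexCountTest 17) = true := by
  decide +kernel

theorem runFlips_four :
    runFlips flipsFour (twistedMasks halfTurn) (vertexCountTest 17) = true := by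
  decide +kernel

/-- A successful flip sequence from a twisted product triangulating `X` yields a triangulation of
`X` with the tested number of vertices. -/
theorem exists_triangulation_of_runFlips {X : Type*} [TopologicalSpace X] {σ : Equiv.Perm ℕ}
    {f : ℕ → ℕ} (hf : ∀ v ∈ Finset.Icc 1 8, σ v = f v ∧ f v ∈ Finset.Icc 1 8)
    (hX : Nonempty (realization (twistedProduct kleinBottle8 σ) ≃ₜ X)) {cs : List ℕ} {n : ℕ}
    (h : runFlips cs (twistedMasks f) (vertexCountTest n) = true) {G : Set (Equiv.Perm ℕ)}
    (hσ : σ ∈ G) :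
    ∃ K : PreAbstractSimplicialComplex (ℕ × ℕ), IsTriangulation K X ∧ (vertices K).ncard = n ∧
      ∃ σ ∈ G, IsTriangulation (twistedProduct kleinBottle8 σ) X ∧
        ObtainedByBistellarFlips 3 (twistedProduct kleinBottle8 σ) K := by
  obtain ⟨L, hL, hflips⟩ := runFlips_eq_true h
  rw [← twistedProduct_kleinBottle8 hf] at hflips
  have hT : IsTriangulation (twistedProduct kleinBottle8 σ) X :=
    ⟨by rw [twistedProduct_kleinBottle8 hf]; exact finite_faces_maskComplex _, hX⟩
  exact ⟨maskComplex L, hflips.isTriangulation hT, ncard_of_vertexCountTest hL, σ, hσ, hT, hflips⟩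

end FlatTriangulation

open FlatTriangulation

/-- One gluing from each pair suffices: the identity for the first manifold, the second alternative
for the second, and the first alternative for the other two. -/
theorem mainTheorem2 (i : Fin 4) :
    ∃ K : PreAbstractSimplicialComplex (ℕ × ℕ),
      FlatTriangulation.IsTriangulation K (FlatTriangulation.FlatB i) ∧
      (FlatTriangulation.vertices K).ncard = ![17, 16, 17, 17] i ∧
      ∃ σ ∈ FlatTriangulation.gluings i,
        FlatTriangulation.IsTriangulation
          (FlatTriangulation.twistedProduct FlatTriangulation.kleinBottle8 σ)
          (FlatTriangulation.FlatB i) ∧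
        FlatTriangulation.ObtainedByBistellarFlips 3
          (FlatTriangulation.twistedProduct FlatTriangulation.kleinBottle8 σ) K := by
  match i with
  | 0 =>
    exact exists_triangulation_of_runFlips (fun v hv => ⟨rfl, hv⟩) triangulates_one runFlips_one
      (Or.inl rfl)
  | 1 =>
    exact exists_triangulation_of_runFlips (fun v hv => ⟨gluing_two_apply v, by
      rwa [halfTurn_mem_iff, flipX_mem_iff, flipY_mem_iff]⟩) triangulates_two runFlips_two
      (Or.inr rfl)
  | 2 =>
    exact exists_triangulation_of_runFlips (fun v hv => ⟨gluing_three_apply v, by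
      rwa [flipX_mem_iff, flipY_mem_iff]⟩) triangulates_three runFlips_three (Or.inl rfl)
  | 3 =>
    exact exists_triangulation_of_runFlips (fun v hv => ⟨gluing_four_apply v, by
      rwa [halfTurn_mem_iff]⟩) triangulates_four runFlips_four (Or.inl rfl)
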